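/- **Setting.** A distributed storage has objects (totally ordered), values, replicas, event identifiers and operations; there are infinitely many objects, replicas and event identifiers. An *event* is an initial event or an invocation of an operation on a replica, with an identifier. A *history* is a finite set of events containing exactly one initial event, with a session order $\mathsf{so}$ (transitive, irreflexive, with the initial event first, relating two distinct non-initial events iff they are on the same replica), write-read relations $\mathsf{wr}_x$ (one for each object $x$, with $\mathsf{wr}=\bigcup_x\mathsf{wr}_x$ and $\mathsf{so}\cup\mathsf{wr}$ acyclic) and, for each event, the partial map from objects to the values it writes. An *abstract execution* adds a receive-before relation $\mathsf{rb}$ (irreflexive, asymmetric, $\mathsf{rb}=\mathsf{rb};\mathsf{so}^*$) and a total arbitration order $\mathsf{ar}$ with $\mathsf{so}\cup\mathsf{wr}\subseteq\mathsf{rb}\subseteq\mathsf{ar}$. A *context* is a finite set of events with relations $\mathsf{rb}\subseteq\mathsf{ar}$, where $\mathsf{rb}$ is irreflexive and asymmetric and $\mathsf{ar}$ is a strict total order. A *visibility formula* of length $n\ge 1$ consists of relations $\mathsf{Rel}_1,\dots,\mathsf{Rel}_n$ built from $\mathsf{id},\mathsf{so},\mathsf{wr},\mathsf{rb},\mathsf{ar}$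 by $\cup$, $;$, $(\cdot)^+$, and finitely many predicates $\mathsf{conflict}(E)$, $\mathsf{conflict}_x(E)$ with $E\subseteq\{\varepsilon_0,\dots,\varepsilon_n\}$, some $\mathsf{conflict}_x(E)$ having $\varepsilon_0\in E$. It holds for an object $x$ at events $\varepsilon_0,\dots,\varepsilon_n$ if $(\varepsilon_{i-1},\varepsilon_i)\in\mathsf{Rel}_i$ for all $i$, $\mathsf{wr}_x^{-1}(\varepsilon_n)\neq\emptyset$, the events in $E$ all write $x$ for each $\mathsf{conflict}_x(E)$, and they all write some common object for each $\mathsf{conflict}(E)$. For a set $M$ of visibility formulas, the context of $r$ for $x$ is the set of the events $\varepsilon_0$ such that some formula of $M$ holds for $x$ at some $\varepsilon_0,\dots,\varepsilon_n=r$, with the projections of $\mathsf{rb}$ and $\mathsf{ar}$. The set $M$ is *arbitration-free* if $\mathsf{ar}$ occurs in no formula of $M$. An *operation specification* $\mathsf{OpSpec}$ consists of a set of events and functions $\mathsf{rspec}$ (the events read from a context, for each event and object), $\mathsf{extract}$ (the value obtained from the events read and the values they wrote; it may be undefined) and $\mathsf{wspec}$ (the value written, if any). The initial event reads nothing and writes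 every object; an event that reads $x$ (that is, $\mathsf{rspec}$ is nonempty for $x$ in some context) reads at least one event for $x$ in every nonempty context. An abstract execution is *valid* w.r.t. $(M,\mathsf{OpSpec})$ if its events belong to $\mathsf{OpSpec}$, $\mathsf{wr}_x^{-1}(r)$ is $\mathsf{rspec}$ applied to the context of $r$ for $x$ and is nonempty whenever $r$ reads $x$, and the values written are those determined by $\mathsf{extract}$ and $\mathsf{wspec}$. It is an *execution over* $\mathsf{OpSpec}$ if the same is true with, for every event $r$ and object $x$, some context formed by events writing $x$ in place of the one defined by $M$. Two sets of formulas are *$\mathsf{OpSpec}$-equivalent* if they have the same valid abstract executions. A *consistency model* is a set of visibility formulas one of which contains $\mathsf{so}$ and one of which contains $\mathsf{wr}$ (on executions over $\mathsf{OpSpec}$, from events writing $x$ to events reading $x$). A *normal form* of a consistency model $\mathsf{CMod}$ w.r.t. $\mathsf{OpSpec}$ is a consistency model $n$ that is $\mathsf{OpSpec}$-equivalent to $\mathsf{CMod}$ and such that: - every relation of a formula of $n$ is one of $\mathsf{so},\mathsf{wr},\mathsf{rb},\mathsf{ar}$; - every $v\in n$ is conflict-maximal: no formula $v'$ obtained from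 $v$ by enlarging the set of one conflict predicate, or by removing a predicate $\mathsf{conflict}(E)$ when $\mathsf{conflict}_x(E)$ is present, holds at all $x,\varepsilon_0,\dots,\varepsilon_n$ at which $v$ does, in all executions over $\mathsf{OpSpec}$; - no $v\in n$ is vacuous: $n$ and $n\setminus\{v\}$ are not $\mathsf{OpSpec}$-equivalent; - $n$ is closed under causal suffixes: for every $v\in n$ and every $k<\mathrm{len}(v)$ such that $\varepsilon_k$ occurs in a $\mathsf{conflict}_x$ predicate of $v$ and the suffix of $v$ from $\varepsilon_k$ is arbitration-free, some $v'\in n$ of the same length as this suffix has relations that are stronger or equal (by $\mathsf{so},\mathsf{wr}\le\mathsf{rb}\le\mathsf{ar}$) and holds wherever the suffix holds in executions over $\mathsf{OpSpec}$. $\mathsf{CMod}$ is *arbitration-free w.r.t. $\mathsf{OpSpec}$* if some normal form of $\mathsf{CMod}$ is arbitration-free. **Assumptions on $\mathsf{OpSpec}$.** For a non-initial event $e$, let $\mathrm{var}(e)$ be the set of objects that $e$ reads or, in some nonempty context, writes; a *domain* is a finite set $\mathrm{var}(e)$. Reads and writes are non-initial events that read, respectively possibly write, some object; a read-write is both, and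 it is conditional if it does not, in every nonempty context, write every object of $\mathrm{var}(e)$. 1. $\mathrm{var}(e)$ is finite for every non-initial event $e$. 2. $\mathsf{rspec}$ is maximally layered: for some $k\in\mathbb N\cup\{\infty\}$ and one of the orders $\mathsf{ar}$, $\mathsf{rb}^+$, it always returns either $\emptyset$ or all the events of the context whose layer is at most $k$. Here the layer of $a$ is the size of the largest chain that has $a$ as its least element and contains a maximal element of the context. 3. Operation closure: there are reads and writes; every non-initial event has a copy on every replica with every identifier; if $D$ is a domain, $x\in D$ and $y\notin D$, then $(D\setminus\{x\})\cup\{y\}$ is a domain; and for each kind (read, write, read-write), if some event of that kind accesses exactly one object then there is one accessing exactly $\{x\}$ for each object $x$, and if some event of that kind accesses several objects then there is one accessing exactly $D$ for each nonempty finite set $D$ of objects. 4. Correctors: if there are conditional read-writes, then for every consistency model $M$, every abstract execution $\xi$ valid w.r.t. $(M,\mathsf{OpSpec})$, every slot (a replica, the set of events received before it, and the events to be read for each object) for a new $\mathsf{ar}$-last event, every domain $D$, every $W\subseteq D$ and every $x\in D$ with $x\in W$ if $W\neq\emptyset$, there are a fresh conditional read-write $e$ on that replica with $\mathrm{var}(e)=D$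 and an injective partial mapping $a$ from $D\setminus\{x\}$ to fresh events other than $e$ on that replica with the following property. Append the events $a(y)$, in increasing order of $y$, and then $e$, at the slot (each receives the events received at the slot and the previous correcting events, and reads as the slot says for the objects it reads that are not yet corrected). Whenever the result of appending the events up to and including $a(y)$ is valid, $a(y)$ writes $y$ and no other object; whenever the final result is valid, $e$ reads every object of $D$ and the objects of $D$ that it writes are exactly those of $W$. **Theorem.** Let $\mathsf{OpSpec}$ be an operation specification satisfying these assumptions and $\mathsf{CMod}$ a consistency model. If $n_1$ and $n_2$ are normal forms of $\mathsf{CMod}$ w.r.t. $\mathsf{OpSpec}$, then $n_1$ is arbitration-free if and only if $n_2$ is. Hence arbitration-freeness is a well-defined property of $(\mathsf{CMod},\mathsf{OpSpec})$: for every normal form $n$ of $\mathsf{CMod}$, $\mathsf{CMod}$ is arbitration-free w.r.t. $\mathsf{OpSpec}$ if and only if $n$ is arbitration-free. -/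

import Mathlib

universe u

namespace DistStore

/-! ### Events -/

/-- The basic sets of a distributed storage: objects, values, replica identifiers, event
identifiers, operations (a name together with all further metadata of the invocation), and
initial states. -/
structure StorageSig where
  Obj : Type u
  Val : Type u
  Replica : Type u
  Id : Type u
  Op : Type u
  Init : Type u

/-- An event is an initial event or the invocation of an operation on a replica. The mapping
of the values written by an event is recorded in the history that contains the event. -/
inductive Event (S : StorageSig.{u}) : Type u where
  | init (s : S.Init) : Event S
  | call (id : S.Id) (replica : S.Replica) (op : S.Op) : Event S

namespace Event

variable {S : StorageSig.{u}}

def IsInit : Event S → Prop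
  | init _ => True
  | call _ _ _ => False

/-- The replica of a non-initial event. -/
def replica? : Event S → Option S.Replica
  | init _ => none
  | call _ r _ => some r

/-- The identifier of a non-initial event. -/
def id? : Event S → Option S.Id
  | init _ => none
  | call i _ _ => some i

end Event

/-! ### Contexts and layers -/

/-- A context: a finite set of events with a receive-before and an arbitration relation. -/
structure Context (α : Type u) where
  events : Set α
  rb : α → α → Prop
  ar : α → α → Prop
  finite : events.Finite
  rb_mem : ∀ a b, rb a b → a ∈ events ∧ b ∈ events
  rb_irrefl : ∀ a, ¬ rb a a
  rb_asymm : ∀ a b, rb a b → ¬ rb b a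
  ar_mem : ∀ a b, ar a b → a ∈ events ∧ b ∈ events
  ar_irrefl : ∀ a, ¬ ar a a
  ar_trans : ∀ a b c, ar a b → ar b c → ar a c
  ar_total : ∀ a ∈ events, ∀ b ∈ events, a ≠ b → ar a b ∨ ar b a
  rb_le_ar : ∀ a b, rb a b → ar a b

/-- The layer of `a` in the set `A` strictly ordered by `R`: the size of the largest chain
that includes `a`, no element smaller than `a`, and a maximal element of `A`. -/
noncomputable def layer {α : Type u} (R : α → α → Prop) (A : Set α) (a : α) : ℕ∞ :=
  ⨆ C ∈ {C : Set α | C ⊆ A ∧ a ∈ C ∧ (∀ b ∈ C, ∀ c ∈ C, b ≠ c → R b c ∨ R c b) ∧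
      (∀ b ∈ C, ¬ R b a) ∧ ∃ m ∈ C, ∀ b ∈ A, ¬ R m b}, C.encard

/-- `B` consists of the elements of `A` of layer at most `k`; for `k = ⊤` it is all of `A`. -/
def IsMaximallyLayered {α : Type u} (k : ℕ∞) (R : α → α → Prop) (A B : Set α) : Prop :=
  B = {a ∈ A | layer R A a ≤ k}

/-! ### Histories and abstract executions -/

/-- A history. `wr x r` is the set of events that `r` reads for the object `x`, that is, the
value at `r` of the inverse of the write-read relation of `x`. `wval e x` is the value that
`e` writes to `x`, if any. -/
structure History (S : StorageSig.{u}) where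
  events : Set (Event S)
  so : Event S → Event S → Prop
  wr : S.Obj → Event S → Set (Event S)
  wval : Event S → S.Obj → Option S.Val
  finite : events.Finite
  so_mem : ∀ a b, so a b → a ∈ events ∧ b ∈ events
  so_irrefl : ∀ a, ¬ so a a
  so_trans : ∀ a b c, so a b → so b c → so a c
  exists_init : ∃ i ∈ events, i.IsInit ∧ (∀ e ∈ events, e.IsInit → e = i) ∧
    ∀ e ∈ events, e ≠ i → so i e
  so_iff : ∀ a ∈ events, ∀ b ∈ events, ¬ a.IsInit → ¬ b.IsInit → a ≠ b →
    ((so a b ∨ so b a) ↔ a.replica? = b.replica?)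
  wr_mem : ∀ x w r, w ∈ wr x r → w ∈ events ∧ r ∈ events
  acyclic : ∀ a, ¬ Relation.TransGen (fun b c => so b c ∨ ∃ x, b ∈ wr x c) a a

/-- An abstract execution of a history. -/
structure Execution (S : StorageSig.{u}) extends History S where
  rb : Event S → Event S → Prop
  ar : Event S → Event S → Prop
  rb_irrefl : ∀ a, ¬ rb a a
  rb_asymm : ∀ a b, rb a b → ¬ rb b a
  rb_comp_so : ∀ a b, rb a b ↔ ∃ c, rb a c ∧ Relation.ReflTransGen so c b
  ar_mem : ∀ a b, ar a b → a ∈ events ∧ b ∈ events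
  ar_irrefl : ∀ a, ¬ ar a a
  ar_trans : ∀ a b c, ar a b → ar b c → ar a c
  ar_total : ∀ a ∈ events, ∀ b ∈ events, a ≠ b → ar a b ∨ ar b a
  so_le_rb : ∀ a b, so a b → rb a b
  wr_le_rb : ∀ x a b, a ∈ wr x b → rb a b
  rb_le_ar : ∀ a b, rb a b → ar a b

namespace Execution

variable {S : StorageSig.{u}}

/-- The event `e` writes the object `x`. -/
def Writes (ξ : Execution S) (e : Event S) (x : S.Obj) : Prop :=
  ∃ u, ξ.wval e x = some u

/-- The context formed by a set `A` of events of `ξ` with the projections of `rb` and `ar`. -/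
def restrict (ξ : Execution S) (A : Set (Event S)) : Context (Event S) where
  events := {e ∈ ξ.events | e ∈ A}
  rb a b := ξ.rb a b ∧ a ∈ A ∧ b ∈ A
  ar a b := ξ.ar a b ∧ a ∈ A ∧ b ∈ A
  finite := ξ.finite.subset (fun _ h => h.1)
  rb_mem a b h :=
    ⟨⟨(ξ.ar_mem a b (ξ.rb_le_ar a b h.1)).1, h.2.1⟩,
      ⟨(ξ.ar_mem a b (ξ.rb_le_ar a b h.1)).2, h.2.2⟩⟩
  rb_irrefl a h := ξ.rb_irrefl a h.1
  rb_asymm a b h h' := ξ.rb_asymm a b h.1 h'.1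
  ar_mem a b h := ⟨⟨(ξ.ar_mem a b h.1).1, h.2.1⟩, ⟨(ξ.ar_mem a b h.1).2, h.2.2⟩⟩
  ar_irrefl a h := ξ.ar_irrefl a h.1
  ar_trans a b c h h' := ⟨ξ.ar_trans a b c h.1 h'.1, h.2.1, h'.2.2⟩
  ar_total a ha b hb hab :=
    (ξ.ar_total a ha.1 b hb.1 hab).imp (fun h => ⟨h, ha.2, hb.2⟩) (fun h => ⟨h, hb.2, ha.2⟩)
  rb_le_ar a b h := ⟨ξ.rb_le_ar a b h.1, h.2⟩

end Execution

/-! ### Visibility formulas -/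

/-- The grammar of relations. -/
inductive RelExpr : Type where
  | id : RelExpr
  | so : RelExpr
  | wr : RelExpr
  | rb : RelExpr
  | ar : RelExpr
  | union (p q : RelExpr) : RelExpr
  | comp (p q : RelExpr) : RelExpr
  | plus (p : RelExpr) : RelExpr

namespace RelExpr

/-- Reflexive closure, as syntactic sugar. -/
def opt (p : RelExpr) : RelExpr := union id p

/-- Reflexive transitive closure, as syntactic sugar. -/
def star (p : RelExpr) : RelExpr := union id (plus p)

/-- The interpretation of a relation in an abstract execution. -/
def interp {S : StorageSig.{u}} (ξ : Execution S) : RelExpr → Event S → Event S → Prop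
  | id => fun a b => a = b
  | so => ξ.so
  | wr => fun a b => ∃ x, a ∈ ξ.wr x b
  | rb => ξ.rb
  | ar => ξ.ar
  | union p q => fun a b => p.interp ξ a b ∨ q.interp ξ a b
  | comp p q => Relation.Comp (p.interp ξ) (q.interp ξ)
  | plus p => Relation.TransGen (p.interp ξ)

/-- Relations without composition operators. -/
def IsSimple (p : RelExpr) : Prop := p = so ∨ p = wr ∨ p = rb ∨ p = ar

/-- The arbitration relation does not occur. -/
def ArbitrationFree : RelExpr → Prop
  | id => True
  | so => True
  | wr => True
  | rb => True
  | ar => False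
  | union p q => p.ArbitrationFree ∧ q.ArbitrationFree
  | comp p q => p.ArbitrationFree ∧ q.ArbitrationFree
  | plus p => p.ArbitrationFree

/-- `StrongerEq q p`: the relation `q` is stronger than or equal to `p`. -/
inductive StrongerEq : RelExpr → RelExpr → Prop where
  | refl (p) : StrongerEq p p
  | rb_so : StrongerEq rb so
  | rb_wr : StrongerEq rb wr
  | ar_so : StrongerEq ar so
  | ar_wr : StrongerEq ar wr
  | ar_rb : StrongerEq ar rb
  | union {p q p' q'} : StrongerEq p' p → StrongerEq q' q →
      StrongerEq (union p' q') (union p q)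
  | comp {p q p' q'} : StrongerEq p' p → StrongerEq q' q →
      StrongerEq (comp p' q') (comp p q)
  | plus {p p'} : StrongerEq p' p → StrongerEq (plus p') (plus p)

end RelExpr

/-- A visibility formula in the variables `ε 0, …, ε n`, `n` being the length of `rels`. The
`i`-th entry of `rels` relates `ε i` and `ε (i + 1)`. The sets in `conf` and in `confx` are the
sets of (indices of) variables of the conflict predicates and of the conflict predicates on
the object `x`, respectively. -/
@[ext] structure VisFormula where
  rels : List RelExpr
  conf : Finset (Finset ℕ)
  confx : Finset (Finset ℕ)

namespace VisFormula

/-- Well-formedness: there is at least one relation, conflict predicates use only the variables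
of the formula, and some conflict predicate on `x` includes the variable `ε 0`. -/
structure WellFormed (v : VisFormula) : Prop where
  length_pos : 0 < v.rels.length
  conf_le : ∀ E ∈ v.conf, ∀ i ∈ E, i ≤ v.rels.length
  confx_le : ∀ E ∈ v.confx, ∀ i ∈ E, i ≤ v.rels.length
  head : ∃ E ∈ v.confx, 0 ∈ E

/-- `v` holds for the object `x` in `ξ`, the variables being instantiated by `ε`. -/
structure HoldsAt {S : StorageSig.{u}} (v : VisFormula) (ξ : Execution S) (x : S.Obj)
    (ε : ℕ → Event S) : Prop where
  mem : ∀ i ≤ v.rels.length, ε i ∈ ξ.events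
  rel : ∀ (i : ℕ) (hi : i < v.rels.length), (v.rels[i]).interp ξ (ε i) (ε (i + 1))
  reads : (ξ.wr x (ε v.rels.length)).Nonempty
  confx : ∀ E ∈ v.confx, ∀ i ∈ E, ξ.Writes (ε i) x
  conf : ∀ E ∈ v.conf, ∃ y, ∀ i ∈ E, ξ.Writes (ε i) y

/-- The binary relation described by `v` for the object `x`. -/
def Holds {S : StorageSig.{u}} (v : VisFormula) (ξ : Execution S) (x : S.Obj)
    (e r : Event S) : Prop :=
  ∃ ε : ℕ → Event S, ε 0 = e ∧ ε v.rels.length = r ∧ v.HoldsAt ξ x ε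

def IsSimple (v : VisFormula) : Prop := ∀ p ∈ v.rels, p.IsSimple

def ArbitrationFree (v : VisFormula) : Prop := ∀ p ∈ v.rels, p.ArbitrationFree

/-- The projection of a set of variables to `ε k, …, ε n`, renumbered from `0`. -/
def shift (k : ℕ) (E : Finset ℕ) : Finset ℕ := (E.filter (k ≤ ·)).image (· - k)

/-- The `ε k`-suffix of a visibility formula. -/
def suffix (v : VisFormula) (k : ℕ) : VisFormula where
  rels := v.rels.drop k
  conf := v.conf.image (shift k)
  confx := v.confx.image (shift k)

/-- `v'` is a conflict-strengthening of `v`: one set of variables of a conflict predicate is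
replaced by a strict superset, or a conflict predicate is removed that also occurs as a
conflict predicate on `x`. -/
def IsConflictStrengthening (v v' : VisFormula) : Prop :=
  v'.WellFormed ∧ v'.rels = v.rels ∧
    ((∃ E ∈ v.conf, ∃ E', E ⊂ E' ∧ v'.conf = insert E' (v.conf.erase E) ∧
        v'.confx = v.confx) ∨
      (∃ E ∈ v.confx, ∃ E', E ⊂ E' ∧ v'.confx = insert E' (v.confx.erase E) ∧
        v'.conf = v.conf) ∨
      (∃ E ∈ v.conf, E ∈ v.confx ∧ v'.conf = v.conf.erase E ∧ v'.confx = v.confx))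

end VisFormula

/-- All visibility formulas of a set are arbitration-free. -/
def ArbitrationFree (M : Set VisFormula) : Prop := ∀ v ∈ M, v.ArbitrationFree

/-- The context of the event `r` for the object `x`. -/
def Execution.context {S : StorageSig.{u}} (ξ : Execution S) (M : Set VisFormula) (x : S.Obj)
    (r : Event S) : Context (Event S) :=
  ξ.restrict {e | ∃ v ∈ M, v.Holds ξ x e r}

/-! ### Operation specifications -/

/-- An operation specification: a set of events with a read, an extract and a write
specification. `none` stands for an undefined value. -/
structure OpSpec (S : StorageSig.{u}) where
  events : Set (Event S)
  rspec : Event S → S.Obj → Context (Event S) → Set (Event S)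
  extract : Event S → S.Obj → Set (Event S × S.Val) → Option S.Val
  wspec : Event S → S.Obj → Option S.Val → Option S.Val
  rspec_subset : ∀ e x c, rspec e x c ⊆ c.events
  rspec_init : ∀ e x c, e.IsInit → rspec e x c = ∅
  rspec_unconditional : ∀ e x, (∃ c, (rspec e x c).Nonempty) →
    ∀ c : Context (Event S), c.events.Nonempty → (rspec e x c).Nonempty
  extract_init : ∀ e x R, e.IsInit → (extract e x R).isSome
  wspec_init : ∀ e x u, e.IsInit → (wspec e x (some u)).isSome

namespace OpSpec

variable {S : StorageSig.{u}} (O : OpSpec S)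

/-- The value that `e` writes to `x` when it reads the set of events `R` of the execution `ξ`
for `x`. -/
def writtenValue (ξ : Execution S) (e : Event S) (x : S.Obj) (R : Set (Event S)) :
    Option S.Val :=
  O.wspec e x (O.extract e x {p | p.1 ∈ R ∧ ξ.wval p.1 x = some p.2})

/-- The event `e` reads the object `x`. -/
def Reads (e : Event S) (x : S.Obj) : Prop := ∃ c, (O.rspec e x c).Nonempty

/-- Validity of an abstract execution w.r.t. the storage specification `(M, O)`. An event
that reads `x` has an actual write-read dependency for `x`. -/
structure Valid (M : Set VisFormula) (ξ : Execution S) : Prop where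
  events_subset : ξ.events ⊆ O.events
  reads_nonempty : ∀ r ∈ ξ.events, ∀ x, O.Reads r x → (ξ.wr x r).Nonempty
  wr_eq : ∀ r ∈ ξ.events, ∀ x, ξ.wr x r = O.rspec r x (ξ.context M x r)
  wval_eq : ∀ e ∈ ξ.events, ∀ x,
    ξ.wval e x = O.writtenValue ξ e x (O.rspec e x (ξ.context M x e))

/-- The abstract executions over the operation specification: every event reads according to
the read specification, in some context of events that write the object in question, and
writes according to the extract and write specifications. No consistency model is involved. -/
structure IsExecution (ξ : Execution S) : Prop where
  events_subset : ξ.events ⊆ O.events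
  reads_nonempty : ∀ r ∈ ξ.events, ∀ x, O.Reads r x → (ξ.wr x r).Nonempty
  wr_eq : ∀ r ∈ ξ.events, ∀ x, ∃ A : Set (Event S), (∀ e ∈ A, ξ.Writes e x) ∧
    ξ.wr x r = O.rspec r x (ξ.restrict A)
  wval_eq : ∀ e ∈ ξ.events, ∀ x, ξ.wval e x = O.writtenValue ξ e x (ξ.wr x e)

/-! #### Kinds of events -/

/-- The value written by `e` to `x` when executed in the context `c` whose events have written
the values `val` to `x`. -/
def outcome (e : Event S) (x : S.Obj) (c : Context (Event S)) (val : Event S → S.Val) :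
    Option S.Val :=
  O.wspec e x (O.extract e x {p | p.1 ∈ O.rspec e x c ∧ p.2 = val p.1})

/-- The event `e` writes the object `x` for at least one value read. -/
def MayWrite (e : Event S) (x : S.Obj) : Prop :=
  ∃ c : Context (Event S), c.events.Nonempty ∧ ∃ val, (O.outcome e x c val).isSome

/-- The event `e` writes the object `x` whatever values it reads. -/
def AlwaysWrites (e : Event S) (x : S.Obj) : Prop :=
  ∀ c : Context (Event S), c.events.Nonempty → ∀ val, (O.outcome e x c val).isSome

/-- The set of objects that `e` accesses (reads or writes). -/
def var (e : Event S) : Set S.Obj := {x | O.Reads e x ∨ O.MayWrite e x}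

def IsRead (e : Event S) : Prop := e ∈ O.events ∧ ¬ e.IsInit ∧ ∃ x, O.Reads e x

def IsWrite (e : Event S) : Prop := e ∈ O.events ∧ ¬ e.IsInit ∧ ∃ x, O.MayWrite e x

def IsReadWrite (e : Event S) : Prop := O.IsRead e ∧ O.IsWrite e

/-- A read-write event that does not unconditionally write all objects that it accesses. -/
def IsConditionalReadWrite (e : Event S) : Prop :=
  O.IsReadWrite e ∧ ∃ x ∈ O.var e, ¬ O.AlwaysWrites e x

/-- `D` is the set of objects accessed by some non-initial event. -/
def IsDomain (D : Finset S.Obj) : Prop := ∃ e ∈ O.events, ¬ e.IsInit ∧ O.var e = ↑D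

/-! #### Consistency models and normal forms -/

/-- A consistency model is a set of visibility formulas, one of which contains the session
order and one of which contains the write-read relation (in the executions over `O`, from
events that write `x` to events that read `x`). -/
structure IsConsistencyModel (M : Set VisFormula) : Prop where
  wellFormed : ∀ v ∈ M, v.WellFormed
  so_visible : ∃ v ∈ M, ∀ ξ : Execution S, O.IsExecution ξ → ∀ x e r, ξ.so e r →
    ξ.Writes e x → (ξ.wr x r).Nonempty → v.Holds ξ x e r
  wr_visible : ∃ v ∈ M, ∀ ξ : Execution S, O.IsExecution ξ → ∀ x e r, e ∈ ξ.wr x r →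
    ξ.Writes e x → v.Holds ξ x e r

/-- `O`-equivalence of consistency models. -/
def Equivalent (M M' : Set VisFormula) : Prop :=
  ∀ ξ : Execution S, O.Valid M ξ ↔ O.Valid M' ξ

def IsVacuous (M : Set VisFormula) (v : VisFormula) : Prop :=
  ∀ ξ : Execution S, O.Valid M ξ ↔ O.Valid (M \ {v}) ξ

def IsConflictMaximal (v : VisFormula) : Prop :=
  ¬ ∃ v', v.IsConflictStrengthening v' ∧
    ∀ ξ : Execution S, O.IsExecution ξ → ∀ x ε, v.HoldsAt ξ x ε → v'.HoldsAt ξ x ε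

/-- The set `M` of visibility formulas is in normal form w.r.t. `O`. -/
structure InNormalForm (M : Set VisFormula) : Prop where
  simple : ∀ v ∈ M, v.IsSimple
  conflictMaximal : ∀ v ∈ M, O.IsConflictMaximal v
  not_vacuous : ∀ v ∈ M, ¬ O.IsVacuous M v

/-- `v'` subsumes `v`: it has the same length, its relations are stronger than or equal to
those of `v`, and it does not impose write constraints that `v` does not guarantee. -/
def Subsumes (v' v : VisFormula) : Prop :=
  List.Forall₂ RelExpr.StrongerEq v'.rels v.rels ∧
    ∀ ξ : Execution S, O.IsExecution ξ → ∀ x ε, v.HoldsAt ξ x ε → v'.HoldsAt ξ x ε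

/-- Every arbitration-free suffix that starts with a variable occurring in a conflict predicate
on `x` is subsumed. -/
def ClosedUnderCausalSuffixes (M : Set VisFormula) : Prop :=
  ∀ v ∈ M, ∀ k < v.rels.length, (∃ E ∈ v.confx, k ∈ E) → (v.suffix k).ArbitrationFree →
    ∃ v' ∈ M, O.Subsumes v' (v.suffix k)

/-- `n` is a normal form of `M` w.r.t. `O`. Closure under causal suffixes is a standing
assumption about the normal forms of consistency models. -/
structure IsNormalFormOf (n M : Set VisFormula) : Prop where
  isConsistencyModel : O.IsConsistencyModel n
  inNormalForm : O.InNormalForm n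
  closed : O.ClosedUnderCausalSuffixes n
  equivalent : O.Equivalent n M

/-- The consistency model `M` is arbitration-free w.r.t. `O`: some normal form of `M` consists
of arbitration-free visibility formulas. -/
def ArbitrationFreeModel (M : Set VisFormula) : Prop :=
  ∃ n, O.IsNormalFormOf n M ∧ ArbitrationFree n

/-! #### Correctors -/

end OpSpec

/-- `ξ'` is obtained from `ξ` by appending the event `e` as the last one w.r.t. `ar`; the events
received before `e` are those in `past`. -/
structure Execution.IsAppend {S : StorageSig.{u}} (ξ : Execution S) (e : Event S)
    (past : Set (Event S)) (ξ' : Execution S) : Prop where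
  not_mem : e ∉ ξ.events
  events_eq : ξ'.events = insert e ξ.events
  so_iff : ∀ a ∈ ξ.events, ∀ b ∈ ξ.events, ξ'.so a b ↔ ξ.so a b
  rb_iff : ∀ a ∈ ξ.events, ∀ b ∈ ξ.events, ξ'.rb a b ↔ ξ.rb a b
  ar_iff : ∀ a ∈ ξ.events, ∀ b ∈ ξ.events, ξ'.ar a b ↔ ξ.ar a b
  wr_eq : ∀ b ∈ ξ.events, ∀ x, ξ'.wr x b = ξ.wr x b
  wval_eq : ∀ b ∈ ξ.events, ∀ x, ξ'.wval b x = ξ.wval b x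
  ar_last : ∀ a ∈ ξ.events, ξ'.ar a e
  rb_past : ∀ a, ξ'.rb a e ↔ a ∈ past

/-- The dependencies of an event that is going to be appended to an execution: its replica, the
events received before it, and the events that it reads for each object that it reads. -/
structure Slot (S : StorageSig.{u}) where
  replica : S.Replica
  past : Set (Event S)
  reads : S.Obj → Set (Event S)

namespace OpSpec

variable {S : StorageSig.{u}} (O : OpSpec S)

/-- `ξ'` is obtained by appending `b` to `ξ` in the slot `p`, after the correcting events listed
in `l` (each with the object that it corrects). The write-read dependencies given by the slot
are retained for the objects that have not been corrected. -/
structure IsPlaced (p : Slot S) (l : List (S.Obj × Event S)) (ξ : Execution S) (b : Event S)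
    (ξ' : Execution S) : Prop where
  replica : b.replica? = some p.replica
  append : ξ.IsAppend b (p.past ∪ {c | ∃ y, (y, c) ∈ l}) ξ'
  reads : ∀ z, O.Reads b z → (∀ c, (z, c) ∉ l) → ξ'.wr z b = p.reads z

/-- `ξ'` is obtained from `ξ` by adding the correcting events of the list one after the other,
immediately before the slot `p`. -/
inductive IsCorrection (p : Slot S) (ξ : Execution S) :
    List (S.Obj × Event S) → Execution S → Prop where
  | nil : IsCorrection p ξ [] ξ
  | snoc {l : List (S.Obj × Event S)} {ξ₁ ξ₂ : Execution S} {y : S.Obj} {b : Event S} :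
      IsCorrection p ξ l ξ₁ → O.IsPlaced p l ξ₁ b ξ₂ → IsCorrection p ξ (l ++ [(y, b)]) ξ₂

end OpSpec

/-- The sequence of the events to which the partial mapping `a` sends the objects in `T`, in
increasing order of the objects, each with its object. -/
def correctorSeq {S : StorageSig.{u}} [LinearOrder S.Obj] (a : S.Obj → Option (Event S))
    (T : Finset S.Obj) : List (S.Obj × Event S) :=
  (T.sort (· ≤ ·)).filterMap (fun y => (a y).map (fun b => (y, b)))

namespace OpSpec

variable {S : StorageSig.{u}} (O : OpSpec S)

/-- The partial mapping `a` on `D \ {x}` is an execution-corrector for the event `e`, appended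
to `ξ` in the slot `p`, w.r.t. the storage specification `(M, O)`. -/
structure IsExecutionCorrector [LinearOrder S.Obj] (M : Set VisFormula) (ξ : Execution S)
    (p : Slot S) (D W : Finset S.Obj) (x : S.Obj) (e : Event S)
    (a : S.Obj → Option (Event S)) : Prop where
  dom : ∀ y b, a y = some b → y ∈ D ∧ y ≠ x
  fresh : ∀ y b, a y = some b → b ∈ O.events ∧ b ∉ ξ.events ∧ b ≠ e ∧
    b.replica? = some p.replica
  injective : ∀ y y' b, a y = some b → a y' = some b → y = y'
  corrector_writes : ∀ y b, a y = some b → ∀ ξ',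
    O.IsCorrection p ξ (correctorSeq a ((D.erase x).filter (· ≤ y))) ξ' → O.Valid M ξ' →
      ∀ z, ξ'.Writes b z ↔ z = y
  event_writes : ∀ ξ' ξ'', O.IsCorrection p ξ (correctorSeq a (D.erase x)) ξ' →
    O.IsPlaced p (correctorSeq a (D.erase x)) ξ' e ξ'' → O.Valid M ξ'' →
      ∀ y ∈ D, (ξ''.wr y e).Nonempty ∧ (ξ''.Writes e y ↔ y ∈ W)

/-! #### Standing assumptions -/

/-- The read specification is maximally layered w.r.t. the arbitration relation or the
transitive closure of the receive-before relation, with a finite or infinite layer bound. -/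
def MaximallyLayered : Prop :=
  ∃ k : ℕ∞,
    (∀ e x c, O.rspec e x c = ∅ ∨ IsMaximallyLayered k c.ar c.events (O.rspec e x c)) ∨
    (∀ e x c, O.rspec e x c = ∅ ∨
      IsMaximallyLayered k (Relation.TransGen c.rb) c.events (O.rspec e x c))

/-- Operation closure. -/
structure OperationClosure : Prop where
  exists_read : ∃ e, O.IsRead e
  exists_write : ∃ e, O.IsWrite e
  copy : ∀ e ∈ O.events, ¬ e.IsInit → ∀ (r : S.Replica) (i : S.Id), ∃ e' ∈ O.events,
    e'.replica? = some r ∧ e'.id? = some i ∧ O.rspec e' = O.rspec e ∧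
      O.extract e' = O.extract e ∧ O.wspec e' = O.wspec e
  symmetric : ∀ D, O.IsDomain D → ∀ D' : Finset S.Obj,
    (∃ x ∈ D, ∃ y ∉ D, (D' : Set S.Obj) = insert y ((D : Set S.Obj) \ {x})) → O.IsDomain D'
  single : ∀ K ∈ ({O.IsRead, O.IsWrite, O.IsReadWrite} : Set (Event S → Prop)),
    (∃ e x, K e ∧ O.var e = {x}) → ∀ x, ∃ e, K e ∧ O.var e = {x}
  multi : ∀ K ∈ ({O.IsRead, O.IsWrite, O.IsReadWrite} : Set (Event S → Prop)),
    (∃ e, K e ∧ (O.var e).Nontrivial) →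
      ∀ D : Finset S.Obj, D.Nonempty → ∃ e, K e ∧ O.var e = ↑D

/-- If conditional read-writes are allowed, then for every domain `D` and every way of appending
an event to a valid execution there is a conditional read-write on `D` with an
execution-corrector that makes it write exactly the objects in `W`. -/
def HasCorrectors [LinearOrder S.Obj] : Prop :=
  (∃ e, O.IsConditionalReadWrite e) →
    ∀ M, O.IsConsistencyModel M → ∀ ξ : Execution S, O.Valid M ξ → ∀ p : Slot S,
    ∀ D W : Finset S.Obj, ∀ x : S.Obj, O.IsDomain D → W ⊆ D → x ∈ D → (W.Nonempty → x ∈ W) →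
      ∃ e, O.IsConditionalReadWrite e ∧ O.var e = ↑D ∧ e ∉ ξ.events ∧
        e.replica? = some p.replica ∧ ∃ a, O.IsExecutionCorrector M ξ p D W x e a

/-- The standing assumptions about operation specifications. -/
structure StandingAssumptions [LinearOrder S.Obj] : Prop where
  finite_var : ∀ e ∈ O.events, ¬ e.IsInit → (O.var e).Finite
  maximallyLayered : O.MaximallyLayered
  operationClosure : O.OperationClosure
  hasCorrectors : O.HasCorrectors

end OpSpec

end DistStore

open DistStore

/-!
Let `N` be an arbitration-free normal form, `M` an equivalent one, and suppose that a formula `v` of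
`M` contains `ar`. The proof constructs an execution that is valid w.r.t. `N`, and hence w.r.t. `M`,
in which `v` makes an event visible that has to be read but is not.

Valid executions are built by appending events. Two facts make this possible. By maximal layering,
an event that reads `x` reads the events of its context of layer at most `k` (`OpSpec.Selects`); and
whether an event writes an object depends only on what it reads for this object. If every event
receives its session only, then an event sees, by every arbitration-free consistency model, exactly
the writers of its session, so that any event of `O` can be appended (`valid_sessionSnoc`). Let
`ε 0, …, ε i` be appended on one replica and `ε (i + 1), …, ε n` on another one, where the relation
between `ε i` and `ε (i + 1)` is `ar`. All other relations of `v` hold within the sessions, so `v`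
lets `ε n` see `ε 0`. If the last event seen in the first session has layer at most `k`, this
contradicts validity (`false_of_blockStep`). This is always so for layers defined by `rb`. For
layers defined by `ar`, it holds if few events of the second session write `x`, and non-vacuity of
`v` together with closure under causal suffixes bounds the number of variables after the last `ar`
that have to write `x` (`encard_confx_lt`). The chain has to provide the conflicts and the `wr`
edges of `v`:

* if there are conditional read-writes, correctors yield events that write prescribed objects; one
  object is enough for layers defined by `rb` (`false_of_conditional_of_rb`), and domains with up to
  three objects keep the other variables from writing `x` for layers defined by `ar`
  (`false_of_conditional_of_ar`);
* if there are none, the sets of objects written are fixed, and an instance of `v` can be copied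
  (`false_of_rigid_of_rb`).

In the remaining cases (layers defined by `ar`, and no conditional read-writes or none that access
two objects), single events can be simulated on other replicas (`Simulable.exists_event`), but no
domains are available to control the conflicts. Here `v` holds in some valid execution at events
such that `ε n` reads `ε 0` (`Simulable.hasReadInstance`): in an execution that is invalid because
of `v`, the set of events read by the first offending event is replaced by a fixed point of the map
that sends a set of events to what is read when these are the events read. Two interleaved copies of
this execution on disjoint sets of replicas form an execution that is valid w.r.t. `N`
(`Simulable.exists_doubling`). The instance of `v` that changes from the second copy to the first
one at the `ar` lets the first copy of `ε n` see the second copy of `ε 0`, which is arbitrated after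
the first one and therefore has to be read (`Doubling.false_of_ar`).
-/


namespace DistStore

/-! ### Layers -/

theorem exists_maximal_rel {α : Type u} {R : α → α → Prop} (hirr : ∀ a, ¬ R a a)
    (htr : ∀ a b c, R a b → R b c → R a c) {s : Set α} (hs : s.Finite) (hne : s.Nonempty) :
    ∃ m ∈ s, ∀ b ∈ s, ¬ R m b := by
  induction s, hs using Set.Finite.induction_on with
  | empty => exact absurd hne Set.not_nonempty_empty
  | @insert a s _ _ ih =>
    rcases s.eq_empty_or_nonempty with rfl | hs
    · exact ⟨a, by simp, by simpa using hirr a⟩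
    · obtain ⟨m, hm, hmax⟩ := ih hs
      by_cases h : R m a
      · refine ⟨a, by simp, ?_⟩
        rintro b (rfl | hb) hab
        · exact hirr _ hab
        · exact hmax b hb (htr _ _ _ h hab)
      · refine ⟨m, by simp [hm], ?_⟩
        rintro b (rfl | hb)
        · exact h
        · exact hmax b hb

theorem layer_le_encard {α : Type u} (R : α → α → Prop) (A : Set α) (a : α) :
    layer R A a ≤ {c ∈ A | c = a ∨ R a c}.encard := by
  refine iSup₂_le ?_
  rintro C ⟨hCA, haC, hchain, hmin, -⟩
  refine Set.encard_le_encard fun c hc => ⟨hCA hc, ?_⟩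
  by_cases h : c = a
  · exact .inl h
  · exact .inr ((hchain c hc a haC h).resolve_left (hmin c hc))

theorem layer_eq_encard {α : Type u} {R : α → α → Prop} {A : Set α} (hfin : A.Finite)
    (hirr : ∀ a, ¬ R a a) (htr : ∀ a b c, R a b → R b c → R a c)
    (htot : ∀ a ∈ A, ∀ b ∈ A, a ≠ b → R a b ∨ R b a) {a : α} (ha : a ∈ A) :
    layer R A a = {c ∈ A | c = a ∨ R a c}.encard := by
  refine le_antisymm (layer_le_encard R A a) ?_
  refine le_iSup₂_of_le {c ∈ A | c = a ∨ R a c} ⟨fun c hc => hc.1, ⟨ha, .inl rfl⟩,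
    fun b hb c hc hbc => htot b hb.1 c hc.1 hbc, ?_, ?_⟩ le_rfl
  · rintro b ⟨-, rfl | hb⟩ hba
    · exact hirr _ hba
    · exact hirr _ (htr _ _ _ hb hba)
  · obtain ⟨m, hm, hmax⟩ := exists_maximal_rel hirr htr
      (hfin.subset (fun c hc => hc.1 : {c ∈ A | c = a ∨ R a c} ⊆ A)) ⟨a, ha, .inl rfl⟩
    refine ⟨m, hm, fun b hb hmb => hmax b ⟨hb, .inr ?_⟩ hmb⟩
    rcases hm.2 with rfl | h
    · exact hmb
    · exact htr _ _ _ h hmb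

namespace Context

variable {α : Type u} (c : Context α)

/-- The order that defines the layers: arbitration if `b` is true, and the transitive closure of
receive-before otherwise. -/
def ord (b : Bool) : α → α → Prop := if b then c.ar else Relation.TransGen c.rb

/-- The events of the context of layer at most `k`. -/
def pick (b : Bool) (k : ℕ∞) : Set α := {a ∈ c.events | layer (c.ord b) c.events a ≤ k}

/-- The elements of the context that are not arbitrated before `a`. -/
def upper (a : α) : Set α := {d ∈ c.events | d = a ∨ c.ar a d}

theorem ord_le_ar {b : Bool} {a d : α} (h : c.ord b a d) : c.ar a d := by
  cases b
  · simp only [ord, Bool.false_eq_true, if_false] at h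
    induction h with
    | single h => exact c.rb_le_ar _ _ h
    | tail _ h ih => exact c.ar_trans _ _ _ ih (c.rb_le_ar _ _ h)
  · simpa [ord] using h

theorem mem_pick_of_encard_le {b : Bool} {k : ℕ∞} {a : α} (ha : a ∈ c.events)
    (h : (c.upper a).encard ≤ k) : a ∈ c.pick b k := by
  refine ⟨ha, (layer_le_encard _ _ _).trans (le_trans (Set.encard_le_encard ?_) h)⟩
  rintro d ⟨hd, h | h⟩
  · exact ⟨hd, .inl h⟩
  · exact ⟨hd, .inr (c.ord_le_ar h)⟩

/-- An element with nothing received after it is selected, whatever the order is. -/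
theorem mem_pick_of_rb_maximal {k : ℕ∞} (hk : 1 ≤ k) {a : α} (ha : a ∈ c.events)
    (h : ∀ d, ¬ c.rb a d) : a ∈ c.pick false k := by
  refine ⟨ha, (layer_le_encard _ _ _).trans (le_trans (Set.encard_le_encard (t := {a}) ?_)
    (by simpa using hk))⟩
  rintro d ⟨-, rfl | hd⟩
  · rfl
  · simp only [ord, Bool.false_eq_true, if_false] at hd
    obtain ⟨e, he, -⟩ := Relation.TransGen.head'_iff.1 hd
    exact absurd he (h e)

theorem mem_pick_true {k : ℕ∞} {a : α} :
    a ∈ c.pick true k ↔ a ∈ c.events ∧ (c.upper a).encard ≤ k := by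
  refine ⟨fun h => ⟨h.1, ?_⟩, fun h => c.mem_pick_of_encard_le h.1 h.2⟩
  have h1 := h.2
  simp only [ord, if_true] at h1
  rwa [layer_eq_encard c.finite c.ar_irrefl c.ar_trans c.ar_total h.1] at h1

theorem pick_congr {c c' : Context α} (he : c.events = c'.events)
    (hrb : ∀ a d, c.rb a d ↔ c'.rb a d) (har : ∀ a d, c.ar a d ↔ c'.ar a d) (b : Bool) (k : ℕ∞) :
    c.pick b k = c'.pick b k := by
  have h1 : c.rb = c'.rb := funext₂ fun a d => propext (hrb a d)
  have h2 : c.ar = c'.ar := funext₂ fun a d => propext (har a d)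
  simp only [pick, ord, he, h1, h2]

end Context

namespace Execution

variable {S : StorageSig.{u}} (ξ : Execution S)

theorem so_le_ar {a b : Event S} (h : ξ.so a b) : ξ.ar a b := ξ.rb_le_ar _ _ (ξ.so_le_rb _ _ h)

theorem wr_le_ar {x : S.Obj} {a b : Event S} (h : a ∈ ξ.wr x b) : ξ.ar a b :=
  ξ.rb_le_ar _ _ (ξ.wr_le_rb _ _ _ h)

theorem ar_asymm {a b : Event S} (h : ξ.ar a b) : ¬ ξ.ar b a :=
  fun h' => ξ.ar_irrefl _ (ξ.ar_trans _ _ _ h h')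

theorem rb_so {a b c : Event S} (h : ξ.rb a b) (h' : ξ.so b c) : ξ.rb a c :=
  (ξ.rb_comp_so a c).2 ⟨b, h, .single h'⟩

theorem not_ar_init {a i : Event S} (hi : i.IsInit) : ¬ ξ.ar a i := by
  intro h
  obtain ⟨j, hj, hji, huniq, hso⟩ := ξ.exists_init
  obtain ⟨ha, hi'⟩ := ξ.ar_mem _ _ h
  obtain rfl := huniq i hi' hi
  by_cases haj : a = i
  · subst haj; exact ξ.ar_irrefl _ h
  · exact ξ.ar_asymm h (ξ.so_le_ar (hso a ha haj))

theorem init_unique {i j : Event S} (hi : i ∈ ξ.events) (hj : j ∈ ξ.events) (hi' : i.IsInit)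
    (hj' : j.IsInit) : i = j := by
  obtain ⟨k, hk, hki, huniq, hso⟩ := ξ.exists_init
  rw [huniq i hi hi', huniq j hj hj']

theorem init_so {i e : Event S} (hi : i ∈ ξ.events) (hi' : i.IsInit) (he : e ∈ ξ.events)
    (hne : ¬ e.IsInit) : ξ.so i e := by
  obtain ⟨k, hk, hki, huniq, hso⟩ := ξ.exists_init
  rw [huniq i hi hi']
  exact hso e he (fun h => hne (h ▸ hki))

/-- The events that precede, in the session order, a last event on the same replica as `r`. -/
def session (r : Event S) : Set (Event S) :=
  {a ∈ ξ.events | a.IsInit ∨ a.replica? = r.replica?}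

theorem session_subset (r : Event S) : ξ.session r ⊆ ξ.events := fun _ h => h.1

theorem mem_session_of_so {a r : Event S} (h : ξ.so a r) : a ∈ ξ.session r := by
  obtain ⟨ha, hr⟩ := ξ.so_mem _ _ h
  refine ⟨ha, ?_⟩
  by_cases hai : a.IsInit
  · exact .inl hai
  · refine .inr ((ξ.so_iff a ha r hr hai (fun h' => ξ.not_ar_init h' (ξ.so_le_ar h)) ?_).1 (.inl h))
    rintro rfl
    exact ξ.so_irrefl _ h

theorem so_of_session {a r : Event S} (ha : a ∈ ξ.session r) (har : ξ.ar a r) : ξ.so a r := by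
  obtain ⟨ha', h⟩ := ha
  have hr := (ξ.ar_mem _ _ har).2
  have hri : ¬ r.IsInit := fun h' => ξ.not_ar_init h' har
  by_cases hai : a.IsInit
  · exact ξ.init_so ha' hai hr hri
  · refine ((ξ.so_iff a ha' r hr hai hri ?_).2 (h.resolve_left hai)).resolve_right ?_
    · rintro rfl
      exact ξ.ar_irrefl _ har
    · exact fun h' => ξ.ar_asymm har (ξ.so_le_ar h')

end Execution

/-! ### Formulas -/

/-- All requirements for `v` to hold, apart from the one that the last event reads `x`. -/
structure VisFormula.Matches {S : StorageSig.{u}} (v : VisFormula) (ξ : Execution S) (x : S.Obj)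
    (ε : ℕ → Event S) : Prop where
  mem : ∀ i ≤ v.rels.length, ε i ∈ ξ.events
  rel : ∀ (i : ℕ) (hi : i < v.rels.length), (v.rels[i]).interp ξ (ε i) (ε (i + 1))
  confx : ∀ E ∈ v.confx, ∀ i ∈ E, ξ.Writes (ε i) x
  conf : ∀ E ∈ v.conf, ∃ y, ∀ i ∈ E, ξ.Writes (ε i) y

theorem VisFormula.holdsAt_iff {S : StorageSig.{u}} {v : VisFormula} {ξ : Execution S} {x : S.Obj}
    {ε : ℕ → Event S} :
    v.HoldsAt ξ x ε ↔ v.Matches ξ x ε ∧ (ξ.wr x (ε v.rels.length)).Nonempty :=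
  ⟨fun h => ⟨⟨h.mem, h.rel, h.confx, h.conf⟩, h.reads⟩,
    fun h => ⟨h.1.mem, h.1.rel, h.2, h.1.confx, h.1.conf⟩⟩

theorem RelExpr.IsSimple.le_ar {S : StorageSig.{u}} {p : RelExpr} (hp : p.IsSimple)
    {ξ : Execution S} {a b : Event S} (h : p.interp ξ a b) : ξ.ar a b := by
  rcases hp with rfl | rfl | rfl | rfl
  · exact ξ.so_le_ar h
  · obtain ⟨x, hx⟩ := h
    exact ξ.wr_le_ar hx
  · exact ξ.rb_le_ar _ _ h
  · exact h

theorem VisFormula.Matches.ar {S : StorageSig.{u}} {v : VisFormula} (hv : v.IsSimple)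
    {ξ : Execution S} {x : S.Obj} {ε : ℕ → Event S} (h : v.Matches ξ x ε) :
    ∀ {i j : ℕ}, i < j → j ≤ v.rels.length → ξ.ar (ε i) (ε j) := by
  intro i j hij
  induction j, hij using Nat.le_induction with
  | base => exact fun hj => (hv _ (List.getElem_mem (by omega))).le_ar (h.rel i (by omega))
  | succ j hij ih =>
    exact fun hj => ξ.ar_trans _ _ _ (ih (by omega))
      ((hv _ (List.getElem_mem (by omega))).le_ar (h.rel j (by omega)))

/-- The events of the context of `r` for `x` according to `M`, if `r` reads `x`. -/
def Execution.sees {S : StorageSig.{u}} (ξ : Execution S) (M : Set VisFormula) (x : S.Obj)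
    (r : Event S) : Set (Event S) :=
  {e | ∃ v ∈ M, ∃ ε : ℕ → Event S, ε 0 = e ∧ ε v.rels.length = r ∧ v.Matches ξ x ε}

namespace Execution

variable {S : StorageSig.{u}} {ξ : Execution S} {M : Set VisFormula} {x : S.Obj} {r : Event S}

theorem holds_iff {v : VisFormula} {e : Event S} (hr : (ξ.wr x r).Nonempty) :
    v.Holds ξ x e r ↔
      ∃ ε : ℕ → Event S, ε 0 = e ∧ ε v.rels.length = r ∧ v.Matches ξ x ε := by
  constructor
  · rintro ⟨ε, h0, hn, h⟩
    exact ⟨ε, h0, hn, (VisFormula.holdsAt_iff.1 h).1⟩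
  · rintro ⟨ε, h0, hn, h⟩
    exact ⟨ε, h0, hn, VisFormula.holdsAt_iff.2 ⟨h, hn ▸ hr⟩⟩

theorem context_eq (hr : (ξ.wr x r).Nonempty) :
    ξ.context M x r = ξ.restrict (ξ.sees M x r) := by
  unfold context sees
  congr 1
  ext e
  simp only [Set.mem_ofPred_eq, holds_iff hr]

theorem sees_subset : ξ.sees M x r ⊆ ξ.events := by
  rintro e ⟨v, -, ε, rfl, -, h⟩
  exact h.mem 0 (Nat.zero_le _)

theorem sees_writes (hM : ∀ v ∈ M, v.WellFormed) {e : Event S} (he : e ∈ ξ.sees M x r) :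
    ξ.Writes e x := by
  obtain ⟨v, hv, ε, rfl, -, h⟩ := he
  obtain ⟨E, hE, h0⟩ := (hM v hv).head
  exact h.confx E hE 0 h0

theorem sees_ar (hM : ∀ v ∈ M, v.WellFormed) (hs : ∀ v ∈ M, v.IsSimple) {e : Event S}
    (he : e ∈ ξ.sees M x r) : ξ.ar e r := by
  obtain ⟨v, hv, ε, rfl, rfl, h⟩ := he
  exact h.ar (hs v hv) (hM v hv).length_pos le_rfl

theorem sees_mono {M' : Set VisFormula} (h : M' ⊆ M) : ξ.sees M' x r ⊆ ξ.sees M x r := by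
  rintro e ⟨v, hv, H⟩
  exact ⟨v, h hv, H⟩

theorem restrict_events_of_subset {A : Set (Event S)} (h : A ⊆ ξ.events) :
    (ξ.restrict A).events = A := by
  ext e
  exact ⟨fun he => he.2, fun he => ⟨h he, he⟩⟩

end Execution

/-! ### Local characterizations of validity -/

namespace OpSpec

variable {S : StorageSig.{u}} (O : OpSpec S)

/-- The read specification selects the events of layer at most `k`. -/
structure Selects (b : Bool) (k : ℕ∞) : Prop where
  one_le : 1 ≤ k
  reads : ∀ e x c, O.Reads e x → O.rspec e x c = c.pick b k

variable {O}

theorem rspec_eq_empty {e : Event S} {x : S.Obj} (h : ¬ O.Reads e x) (c : Context (Event S)) :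
    O.rspec e x c = ∅ := by
  rw [Set.eq_empty_iff_forall_notMem]
  exact fun a ha => h ⟨c, a, ha⟩

theorem not_reads_of_isInit {e : Event S} (h : e.IsInit) (x : S.Obj) : ¬ O.Reads e x := by
  rintro ⟨c, a, ha⟩
  rw [O.rspec_init e x c h] at ha
  exact ha

end OpSpec

/-- The context that consists of a single event. -/
def singletonContext {α : Type u} (a : α) : Context α where
  events := {a}
  rb _ _ := False
  ar _ _ := False
  finite := Set.finite_singleton a
  rb_mem _ _ h := h.elim
  rb_irrefl _ h := h
  rb_asymm _ _ h _ := h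
  ar_mem _ _ h := h.elim
  ar_irrefl _ h := h
  ar_trans _ _ _ h _ := h
  ar_total _ hb _ hc hbc := absurd (hb.trans hc.symm) hbc
  rb_le_ar _ _ h := h

namespace OpSpec

variable {S : StorageSig.{u}} {O : OpSpec S}

theorem exists_selects (hO : O.MaximallyLayered) (hr : ∃ e, O.IsRead e) :
    ∃ b k, O.Selects b k := by
  have key : ∀ (b : Bool) (k : ℕ∞), (∀ e x c, O.rspec e x c = ∅ ∨
      IsMaximallyLayered k (c.ord b) c.events (O.rspec e x c)) → ∃ b k, O.Selects b k := by
    intro b k h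
    have h' : ∀ e x c, O.Reads e x → O.rspec e x c = c.pick b k := by
      intro e x c hex
      rcases h e x c with h1 | h1
      · rw [h1]
        symm
        rw [Set.eq_empty_iff_forall_notMem]
        intro a ha
        obtain ⟨d, hd⟩ := O.rspec_unconditional e x hex c ⟨a, ha.1⟩
        rw [h1] at hd
        exact hd
      · exact h1
    refine ⟨b, k, ?_, h'⟩
    obtain ⟨e, -, -, x, hx⟩ := hr
    obtain ⟨a, ha⟩ := O.rspec_unconditional e x hx (singletonContext e) ⟨e, rfl⟩
    rw [h' _ _ _ hx] at ha
    obtain ⟨ha1, ha2⟩ := ha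
    obtain rfl : a = e := ha1
    refine le_trans ?_ ha2
    refine le_iSup₂_of_le {a} ⟨subset_rfl, rfl, ?_, ?_, a, rfl, ?_⟩ (by simp)
    · rintro b rfl c rfl hbc
      exact absurd rfl hbc
    · rintro b rfl hb
      exact (singletonContext b).ord_le_ar hb
    · rintro b - hb
      exact (singletonContext a).ord_le_ar hb
  obtain ⟨k, h | h⟩ := hO
  · exact key true k (by simpa [Context.ord] using h)
  · exact key false k (by simpa [Context.ord] using h)

theorem Selects.pick_nonempty {b : Bool} {k : ℕ∞} (h : O.Selects b k) {e : Event S} {x : S.Obj}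
    (hx : O.Reads e x) {c : Context (Event S)} (hc : c.events.Nonempty) : (c.pick b k).Nonempty := by
  rw [← h.reads e x c hx]
  exact O.rspec_unconditional e x hx c hc

variable (O)

/-- The requirements of validity that concern the event `r`. -/
structure ValidAt (b : Bool) (k : ℕ∞) (M : Set VisFormula) (ξ : Execution S) (r : Event S) :
    Prop where
  mem : r ∈ O.events
  nonempty : ∀ x, O.Reads r x → (ξ.wr x r).Nonempty
  reads : ∀ x, O.Reads r x → ξ.wr x r = (ξ.restrict (ξ.sees M x r)).pick b k
  no_reads : ∀ x, ¬ O.Reads r x → ξ.wr x r = ∅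
  wval_eq : ∀ x, ξ.wval r x = O.writtenValue ξ r x (ξ.wr x r)

/-- The requirements on an execution over `O` that concern the event `r`. -/
structure ExecAt (b : Bool) (k : ℕ∞) (ξ : Execution S) (r : Event S) : Prop where
  mem : r ∈ O.events
  nonempty : ∀ x, O.Reads r x → (ξ.wr x r).Nonempty
  reads : ∀ x, O.Reads r x → ∃ A : Set (Event S), (∀ e ∈ A, ξ.Writes e x) ∧
    ξ.wr x r = (ξ.restrict A).pick b k
  no_reads : ∀ x, ¬ O.Reads r x → ξ.wr x r = ∅
  wval_eq : ∀ x, ξ.wval r x = O.writtenValue ξ r x (ξ.wr x r)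

variable {O} {b : Bool} {k : ℕ∞} {M : Set VisFormula} {ξ : Execution S}

theorem Selects.valid_iff (h : O.Selects b k) :
    O.Valid M ξ ↔ ∀ r ∈ ξ.events, O.ValidAt b k M ξ r := by
  constructor
  · intro hv r hr
    have hne := hv.reads_nonempty r hr
    refine ⟨hv.events_subset hr, hne, fun x hx => ?_, fun x hx => ?_, fun x => ?_⟩
    · rw [← Execution.context_eq (hne x hx), ← h.reads r x _ hx]
      exact hv.wr_eq r hr x
    · rw [hv.wr_eq r hr x, rspec_eq_empty hx]
    · rw [hv.wval_eq r hr x, hv.wr_eq r hr x]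
  · intro hv
    have hwr : ∀ r ∈ ξ.events, ∀ x, ξ.wr x r = O.rspec r x (ξ.context M x r) := by
      intro r hr x
      by_cases hx : O.Reads r x
      · rw [h.reads r x _ hx, Execution.context_eq ((hv r hr).nonempty x hx)]
        exact (hv r hr).reads x hx
      · rw [rspec_eq_empty hx, (hv r hr).no_reads x hx]
    refine ⟨fun r hr => (hv r hr).mem, fun r hr => (hv r hr).nonempty, hwr, fun r hr x => ?_⟩
    rw [← hwr r hr x]
    exact (hv r hr).wval_eq x

theorem Selects.isExecution_iff (h : O.Selects b k) :
    O.IsExecution ξ ↔ ∀ r ∈ ξ.events, O.ExecAt b k ξ r := by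
  constructor
  · intro hv r hr
    refine ⟨hv.events_subset hr, hv.reads_nonempty r hr, fun x hx => ?_, fun x hx => ?_,
      hv.wval_eq r hr⟩
    · obtain ⟨A, hA, hA'⟩ := hv.wr_eq r hr x
      exact ⟨A, hA, by rw [hA', h.reads r x _ hx]⟩
    · obtain ⟨A, hA, hA'⟩ := hv.wr_eq r hr x
      rw [hA', rspec_eq_empty hx]
  · intro hv
    refine ⟨fun r hr => (hv r hr).mem, fun r hr => (hv r hr).nonempty, fun r hr x => ?_,
      fun r hr => (hv r hr).wval_eq⟩
    by_cases hx : O.Reads r x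
    · obtain ⟨A, hA, hA'⟩ := (hv r hr).reads x hx
      exact ⟨A, hA, by rw [hA', h.reads r x _ hx]⟩
    · exact ⟨∅, by simp, by rw [rspec_eq_empty hx, (hv r hr).no_reads x hx]⟩

theorem ValidAt.execAt (hM : ∀ v ∈ M, v.WellFormed) {r : Event S} (h : O.ValidAt b k M ξ r) :
    O.ExecAt b k ξ r :=
  ⟨h.mem, h.nonempty, fun x hx => ⟨_, fun _ he => Execution.sees_writes hM he, h.reads x hx⟩,
    h.no_reads, h.wval_eq⟩

theorem Selects.isExecution (h : O.Selects b k) (hM : ∀ v ∈ M, v.WellFormed)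
    (hv : O.Valid M ξ) : O.IsExecution ξ :=
  h.isExecution_iff.2 fun r hr => (h.valid_iff.1 hv r hr).execAt hM

theorem IsExecution.writes_of_mem_wr (h : O.IsExecution ξ) {x : S.Obj} {a r : Event S}
    (ha : a ∈ ξ.wr x r) : ξ.Writes a x := by
  obtain ⟨A, hA, hA'⟩ := h.wr_eq r (ξ.wr_mem _ _ _ ha).2 x
  rw [hA'] at ha
  exact hA a (O.rspec_subset _ _ _ ha).2

theorem IsExecution.reads_of_mem_wr (h : O.IsExecution ξ) {x : S.Obj} {a r : Event S}
    (ha : a ∈ ξ.wr x r) : O.Reads r x := by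
  obtain ⟨A, hA, hA'⟩ := h.wr_eq r (ξ.wr_mem _ _ _ ha).2 x
  rw [hA'] at ha
  exact ⟨_, a, ha⟩

theorem IsExecution.init_writes (h : O.IsExecution ξ) {i : Event S} (hi : i ∈ ξ.events)
    (hi' : i.IsInit) (x : S.Obj) : ξ.Writes i x := by
  have h1 := h.wval_eq i hi x
  unfold Execution.Writes
  rw [← Option.isSome_iff_exists, h1]
  unfold writtenValue
  obtain ⟨u, hu⟩ := Option.isSome_iff_exists.1
    (O.extract_init i x {p | p.1 ∈ ξ.wr x i ∧ ξ.wval p.1 x = some p.2} hi')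
  rw [hu]
  exact O.wspec_init i x u hi'

/-! ### Written objects -/

theorem nonempty_val (O : OpSpec S) (ξ : Execution S) (x : S.Obj) : Nonempty S.Val := by
  obtain ⟨i, -, hi, -⟩ := ξ.exists_init
  obtain ⟨u, -⟩ := Option.isSome_iff_exists.1 (O.extract_init i x ∅ hi)
  exact ⟨u⟩

/-- The value written by an event is an outcome in some nonempty context, provided that the
events read write the object in question. -/
theorem exists_outcome {e : Event S} {x : S.Obj} {R : Set (Event S)} (ξ : Execution S)
    (h1 : O.Reads e x → ∃ c : Context (Event S), c.events.Nonempty ∧ O.rspec e x c = R)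
    (h2 : ¬ O.Reads e x → R = ∅) (h3 : ∀ a ∈ R, ξ.Writes a x) :
    ∃ c : Context (Event S), c.events.Nonempty ∧ ∃ val,
      O.outcome e x c val = O.writtenValue ξ e x R := by
  classical
  obtain ⟨u₀⟩ := nonempty_val O ξ x
  obtain ⟨c, hc, hcR⟩ : ∃ c : Context (Event S), c.events.Nonempty ∧ O.rspec e x c = R := by
    by_cases h : O.Reads e x
    · exact h1 h
    · exact ⟨singletonContext e, ⟨e, rfl⟩, by rw [rspec_eq_empty h, h2 h]⟩
  refine ⟨c, hc, fun a => (ξ.wval a x).getD u₀, ?_⟩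
  unfold outcome writtenValue
  congr 2
  ext ⟨a, w⟩
  simp only [hcR, Set.mem_ofPred_eq]
  refine and_congr_right fun ha => ?_
  obtain ⟨w', hw'⟩ := h3 a ha
  rw [hw']
  simp [eq_comm]

/-- Whether the event writes an object does not depend on the values that it reads. -/
def Rigid (O : OpSpec S) (e : Event S) : Prop := ∀ y, O.MayWrite e y → O.AlwaysWrites e y

theorem rigid_of_not_conditional {e : Event S} (he : e ∈ O.events) (hi : ¬ e.IsInit)
    (h : ¬ O.IsConditionalReadWrite e) : O.Rigid e := by
  intro y hy
  by_cases hr : ∃ x, O.Reads e x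
  · by_contra hA
    exact h ⟨⟨⟨he, hi, hr⟩, he, hi, y, hy⟩, y, .inr hy, hA⟩
  · obtain ⟨c, -, val, hval⟩ := hy
    intro c' _ val'
    have : O.outcome e y c' val' = O.outcome e y c val := by
      unfold outcome
      rw [rspec_eq_empty (fun h => hr ⟨y, h⟩), rspec_eq_empty (fun h => hr ⟨y, h⟩)]
      simp
    rwa [this]

theorem IsExecution.exists_outcome_eq (h : O.IsExecution ξ) {e : Event S} (he : e ∈ ξ.events)
    (x : S.Obj) : ∃ c : Context (Event S), c.events.Nonempty ∧ ∃ val,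
      O.outcome e x c val = ξ.wval e x := by
  rw [h.wval_eq e he x]
  obtain ⟨A, hA, hA'⟩ := h.wr_eq e he x
  refine exists_outcome ξ (fun hx => ?_) (fun hx => ?_) fun a ha => h.writes_of_mem_wr ha
  · refine ⟨_, ?_, hA'.symm⟩
    obtain ⟨a, ha⟩ := h.reads_nonempty e he x hx
    rw [hA'] at ha
    exact ⟨a, O.rspec_subset _ _ _ ha⟩
  · rw [hA', rspec_eq_empty hx]

theorem IsExecution.mayWrite (h : O.IsExecution ξ) {e : Event S} {x : S.Obj} (he : e ∈ ξ.events)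
    (hw : ξ.Writes e x) : O.MayWrite e x := by
  obtain ⟨c, hc, val, hv⟩ := h.exists_outcome_eq he x
  exact ⟨c, hc, val, by rw [hv]; exact Option.isSome_iff_exists.2 hw⟩

theorem IsExecution.writes_of_always (h : O.IsExecution ξ) {e : Event S} {x : S.Obj}
    (he : e ∈ ξ.events) (hw : O.AlwaysWrites e x) : ξ.Writes e x := by
  obtain ⟨c, hc, val, hv⟩ := h.exists_outcome_eq he x
  have := hw c hc val
  rw [hv] at this
  exact Option.isSome_iff_exists.1 this

end OpSpec

/-! ### Transfer of contexts between executions -/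

variable {S : StorageSig.{u}}

/-- Along `φ`, the predecessors for the relation `p` of the events in `B` correspond to the
predecessors of their images. -/
structure Lifts (ξ ξ' : Execution S) (B : Set (Event S)) (φ : Event S → Event S) (p : RelExpr) :
    Prop where
  forth : ∀ a r, r ∈ B → p.interp ξ a r → a ∈ B ∧ p.interp ξ' (φ a) (φ r)
  back : ∀ a' r, r ∈ B → p.interp ξ' a' (φ r) → ∃ a ∈ B, a' = φ a ∧ p.interp ξ a r

/-- An injection of a set `B` of events of `ξ` into the events of `ξ'` that preserves the sets of
objects written. -/
structure WriteEmbedding (ξ ξ' : Execution S) (B : Set (Event S)) (φ : Event S → Event S) :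
    Prop where
  injOn : Set.InjOn φ B
  mem : ∀ a ∈ B, a ∈ ξ.events
  mem' : ∀ a ∈ B, φ a ∈ ξ'.events
  writes : ∀ a ∈ B, ∀ x, ξ'.Writes (φ a) x ↔ ξ.Writes a x

theorem WriteEmbedding.matches_image {ξ ξ' : Execution S} {B : Set (Event S)}
    {φ : Event S → Event S} (hφ : WriteEmbedding ξ ξ' B φ) {v : VisFormula} (hv : v.WellFormed)
    (hp : ∀ p ∈ v.rels, Lifts ξ ξ' B φ p) {x : S.Obj} {ε : ℕ → Event S}
    (h : v.Matches ξ x ε) (hr : ε v.rels.length ∈ B) :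
    (∀ i ≤ v.rels.length, ε i ∈ B) ∧ v.Matches ξ' x (φ ∘ ε) := by
  have hB : ∀ i ≤ v.rels.length, ε i ∈ B := by
    intro i hi
    induction hi using Nat.decreasingInduction with
    | self => exact hr
    | of_succ i hi ih =>
      exact ((hp _ (List.getElem_mem hi)).forth _ _ ih (h.rel i hi)).1
  refine ⟨hB, fun i hi => hφ.mem' _ (hB i hi), fun i hi => ?_, fun E hE i hi => ?_,
    fun E hE => ?_⟩
  · exact ((hp _ (List.getElem_mem hi)).forth _ _ (hB _ hi) (h.rel i hi)).2
  · exact (hφ.writes _ (hB i (hv.confx_le E hE i hi)) x).2 (h.confx E hE i hi)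
  · obtain ⟨y, hy⟩ := h.conf E hE
    exact ⟨y, fun i hi => (hφ.writes _ (hB i (hv.conf_le E hE i hi)) y).2 (hy i hi)⟩

theorem WriteEmbedding.exists_matches {ξ ξ' : Execution S} {B : Set (Event S)}
    {φ : Event S → Event S} (hφ : WriteEmbedding ξ ξ' B φ) {v : VisFormula} (hv : v.WellFormed)
    (hp : ∀ p ∈ v.rels, Lifts ξ ξ' B φ p) {x : S.Obj} {ε' : ℕ → Event S}
    (h : v.Matches ξ' x ε') {r : Event S} (hr : r ∈ B) (hr' : ε' v.rels.length = φ r) :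
    ∃ ε : ℕ → Event S, (∀ i ≤ v.rels.length, ε i ∈ B ∧ ε' i = φ (ε i)) ∧
      ε v.rels.length = r ∧ v.Matches ξ x ε := by
  classical
  have hB : ∀ i ≤ v.rels.length, ∃ a ∈ B, ε' i = φ a := by
    intro i hi
    induction hi using Nat.decreasingInduction with
    | self => exact ⟨r, hr, hr'⟩
    | of_succ i hi ih =>
      obtain ⟨a, ha, hai⟩ := ih
      have h1 := h.rel i hi
      rw [hai] at h1
      obtain ⟨a', ha', h2, -⟩ := (hp _ (List.getElem_mem hi)).back _ _ ha h1
      exact ⟨a', ha', h2⟩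
  have : Nonempty (Event S) := ⟨r⟩
  choose! ε hε using hB
  have hn : ε v.rels.length = r :=
    hφ.injOn (hε _ le_rfl).1 hr ((hε _ le_rfl).2.symm.trans hr')
  refine ⟨ε, hε, hn, fun i hi => hφ.mem _ (hε i hi).1, fun i hi => ?_, fun E hE i hi => ?_,
    fun E hE => ?_⟩
  · have h1 := h.rel i hi
    rw [(hε (i + 1) hi).2] at h1
    obtain ⟨a, ha, h2, h3⟩ := (hp _ (List.getElem_mem hi)).back _ _ (hε _ hi).1 h1
    rw [(hε i hi.le).2] at h2
    rwa [hφ.injOn (hε i hi.le).1 ha h2]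
  · have hi' := hv.confx_le E hE i hi
    have h1 := h.confx E hE i hi
    rw [(hε i hi').2] at h1
    exact (hφ.writes _ (hε i hi').1 x).1 h1
  · obtain ⟨y, hy⟩ := h.conf E hE
    refine ⟨y, fun i hi => ?_⟩
    have hi' := hv.conf_le E hE i hi
    have h1 := hy i hi
    rw [(hε i hi').2] at h1
    exact (hφ.writes _ (hε i hi').1 y).1 h1

theorem WriteEmbedding.sees_image {ξ ξ' : Execution S} {B : Set (Event S)}
    {φ : Event S → Event S} (hφ : WriteEmbedding ξ ξ' B φ) {M : Set VisFormula}
    (hM : ∀ v ∈ M, v.WellFormed) (hp : ∀ v ∈ M, ∀ p ∈ v.rels, Lifts ξ ξ' B φ p) {r : Event S}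
    (hr : r ∈ B) (x : S.Obj) :
    ξ'.sees M x (φ r) = φ '' ξ.sees M x r ∧ ξ.sees M x r ⊆ B := by
  constructor
  · ext e'
    constructor
    · rintro ⟨v, hv, ε', rfl, hn, h⟩
      obtain ⟨ε, h1, h2, h3⟩ := hφ.exists_matches (hM v hv) (hp v hv) h hr hn
      exact ⟨ε 0, ⟨v, hv, ε, rfl, h2, h3⟩, (h1 0 (Nat.zero_le _)).2.symm⟩
    · rintro ⟨e, ⟨v, hv, ε, rfl, hn, h⟩, rfl⟩
      obtain ⟨-, h2⟩ := hφ.matches_image (hM v hv) (hp v hv) h (by rwa [hn])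
      exact ⟨v, hv, φ ∘ ε, rfl, by simp [hn], h2⟩
  · rintro e ⟨v, hv, ε, rfl, hn, h⟩
    exact (hφ.matches_image (hM v hv) (hp v hv) h (by rwa [hn])).1 0 (Nat.zero_le _)

theorem encard_upper_image {ξ ξ' : Execution S} {B : Set (Event S)} {φ : Event S → Event S}
    (hφ : WriteEmbedding ξ ξ' B φ)
    (har : ∀ a ∈ B, ∀ d ∈ B, ξ'.ar (φ a) (φ d) ↔ ξ.ar a d) {A : Set (Event S)} (hA : A ⊆ B)
    {a : Event S} (ha : a ∈ A) :
    ((ξ'.restrict (φ '' A)).upper (φ a)).encard = ((ξ.restrict A).upper a).encard := by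
  have : (ξ'.restrict (φ '' A)).upper (φ a) = φ '' (ξ.restrict A).upper a := by
    ext d'
    constructor
    · rintro ⟨⟨-, d, hd, rfl⟩, h⟩
      refine ⟨d, ⟨⟨hφ.mem _ (hA hd), hd⟩, ?_⟩, rfl⟩
      rcases h with h | h
      · exact .inl (hφ.injOn (hA hd) (hA ha) h)
      · exact .inr ⟨(har _ (hA ha) _ (hA hd)).1 h.1, ha, hd⟩
    · rintro ⟨d, ⟨⟨-, hd⟩, h⟩, rfl⟩
      refine ⟨⟨hφ.mem' _ (hA hd), d, hd, rfl⟩, ?_⟩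
      rcases h with rfl | h
      · exact .inl rfl
      · exact .inr ⟨(har _ (hA ha) _ (hA hd)).2 h.1, ⟨a, ha, rfl⟩, ⟨d, hd, rfl⟩⟩
  rw [this]
  exact Set.InjOn.encard_image (hφ.injOn.mono fun d hd => hA hd.1.2)

theorem pick_true_image {ξ ξ' : Execution S} {B : Set (Event S)} {φ : Event S → Event S}
    (hφ : WriteEmbedding ξ ξ' B φ)
    (har : ∀ a ∈ B, ∀ d ∈ B, ξ'.ar (φ a) (φ d) ↔ ξ.ar a d) {A : Set (Event S)} (hA : A ⊆ B)
    (k : ℕ∞) :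
    (ξ'.restrict (φ '' A)).pick true k = φ '' (ξ.restrict A).pick true k := by
  ext a'
  constructor
  · intro h
    obtain ⟨⟨-, a, ha, rfl⟩, h⟩ := (Context.mem_pick_true _).1 h
    rw [encard_upper_image hφ har hA ha] at h
    exact ⟨a, (Context.mem_pick_true _).2 ⟨⟨hφ.mem _ (hA ha), ha⟩, h⟩, rfl⟩
  · rintro ⟨a, h, rfl⟩
    obtain ⟨⟨-, ha⟩, h⟩ := (Context.mem_pick_true _).1 h
    refine (Context.mem_pick_true _).2 ⟨⟨hφ.mem' _ (hA ha), a, ha, rfl⟩, ?_⟩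
    rwa [encard_upper_image hφ har hA ha]

/-- The events selected do not change in an execution with the same relations on a set of events. -/
theorem pick_restrict_congr {ξ ξ' : Execution S} {A : Set (Event S)} (hA : A ⊆ ξ.events)
    (hA' : A ⊆ ξ'.events) (hrb : ∀ a ∈ A, ∀ d ∈ A, ξ'.rb a d ↔ ξ.rb a d)
    (har : ∀ a ∈ A, ∀ d ∈ A, ξ'.ar a d ↔ ξ.ar a d) (b : Bool) (k : ℕ∞) :
    (ξ'.restrict A).pick b k = (ξ.restrict A).pick b k := by
  refine Context.pick_congr ?_ (fun a d => ?_) (fun a d => ?_) b k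
  · rw [Execution.restrict_events_of_subset hA, Execution.restrict_events_of_subset hA']
  · exact and_congr_left fun h => hrb a h.1 d h.2
  · exact and_congr_left fun h => har a h.1 d h.2

theorem restrict_inter_events {ξ : Execution S} (A : Set (Event S)) (b : Bool) (k : ℕ∞) :
    (ξ.restrict A).pick b k = (ξ.restrict (A ∩ ξ.events)).pick b k := by
  refine Context.pick_congr ?_ (fun a d => ?_) (fun a d => ?_) b k
  · ext e
    exact ⟨fun h => ⟨h.1, h.2, h.1⟩, fun h => ⟨h.1, h.2.1⟩⟩
  · refine and_congr_right fun h => ?_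
    have := ξ.ar_mem _ _ (ξ.rb_le_ar _ _ h)
    exact and_congr ⟨fun h => ⟨h, this.1⟩, fun h => h.1⟩ ⟨fun h => ⟨h, this.2⟩, fun h => h.1⟩
  · refine and_congr_right fun h => ?_
    have := ξ.ar_mem _ _ h
    exact and_congr ⟨fun h => ⟨h, this.1⟩, fun h => h.1⟩ ⟨fun h => ⟨h, this.2⟩, fun h => h.1⟩

/-- `B` is a set of events whose past, with all relations on it, is the same in `ξ` and `ξ'`. -/
structure SamePast (ξ ξ' : Execution S) (B : Set (Event S)) : Prop where
  mem : ∀ a ∈ B, a ∈ ξ.events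
  mem' : ∀ a ∈ B, a ∈ ξ'.events
  down : ∀ a, ∀ r ∈ B, ξ.ar a r → a ∈ B
  down' : ∀ a, ∀ r ∈ B, ξ'.ar a r → a ∈ B
  so : ∀ a ∈ B, ∀ r ∈ B, ξ'.so a r ↔ ξ.so a r
  rb : ∀ a ∈ B, ∀ r ∈ B, ξ'.rb a r ↔ ξ.rb a r
  ar : ∀ a ∈ B, ∀ r ∈ B, ξ'.ar a r ↔ ξ.ar a r
  wr : ∀ r ∈ B, ∀ x, ξ'.wr x r = ξ.wr x r
  wval : ∀ r ∈ B, ∀ x, ξ'.wval r x = ξ.wval r x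

namespace SamePast

variable {ξ ξ' : Execution S} {B : Set (Event S)}

theorem symm (h : SamePast ξ ξ' B) : SamePast ξ' ξ B where
  mem := h.mem'
  mem' := h.mem
  down := h.down'
  down' := h.down
  so a ha r hr := (h.so a ha r hr).symm
  rb a ha r hr := (h.rb a ha r hr).symm
  ar a ha r hr := (h.ar a ha r hr).symm
  wr r hr x := (h.wr r hr x).symm
  wval r hr x := (h.wval r hr x).symm

theorem writes (h : SamePast ξ ξ' B) {a : Event S} (ha : a ∈ B) (x : S.Obj) :
    ξ'.Writes a x ↔ ξ.Writes a x := by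
  simp only [Execution.Writes, h.wval a ha x]

theorem writeEmbedding (h : SamePast ξ ξ' B) : WriteEmbedding ξ ξ' B id where
  injOn := Set.injOn_id B
  mem := h.mem
  mem' := h.mem'
  writes _ ha x := h.writes ha x

theorem lifts (h : SamePast ξ ξ' B) {p : RelExpr} (hp : p.IsSimple) : Lifts ξ ξ' B id p := by
  refine ⟨fun a r hr har => ?_, fun a r hr har => ?_⟩
  · have ha := h.down a r hr (hp.le_ar har)
    refine ⟨ha, ?_⟩
    rcases hp with rfl | rfl | rfl | rfl
    · exact (h.so a ha r hr).2 har
    · obtain ⟨x, hx⟩ := har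
      exact ⟨x, by rw [id, id, h.wr r hr]; exact hx⟩
    · exact (h.rb a ha r hr).2 har
    · exact (h.ar a ha r hr).2 har
  · have ha := h.down' a r hr (hp.le_ar har)
    refine ⟨a, ha, rfl, ?_⟩
    rcases hp with rfl | rfl | rfl | rfl
    · exact (h.so a ha r hr).1 har
    · obtain ⟨x, hx⟩ := har
      exact ⟨x, by rw [id, h.wr r hr] at hx; exact hx⟩
    · exact (h.rb a ha r hr).1 har
    · exact (h.ar a ha r hr).1 har

theorem sees_eq (h : SamePast ξ ξ' B) {M : Set VisFormula} (hM : ∀ v ∈ M, v.WellFormed)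
    (hs : ∀ v ∈ M, v.IsSimple) {r : Event S} (hr : r ∈ B) (x : S.Obj) :
    ξ'.sees M x r = ξ.sees M x r ∧ ξ.sees M x r ⊆ B := by
  have := h.writeEmbedding.sees_image hM (fun v hv p hp => h.lifts (hs v hv p hp)) hr x
  simpa using this

theorem writtenValue_eq (h : SamePast ξ ξ' B) (O : OpSpec S) {R : Set (Event S)} (hR : R ⊆ B)
    (e : Event S) (x : S.Obj) : O.writtenValue ξ' e x R = O.writtenValue ξ e x R := by
  unfold OpSpec.writtenValue
  congr 2
  ext p
  exact and_congr_right fun hp => by rw [h.wval _ (hR hp)]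

theorem wr_subset (h : SamePast ξ ξ' B) {r : Event S} (hr : r ∈ B) (x : S.Obj) : ξ.wr x r ⊆ B :=
  fun a ha => h.down a r hr (ξ.wr_le_ar ha)

theorem validAt (h : SamePast ξ ξ' B) {O : OpSpec S} {b : Bool} {k : ℕ∞} {M : Set VisFormula}
    (hM : ∀ v ∈ M, v.WellFormed) (hs : ∀ v ∈ M, v.IsSimple) {r : Event S} (hr : r ∈ B)
    (hv : O.ValidAt b k M ξ r) : O.ValidAt b k M ξ' r := by
  refine ⟨hv.mem, fun x hx => ?_, fun x hx => ?_, fun x hx => ?_, fun x => ?_⟩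
  · rw [h.wr r hr]; exact hv.nonempty x hx
  · obtain ⟨h1, h2⟩ := h.sees_eq hM hs hr x
    rw [h.wr r hr, hv.reads x hx, h1]
    symm
    exact pick_restrict_congr (fun a ha => h.mem a (h2 ha)) (fun a ha => h.mem' a (h2 ha))
      (fun a ha d hd => h.rb a (h2 ha) d (h2 hd)) (fun a ha d hd => h.ar a (h2 ha) d (h2 hd)) b k
  · rw [h.wr r hr]; exact hv.no_reads x hx
  · rw [h.wr r hr, h.wval r hr, h.writtenValue_eq O (h.wr_subset hr x)]; exact hv.wval_eq x

theorem execAt_of_subset (h : SamePast ξ ξ' B) {O : OpSpec S} {b : Bool} {k : ℕ∞}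
    (hB : ξ.events ⊆ B) {r : Event S} (hr : r ∈ B)
    (hv : O.ExecAt b k ξ r) : O.ExecAt b k ξ' r := by
  refine ⟨hv.mem, fun x hx => ?_, fun x hx => ?_, fun x hx => ?_, fun x => ?_⟩
  · rw [h.wr r hr]; exact hv.nonempty x hx
  · obtain ⟨A, hA, hA'⟩ := hv.reads x hx
    have h2 : A ∩ ξ.events ⊆ B := fun a ha => hB ha.2
    refine ⟨A ∩ ξ.events, fun e he => (h.writes (h2 he) x).2 (hA e he.1), ?_⟩
    rw [h.wr r hr, hA', restrict_inter_events]
    symm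
    exact pick_restrict_congr (fun a ha => h.mem a (h2 ha)) (fun a ha => h.mem' a (h2 ha))
      (fun a ha d hd => h.rb a (h2 ha) d (h2 hd)) (fun a ha d hd => h.ar a (h2 ha) d (h2 hd)) b k
  · rw [h.wr r hr]; exact hv.no_reads x hx
  · rw [h.wr r hr, h.wval r hr, h.writtenValue_eq O (h.wr_subset hr x)]; exact hv.wval_eq x

end SamePast

/-! ### Constructions of executions -/

namespace Execution

/-- The execution that consists of an initial event. -/
def single (i : Event S) (hi : i.IsInit) (g : S.Obj → Option S.Val) : Execution S where
  events := {i}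
  so _ _ := False
  wr _ _ := ∅
  wval _ x := g x
  finite := Set.finite_singleton i
  so_mem _ _ h := h.elim
  so_irrefl _ h := h
  so_trans _ _ _ h _ := h
  exists_init := ⟨i, rfl, hi, fun _ he _ => he, fun _ he hne => absurd he hne⟩
  so_iff a ha _ _ hai _ _ := absurd hi (by rcases ha with rfl; exact hai)
  wr_mem _ _ _ h := h.elim
  acyclic a h := by
    obtain ⟨c, h1 | ⟨x, hx⟩, -⟩ := Relation.TransGen.head'_iff.1 h
    · exact h1
    · exact hx
  rb _ _ := False
  ar _ _ := False
  rb_irrefl _ h := h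
  rb_asymm _ _ h _ := h
  rb_comp_so _ _ := ⟨fun h => h.elim, fun ⟨_, h, _⟩ => h⟩
  ar_mem _ _ h := h.elim
  ar_irrefl _ h := h
  ar_trans _ _ _ h _ := h
  ar_total a ha b hb hab := absurd (ha.trans hb.symm) hab
  so_le_rb _ _ h := h
  wr_le_rb _ _ _ h := h
  rb_le_ar _ _ h := h

theorem acyclic_of_le_ar {so ar : Event S → Event S → Prop} {wr : S.Obj → Event S → Set (Event S)}
    (hirr : ∀ a, ¬ ar a a) (htr : ∀ a b c, ar a b → ar b c → ar a c)
    (hso : ∀ a b, so a b → ar a b) (hwr : ∀ x a b, a ∈ wr x b → ar a b) (a : Event S) :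
    ¬ Relation.TransGen (fun b c => so b c ∨ ∃ x, b ∈ wr x c) a a := by
  have key : ∀ a b, Relation.TransGen (fun b c => so b c ∨ ∃ x, b ∈ wr x c) a b → ar a b := by
    intro a b h
    induction h with
    | single h => exact h.elim (hso _ _) fun ⟨x, hx⟩ => hwr x _ _ hx
    | tail _ h ih => exact htr _ _ _ ih (h.elim (hso _ _) fun ⟨x, hx⟩ => hwr x _ _ hx)
  exact fun h => hirr a (key a a h)

/-- The restriction of an execution to an initial segment of the arbitration order. -/
def initialSegment (ξ : Execution S) (B : Set (Event S)) (hB : B ⊆ ξ.events)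
    (hdown : ∀ a, ∀ r ∈ B, ξ.ar a r → a ∈ B) (hi : ∃ i ∈ B, i.IsInit) : Execution S where
  events := B
  so a b := ξ.so a b ∧ b ∈ B
  wr x r := {a | a ∈ ξ.wr x r ∧ r ∈ B}
  wval := ξ.wval
  finite := ξ.finite.subset hB
  so_mem a b h := ⟨hdown a b h.2 (ξ.so_le_ar h.1), h.2⟩
  so_irrefl a h := ξ.so_irrefl a h.1
  so_trans a b c h h' := ⟨ξ.so_trans a b c h.1 h'.1, h'.2⟩
  exists_init := by
    obtain ⟨i, hi, hi'⟩ := hi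
    refine ⟨i, hi, hi', fun e he he' => ξ.init_unique (hB he) (hB hi) he' hi', fun e he hne => ?_⟩
    exact ⟨ξ.init_so (hB hi) hi' (hB he)
      fun h => hne (ξ.init_unique (hB he) (hB hi) h hi'), he⟩
  so_iff a ha b hb hai hbi hab := by
    rw [← ξ.so_iff a (hB ha) b (hB hb) hai hbi hab]
    simp [ha, hb]
  wr_mem x w r h := ⟨hdown w r h.2 (ξ.wr_le_ar h.1), h.2⟩
  acyclic := acyclic_of_le_ar ξ.ar_irrefl ξ.ar_trans (fun _ _ h => ξ.so_le_ar h.1)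
    fun _ _ _ h => ξ.wr_le_ar h.1
  rb a b := ξ.rb a b ∧ b ∈ B
  ar a b := ξ.ar a b ∧ b ∈ B
  rb_irrefl a h := ξ.rb_irrefl a h.1
  rb_asymm a b h h' := ξ.rb_asymm a b h.1 h'.1
  rb_comp_so a b := by
    refine ⟨fun h => ⟨b, h, .refl⟩, ?_⟩
    rintro ⟨c, hac, hcb⟩
    induction hcb with
    | refl => exact hac
    | tail _ h ih => exact ⟨ξ.rb_so ih.1 h.1, h.2⟩
  ar_mem a b h := ⟨hdown a b h.2 h.1, h.2⟩
  ar_irrefl a h := ξ.ar_irrefl a h.1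
  ar_trans a b c h h' := ⟨ξ.ar_trans a b c h.1 h'.1, h'.2⟩
  ar_total a ha b hb hab :=
    (ξ.ar_total a (hB ha) b (hB hb) hab).imp (fun h => ⟨h, hb⟩) fun h => ⟨h, ha⟩
  so_le_rb a b h := ⟨ξ.so_le_rb a b h.1, h.2⟩
  wr_le_rb x a b h := ⟨ξ.wr_le_rb x a b h.1, h.2⟩
  rb_le_ar a b h := ⟨ξ.rb_le_ar a b h.1, h.2⟩

theorem samePast_initialSegment (ξ : Execution S) {B : Set (Event S)} (hB : B ⊆ ξ.events)
    (hdown : ∀ a, ∀ r ∈ B, ξ.ar a r → a ∈ B) (hi : ∃ i ∈ B, i.IsInit) :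
    SamePast ξ (ξ.initialSegment B hB hdown hi) B where
  mem _ h := hB h
  mem' _ h := h
  down := hdown
  down' a r hr h := hdown a r hr h.1
  so a _ r hr := ⟨fun h => h.1, fun h => ⟨h, hr⟩⟩
  rb a _ r hr := ⟨fun h => h.1, fun h => ⟨h, hr⟩⟩
  ar a _ r hr := ⟨fun h => h.1, fun h => ⟨h, hr⟩⟩
  wr r hr x := by
    ext a
    exact ⟨fun h => h.1, fun h => ⟨h, hr⟩⟩
  wval _ _ _ := rfl

/-- The data with which an event `r` can be appended to `ξ`: the set `past` of the events received
before `r` includes the session and is closed under receive-before from it, and the events in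
`ω x`, to be read for `x`, are among them. -/
structure Appendable (ξ : Execution S) (r : Event S) (past : Set (Event S))
    (ω : S.Obj → Set (Event S)) : Prop where
  fresh : r ∉ ξ.events
  not_init : ¬ r.IsInit
  past_subset : past ⊆ ξ.events
  session_subset : ξ.session r ⊆ past
  closed : ∀ a c, ξ.rb a c → c ∈ ξ.session r → a ∈ past
  subset_past : ∀ x, ω x ⊆ past

open Classical in
/-- The execution `ξ` with an additional last event `r`, which receives the events in `past`, reads
`ω` and writes `g`. -/
noncomputable def snoc (ξ : Execution S) (r : Event S) (past : Set (Event S))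
    (ω : S.Obj → Set (Event S)) (g : S.Obj → Option S.Val) (h : ξ.Appendable r past ω) :
    Execution S where
  events := insert r ξ.events
  so a b := ξ.so a b ∨ b = r ∧ a ∈ ξ.session r
  wr x e := {a | a ∈ ξ.wr x e ∨ e = r ∧ a ∈ ω x}
  wval e x := if e = r then g x else ξ.wval e x
  finite := ξ.finite.insert r
  so_mem a b := by
    rintro (h' | ⟨rfl, h'⟩)
    · exact ⟨.inr (ξ.so_mem _ _ h').1, .inr (ξ.so_mem _ _ h').2⟩
    · exact ⟨.inr h'.1, .inl rfl⟩
  so_irrefl a := by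
    rintro (h' | ⟨rfl, h'⟩)
    · exact ξ.so_irrefl _ h'
    · exact h.fresh h'.1
  so_trans a b c := by
    rintro (h1 | ⟨rfl, h1⟩) (h2 | ⟨rfl, h2⟩)
    · exact .inl (ξ.so_trans _ _ _ h1 h2)
    · refine .inr ⟨rfl, ?_⟩
      have h3 := ξ.mem_session_of_so h1
      refine ⟨h3.1, h3.2.imp id fun h4 => h4.trans (h2.2.resolve_left ?_)⟩
      exact fun hb => ξ.not_ar_init hb (ξ.so_le_ar h1)
    · exact absurd (ξ.so_mem _ _ h2).1 h.fresh
    · exact absurd h2.1 h.fresh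
  exists_init := by
    obtain ⟨i, hi, hii, huniq, hso⟩ := ξ.exists_init
    refine ⟨i, .inr hi, hii, ?_, ?_⟩
    · rintro e (rfl | he) hei
      · exact absurd hei h.not_init
      · exact huniq e he hei
    · rintro e (rfl | he) hne
      · exact .inr ⟨rfl, hi, .inl hii⟩
      · exact .inl (hso e he hne)
  so_iff a ha b hb hai hbi hab := by
    have key : ∀ a ∈ ξ.events, ¬ a.IsInit →
        ((ξ.so a r ∨ r = r ∧ a ∈ ξ.session r) ↔ a.replica? = r.replica?) := by
      intro a ha hai
      constructor
      · rintro (h' | ⟨-, h'⟩)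
        · exact absurd (ξ.so_mem _ _ h').2 h.fresh
        · exact h'.2.resolve_left hai
      · exact fun h' => .inr ⟨rfl, ha, .inr h'⟩
    rcases ha with rfl | ha <;> rcases hb with rfl | hb
    · exact absurd rfl hab
    · have : ¬ (ξ.so a b ∨ b = a ∧ a ∈ ξ.session a) := by
        rintro (h' | ⟨rfl, -⟩)
        · exact h.fresh (ξ.so_mem _ _ h').1
        · exact hab rfl
      rw [or_iff_right this, key b hb hbi, eq_comm]
    · have : ¬ (ξ.so b a ∨ a = b ∧ b ∈ ξ.session b) := by
        rintro (h' | ⟨rfl, -⟩)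
        · exact h.fresh (ξ.so_mem _ _ h').1
        · exact hab rfl
      rw [or_iff_left this, key a ha hai]
    · rw [← ξ.so_iff a ha b hb hai hbi hab]
      have h1 : a ≠ r := fun h' => h.fresh (h' ▸ ha)
      have h2 : b ≠ r := fun h' => h.fresh (h' ▸ hb)
      simp [h1, h2]
  wr_mem x a b := by
    rintro (h' | ⟨rfl, h'⟩)
    · exact ⟨.inr (ξ.wr_mem _ _ _ h').1, .inr (ξ.wr_mem _ _ _ h').2⟩
    · exact ⟨.inr (h.past_subset (h.subset_past _ h')), .inl rfl⟩
  rb a b := ξ.rb a b ∨ b = r ∧ a ∈ past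
  ar a b := ξ.ar a b ∨ b = r ∧ a ∈ ξ.events
  rb_irrefl a := by
    rintro (h' | ⟨rfl, h'⟩)
    · exact ξ.rb_irrefl _ h'
    · exact h.fresh (h.past_subset h')
  rb_asymm a b := by
    rintro (h1 | ⟨rfl, h1⟩) (h2 | ⟨rfl, h2⟩)
    · exact ξ.rb_asymm _ _ h1 h2
    · exact h.fresh (ξ.ar_mem _ _ (ξ.rb_le_ar _ _ h1)).1
    · exact h.fresh (ξ.ar_mem _ _ (ξ.rb_le_ar _ _ h2)).1
    · exact h.fresh (h.past_subset h1)
  rb_comp_so a b := by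
    refine ⟨fun h => ⟨b, h, .refl⟩, ?_⟩
    rintro ⟨c, hac, hcb⟩
    induction hcb with
    | refl => exact hac
    | tail _ h1 ih =>
      rcases h1 with h1 | ⟨rfl, h1⟩
      · rcases ih with h2 | ⟨rfl, h2⟩
        · exact .inl (ξ.rb_so h2 h1)
        · exact absurd (ξ.so_mem _ _ h1).1 h.fresh
      · rcases ih with h2 | ⟨rfl, h2⟩
        · exact .inr ⟨rfl, h.closed _ _ h2 h1⟩
        · exact .inr ⟨rfl, h2⟩
  ar_mem a b := by
    rintro (h' | ⟨rfl, h'⟩)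
    · exact ⟨.inr (ξ.ar_mem _ _ h').1, .inr (ξ.ar_mem _ _ h').2⟩
    · exact ⟨.inr h', .inl rfl⟩
  ar_irrefl a := by
    rintro (h' | ⟨rfl, h'⟩)
    · exact ξ.ar_irrefl _ h'
    · exact h.fresh h'
  ar_trans a b c := by
    rintro (h1 | ⟨rfl, h1⟩) (h2 | ⟨rfl, h2⟩)
    · exact .inl (ξ.ar_trans _ _ _ h1 h2)
    · exact .inr ⟨rfl, (ξ.ar_mem _ _ h1).1⟩
    · exact absurd (ξ.ar_mem _ _ h2).1 h.fresh
    · exact absurd h2 h.fresh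
  ar_total a ha b hb hab := by
    rcases ha with rfl | ha <;> rcases hb with rfl | hb
    · exact absurd rfl hab
    · exact .inr (.inr ⟨rfl, hb⟩)
    · exact .inl (.inr ⟨rfl, ha⟩)
    · exact (ξ.ar_total a ha b hb hab).imp .inl .inl
  so_le_rb a b := by
    rintro (h' | ⟨rfl, h'⟩)
    · exact .inl (ξ.so_le_rb _ _ h')
    · exact .inr ⟨rfl, h.session_subset h'⟩
  wr_le_rb x a b := by
    rintro (h' | ⟨rfl, h'⟩)
    · exact .inl (ξ.wr_le_rb _ _ _ h')
    · exact .inr ⟨rfl, h.subset_past _ h'⟩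
  rb_le_ar a b := by
    rintro (h' | ⟨rfl, h'⟩)
    · exact .inl (ξ.rb_le_ar _ _ h')
    · exact .inr ⟨rfl, h.past_subset h'⟩
  acyclic := by
    have key : ∀ a b, (ξ.ar a b ∨ b = r ∧ a ∈ ξ.events) → a ∈ ξ.events := by
      rintro a b (h' | ⟨rfl, h'⟩)
      · exact (ξ.ar_mem _ _ h').1
      · exact h'
    refine acyclic_of_le_ar (ar := fun a b => ξ.ar a b ∨ b = r ∧ a ∈ ξ.events) ?_ ?_ ?_ ?_
    · rintro a (h' | ⟨rfl, h'⟩)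
      · exact ξ.ar_irrefl _ h'
      · exact h.fresh h'
    · rintro a b c h1 (h2 | ⟨rfl, h2⟩)
      · rcases h1 with h1 | ⟨rfl, h1⟩
        · exact .inl (ξ.ar_trans _ _ _ h1 h2)
        · exact absurd (ξ.ar_mem _ _ h2).1 h.fresh
      · exact .inr ⟨rfl, key _ _ h1⟩
    · rintro a b (h' | ⟨rfl, h'⟩)
      · exact .inl (ξ.so_le_ar h')
      · exact .inr ⟨rfl, h'.1⟩
    · rintro x a b (h' | ⟨rfl, h'⟩)
      · exact .inl (ξ.wr_le_ar h')
      · exact .inr ⟨rfl, h.past_subset (h.subset_past _ h')⟩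

section snoc

variable {ξ : Execution S} {r : Event S} {past : Set (Event S)} {ω : S.Obj → Set (Event S)}
  {g : S.Obj → Option S.Val} (h : ξ.Appendable r past ω)

theorem snoc_so {a : Event S} : (ξ.snoc r past ω g h).so a r ↔ a ∈ ξ.session r :=
  ⟨fun h' => h'.elim (fun h' => absurd (ξ.so_mem _ _ h').2 h.fresh) fun h' => h'.2,
    fun h' => .inr ⟨rfl, h'⟩⟩

theorem snoc_rb {a : Event S} : (ξ.snoc r past ω g h).rb a r ↔ a ∈ past :=
  ⟨fun h' => h'.elim (fun h' => absurd (ξ.ar_mem _ _ (ξ.rb_le_ar _ _ h')).2 h.fresh)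
    fun h' => h'.2, fun h' => .inr ⟨rfl, h'⟩⟩

theorem snoc_ar {a : Event S} : (ξ.snoc r past ω g h).ar a r ↔ a ∈ ξ.events :=
  ⟨fun h' => h'.elim (fun h' => absurd (ξ.ar_mem _ _ h').2 h.fresh) fun h' => h'.2,
    fun h' => .inr ⟨rfl, h'⟩⟩

theorem snoc_wr (x : S.Obj) : (ξ.snoc r past ω g h).wr x r = ω x := by
  ext a
  exact ⟨fun h' => h'.elim (fun h' => absurd (ξ.wr_mem _ _ _ h').2 h.fresh) fun h' => h'.2,
    fun h' => .inr ⟨rfl, h'⟩⟩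

theorem snoc_wval (x : S.Obj) : (ξ.snoc r past ω g h).wval r x = g x := if_pos rfl

theorem samePast_snoc : SamePast ξ (ξ.snoc r past ω g h) ξ.events := by
  have hne : ∀ e ∈ ξ.events, e ≠ r := fun e he h' => h.fresh (h' ▸ he)
  refine ⟨fun _ h => h, fun _ h => .inr h, fun a e _ h => (ξ.ar_mem _ _ h).1, ?_, ?_, ?_, ?_, ?_,
    ?_⟩
  · rintro a e he (h' | ⟨rfl, h'⟩)
    · exact (ξ.ar_mem _ _ h').1
    · exact h'
  · exact fun a _ e he => or_iff_left fun h' => hne e he h'.1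
  · exact fun a _ e he => or_iff_left fun h' => hne e he h'.1
  · exact fun a _ e he => or_iff_left fun h' => hne e he h'.1
  · intro e he x
    ext a
    exact or_iff_left fun h' => hne e he h'.1
  · exact fun e he x => if_neg (hne e he)

theorem isAppend_snoc : ξ.IsAppend r past (ξ.snoc r past ω g h) where
  not_mem := h.fresh
  events_eq := rfl
  so_iff := (samePast_snoc h).so
  rb_iff := (samePast_snoc h).rb
  ar_iff := (samePast_snoc h).ar
  wr_eq := (samePast_snoc h).wr
  wval_eq := (samePast_snoc h).wval
  ar_last _ ha := (snoc_ar h).2 ha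
  rb_past _ := snoc_rb h

end snoc

end Execution

variable {O : OpSpec S} {b : Bool} {k : ℕ∞}

/-! ### Appending an event -/

theorem OpSpec.Selects.valid_snoc (hsel : O.Selects b k) {M : Set VisFormula}
    (hM : ∀ v ∈ M, v.WellFormed) (hs : ∀ v ∈ M, v.IsSimple) {ξ : Execution S}
    (hξ : O.Valid M ξ) {r : Event S} {past : Set (Event S)} {ω : S.Obj → Set (Event S)}
    (h : ξ.Appendable r past ω) (hr : r ∈ O.events) {g : S.Obj → Option S.Val}
    (hg : ∀ x, g x = O.writtenValue ξ r x (ω x)) (hne : ∀ x, O.Reads r x → (ω x).Nonempty)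
    (hω : ∀ x, O.Reads r x →
      ω x = ((ξ.snoc r past ω g h).restrict ((ξ.snoc r past ω g h).sees M x r)).pick b k)
    (hω' : ∀ x, ¬ O.Reads r x → ω x = ∅) : O.Valid M (ξ.snoc r past ω g h) := by
  have hsp := Execution.samePast_snoc (g := g) h
  refine hsel.valid_iff.2 ?_
  rintro e (rfl | he)
  · refine ⟨hr, fun x hx => ?_, fun x hx => ?_, fun x hx => ?_, fun x => ?_⟩
    · rw [Execution.snoc_wr]; exact hne x hx
    · rw [Execution.snoc_wr]; exact hω x hx
    · rw [Execution.snoc_wr]; exact hω' x hx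
    · rw [Execution.snoc_wr, Execution.snoc_wval, hg,
        hsp.writtenValue_eq O ((h.subset_past x).trans h.past_subset)]
  · exact hsp.validAt hM hs he (hsel.valid_iff.1 hξ e he)

theorem OpSpec.Selects.isExecution_snoc (hsel : O.Selects b k) {ξ : Execution S}
    (hξ : O.IsExecution ξ) {r : Event S} {past : Set (Event S)} {ω : S.Obj → Set (Event S)}
    (h : ξ.Appendable r past ω) (hr : r ∈ O.events) {g : S.Obj → Option S.Val}
    (hg : ∀ x, g x = O.writtenValue ξ r x (ω x)) (hne : ∀ x, O.Reads r x → (ω x).Nonempty)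
    (hω : ∀ x, O.Reads r x → ∃ A : Set (Event S), A ⊆ ξ.events ∧ (∀ e ∈ A, ξ.Writes e x) ∧
      ω x = (ξ.restrict A).pick b k)
    (hω' : ∀ x, ¬ O.Reads r x → ω x = ∅) : O.IsExecution (ξ.snoc r past ω g h) := by
  have hsp := Execution.samePast_snoc (g := g) h
  refine hsel.isExecution_iff.2 ?_
  rintro e (rfl | he)
  · refine ⟨hr, fun x hx => ?_, fun x hx => ?_, fun x hx => ?_, fun x => ?_⟩
    · rw [Execution.snoc_wr]; exact hne x hx
    · obtain ⟨A, hAξ, hA, hA'⟩ := hω x hx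
      refine ⟨A, fun e he => (hsp.writes (hAξ he) x).2 (hA e he), ?_⟩
      rw [Execution.snoc_wr, hA']
      exact (pick_restrict_congr hAξ (fun a ha => hsp.mem' a (hAξ ha))
        (fun a ha d hd => hsp.rb a (hAξ ha) d (hAξ hd))
        (fun a ha d hd => hsp.ar a (hAξ ha) d (hAξ hd)) b k).symm
    · rw [Execution.snoc_wr]; exact hω' x hx
    · rw [Execution.snoc_wr, Execution.snoc_wval, hg,
        hsp.writtenValue_eq O ((h.subset_past x).trans h.past_subset)]
  · exact hsp.execAt_of_subset subset_rfl he (hsel.isExecution_iff.1 hξ e he)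

/-- The execution that consists of an initial event of `O`, with the values written by it. -/
def OpSpec.initial (O : OpSpec S) (i : Event S) (hi : i.IsInit) : Execution S :=
  Execution.single i hi fun x => O.wspec i x (O.extract i x ∅)

theorem OpSpec.Selects.valid_initial (hsel : O.Selects b k) (M : Set VisFormula) {i : Event S}
    (hi : i.IsInit) (hiO : i ∈ O.events) : O.Valid M (O.initial i hi) := by
  refine hsel.valid_iff.2 fun e he => ?_
  obtain rfl : e = i := he
  refine ⟨hiO, fun x hx => absurd hx (OpSpec.not_reads_of_isInit hi x),
    fun x hx => absurd hx (OpSpec.not_reads_of_isInit hi x), fun x _ => rfl, fun x => ?_⟩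
  simp [OpSpec.initial, Execution.single, OpSpec.writtenValue]

/-! ### Executions in which only session predecessors are received -/

/-- An event receives only the events that precede it in its session. -/
def Execution.SessionOnly (ξ : Execution S) : Prop := ∀ a c, ξ.rb a c → ξ.so a c

theorem Execution.SessionOnly.sees_eq {ξ : Execution S} (hξ : ξ.SessionOnly)
    (hE : O.IsExecution ξ) {N : Set VisFormula} (hN : O.IsConsistencyModel N)
    (hs : ∀ v ∈ N, v.IsSimple) (haf : ArbitrationFree N) {x : S.Obj} {r : Event S}
    (hr : (ξ.wr x r).Nonempty) : ξ.sees N x r = {a | ξ.so a r ∧ ξ.Writes a x} := by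
  ext e
  constructor
  · intro he
    refine ⟨?_, Execution.sees_writes hN.wellFormed he⟩
    obtain ⟨v, hv, ε, rfl, rfl, h⟩ := he
    have hstep : ∀ i < v.rels.length, ξ.so (ε i) (ε (i + 1)) := by
      intro i hi
      have h1 := h.rel i hi
      have h2 := hs v hv _ (List.getElem_mem hi)
      have h3 := haf v hv _ (List.getElem_mem hi)
      generalize v.rels[i] = p at h1 h2 h3
      rcases h2 with rfl | rfl | rfl | rfl
      · exact h1
      · obtain ⟨y, hy⟩ := h1
        exact hξ _ _ (ξ.wr_le_rb _ _ _ hy)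
      · exact hξ _ _ h1
      · exact h3.elim
    have hall : ∀ j, 0 < j → j ≤ v.rels.length → ξ.so (ε 0) (ε j) := by
      intro j hj
      induction j, hj using Nat.le_induction with
      | base => exact fun h => hstep 0 h
      | succ j hj ih => exact fun h => ξ.so_trans _ _ _ (ih (by omega)) (hstep j h)
    exact hall _ (hN.wellFormed v hv).length_pos le_rfl
  · rintro ⟨h1, h2⟩
    obtain ⟨v, hv, H⟩ := hN.so_visible
    exact ⟨v, hv, (Execution.holds_iff hr).1 (H ξ hE x e r h1 h2 hr)⟩

/-- The events that write `x` and precede, in the session order, a last event `r`. -/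
def Execution.sessionWriters (ξ : Execution S) (r : Event S) (x : S.Obj) : Set (Event S) :=
  {a ∈ ξ.session r | ξ.Writes a x}

/-- The events read by a last event `r` that sees the writers of its session only. -/
def OpSpec.sessionReads (O : OpSpec S) (b : Bool) (k : ℕ∞) (ξ : Execution S) (r : Event S)
    (x : S.Obj) : Set (Event S) :=
  {a | O.Reads r x ∧ a ∈ (ξ.restrict (ξ.sessionWriters r x)).pick b k}

theorem Execution.SessionOnly.appendable {ξ : Execution S} (hξ : ξ.SessionOnly) {r : Event S}
    (hr : r ∉ ξ.events) (hi : ¬ r.IsInit) :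
    ξ.Appendable r (ξ.session r) (O.sessionReads b k ξ r) where
  fresh := hr
  not_init := hi
  past_subset := ξ.session_subset r
  session_subset := subset_rfl
  closed a c h hc := by
    have h1 := ξ.mem_session_of_so (hξ a c h)
    refine ⟨h1.1, h1.2.imp id fun h2 => h2.trans (hc.2.resolve_left ?_)⟩
    exact fun hci => ξ.not_ar_init hci (ξ.rb_le_ar _ _ h)
  subset_past x := fun _ ha => ha.2.1.2.1

/-- The execution `ξ` with an additional last event, which receives its session only. -/
noncomputable def OpSpec.sessionSnoc (O : OpSpec S) (b : Bool) (k : ℕ∞) (ξ : Execution S)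
    (hξ : ξ.SessionOnly) (r : Event S) (hr : r ∉ ξ.events) (hi : ¬ r.IsInit) : Execution S :=
  ξ.snoc r (ξ.session r) (O.sessionReads b k ξ r)
    (fun x => O.writtenValue ξ r x (O.sessionReads b k ξ r x)) (hξ.appendable hr hi)

theorem Execution.exists_init_writes {ξ : Execution S} (hE : O.IsExecution ξ) :
    ∃ i ∈ ξ.events, i.IsInit ∧ ∀ x, ξ.Writes i x := by
  obtain ⟨i, hi, hi', -⟩ := ξ.exists_init
  exact ⟨i, hi, hi', hE.init_writes hi hi'⟩

theorem OpSpec.Selects.sessionReads_nonempty (hsel : O.Selects b k) {ξ : Execution S}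
    (hE : O.IsExecution ξ) {r : Event S} {x : S.Obj} (hx : O.Reads r x) :
    (O.sessionReads b k ξ r x).Nonempty := by
  obtain ⟨i, hi, hi', hw⟩ := Execution.exists_init_writes hE
  obtain ⟨a, ha⟩ := hsel.pick_nonempty hx (c := ξ.restrict (ξ.sessionWriters r x))
    ⟨i, hi, ⟨hi, .inl hi'⟩, hw x⟩
  exact ⟨a, hx, ha⟩

theorem OpSpec.Selects.isExecution_sessionSnoc (hsel : O.Selects b k) {ξ : Execution S}
    (hE : O.IsExecution ξ) (hξ : ξ.SessionOnly) {r : Event S} (hr : r ∉ ξ.events)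
    (hi : ¬ r.IsInit) (hrO : r ∈ O.events) : O.IsExecution (O.sessionSnoc b k ξ hξ r hr hi) := by
  refine hsel.isExecution_snoc hE _ hrO (fun _ => rfl)
    (fun x hx => hsel.sessionReads_nonempty hE hx) (fun x hx => ?_) fun x hx => ?_
  · refine ⟨ξ.sessionWriters r x, fun a ha => ha.1.1, fun a ha => ha.2, ?_⟩
    ext a
    exact ⟨fun h => h.2, fun h => ⟨hx, h⟩⟩
  · exact Set.eq_empty_of_forall_notMem fun a ha => hx ha.1

section sessionSnoc

variable {ξ : Execution S} (hξ : ξ.SessionOnly) {r : Event S} (hr : r ∉ ξ.events)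
  (hi : ¬ r.IsInit)

theorem sessionOnly_sessionSnoc : (O.sessionSnoc b k ξ hξ r hr hi).SessionOnly := by
  rintro a c (h | ⟨rfl, h⟩)
  · exact .inl (hξ a c h)
  · exact .inr ⟨rfl, h⟩

theorem samePast_sessionSnoc : SamePast ξ (O.sessionSnoc b k ξ hξ r hr hi) ξ.events :=
  Execution.samePast_snoc _

theorem sessionSnoc_wr (x : S.Obj) :
    (O.sessionSnoc b k ξ hξ r hr hi).wr x r = O.sessionReads b k ξ r x :=
  Execution.snoc_wr _ x

theorem sessionSnoc_wval (x : S.Obj) :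
    (O.sessionSnoc b k ξ hξ r hr hi).wval r x =
      O.writtenValue ξ r x (O.sessionReads b k ξ r x) :=
  Execution.snoc_wval _ x

theorem sessionSnoc_events :
    (O.sessionSnoc b k ξ hξ r hr hi).events = insert r ξ.events := rfl

/-- Whatever the arbitration-free consistency model is, the appended event sees exactly the writers
of its session, since the session order is visible. -/
theorem OpSpec.Selects.valid_sessionSnoc (hsel : O.Selects b k) {N : Set VisFormula}
    (hN : O.IsConsistencyModel N) (hs : ∀ v ∈ N, v.IsSimple) (haf : ArbitrationFree N)
    (hv : O.Valid N ξ) (hrO : r ∈ O.events) : O.Valid N (O.sessionSnoc b k ξ hξ r hr hi) := by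
  have hE := hsel.isExecution hN.wellFormed hv
  have hsp : SamePast ξ (O.sessionSnoc b k ξ hξ r hr hi) ξ.events := samePast_sessionSnoc hξ hr hi
  refine hsel.valid_snoc hN.wellFormed hs hv _ hrO (fun _ => rfl)
    (fun x hx => hsel.sessionReads_nonempty hE hx) (fun x hx => ?_) fun x hx => ?_
  · change _ = ((O.sessionSnoc b k ξ hξ r hr hi).restrict
      ((O.sessionSnoc b k ξ hξ r hr hi).sees N x r)).pick b k
    have hsees : (O.sessionSnoc b k ξ hξ r hr hi).sees N x r = ξ.sessionWriters r x := by
      rw [(sessionOnly_sessionSnoc hξ hr hi).sees_eq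
        (hsel.isExecution_sessionSnoc hE hξ hr hi hrO) hN hs haf
        (by rw [sessionSnoc_wr]; exact hsel.sessionReads_nonempty hE hx)]
      ext a
      have h1 : (O.sessionSnoc b k ξ hξ r hr hi).so a r ↔ a ∈ ξ.session r := Execution.snoc_so _
      constructor
      · rintro ⟨h2, h3⟩
        exact ⟨h1.1 h2, (hsp.writes (h1.1 h2).1 x).1 h3⟩
      · rintro ⟨h2, h3⟩
        exact ⟨h1.2 h2, (hsp.writes h2.1 x).2 h3⟩
    have hA : ξ.sessionWriters r x ⊆ ξ.events := fun a ha => ha.1.1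
    rw [hsees, pick_restrict_congr hA (fun a ha => hsp.mem' a (hA ha))
      (fun a ha d hd => hsp.rb a (hA ha) d (hA hd))
      (fun a ha d hd => hsp.ar a (hA ha) d (hA hd)) b k]
    ext a
    exact ⟨fun h => h.2, fun h => ⟨hx, h⟩⟩
  · exact Set.eq_empty_of_forall_notMem fun a ha => hx ha.1

end sessionSnoc

theorem sessionOnly_initial {i : Event S} (hi : i.IsInit) : (O.initial i hi).SessionOnly :=
  fun _ _ h => h.elim

/-! ### Selected events in arbitration order -/

/-- Two sets of events select the same events of `Q` w.r.t. arbitration if one includes the other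
and all selected events of `Q`: removing events that are not selected changes nothing. -/
theorem mem_pick_true_congr {ξ : Execution S} {A A' Q : Set (Event S)} (hA : A' ⊆ A)
    (hQ : ∀ a ∈ Q, ∀ d, ξ.ar a d → d ∈ Q)
    (h : ∀ d ∈ Q, d ∈ (ξ.restrict A).pick true k → d ∈ A') {a : Event S} (ha : a ∈ Q) :
    a ∈ (ξ.restrict A).pick true k ↔ a ∈ (ξ.restrict A').pick true k := by
  simp only [Context.mem_pick_true] at h ⊢
  constructor
  · rintro ⟨h1, h2⟩
    have haA' := h a ha ⟨h1, h2⟩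
    refine ⟨⟨h1.1, haA'⟩, (Set.encard_le_encard ?_).trans h2⟩
    rintro d ⟨⟨hd1, hd2⟩, hd⟩
    exact ⟨⟨hd1, hA hd2⟩, hd.imp id fun hd => ⟨hd.1, hA hd.2.1, hA hd.2.2⟩⟩
  · rintro ⟨⟨h1, haA'⟩, h2⟩
    refine ⟨⟨h1, hA haA'⟩, ?_⟩
    rcases ({d ∈ ξ.events | d ∈ A ∧ d ∉ A' ∧ ξ.ar a d}).eq_empty_or_nonempty with he | hne
    · refine (Set.encard_le_encard ?_).trans h2
      rintro d ⟨⟨hd1, hd2⟩, hd⟩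
      have hdA' : d ∈ A' := by
        rcases hd with rfl | hd
        · exact haA'
        · by_contra hcon
          exact (Set.eq_empty_iff_forall_notMem.1 he) d ⟨hd1, hd2, hcon, hd.1⟩
      exact ⟨⟨hd1, hdA'⟩, hd.imp id fun hd => ⟨hd.1, haA', hdA'⟩⟩
    · exfalso
      obtain ⟨d, ⟨hd1, hdA, hdA', had⟩, hmax⟩ := exists_maximal_rel ξ.ar_irrefl ξ.ar_trans
        (ξ.finite.subset fun d hd => hd.1) hne
      refine hdA' (h d (hQ a ha d had) ⟨⟨hd1, hdA⟩, ?_⟩)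
      set X : Set (Event S) := {e ∈ ξ.events | e ∈ A ∧ ξ.ar d e} with hX
      have hX' : X ⊆ A' := by
        rintro e ⟨he1, he2, he3⟩
        by_contra hcon
        exact hmax e ⟨he1, he2, hcon, ξ.ar_trans _ _ _ had he3⟩ he3
      have haX : a ∉ X := fun h' => ξ.ar_asymm had h'.2.2
      calc ((ξ.restrict A).upper d).encard ≤ (insert d X).encard := by
            refine Set.encard_le_encard ?_
            rintro e ⟨⟨he1, he2⟩, rfl | he⟩
            · exact .inl rfl
            · exact .inr ⟨he1, he2, he.1⟩
        _ ≤ X.encard + 1 := Set.encard_insert_le X d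
        _ = (insert a X).encard := (Set.encard_insert_of_notMem haX).symm
        _ ≤ ((ξ.restrict A').upper a).encard := by
            refine Set.encard_le_encard ?_
            rintro e (rfl | he)
            · exact ⟨⟨h1, haA'⟩, .inl rfl⟩
            · exact ⟨⟨he.1, hX' he⟩, .inr ⟨ξ.ar_trans _ _ _ had he.2.2, haA', hX' he⟩⟩
        _ ≤ k := h2

theorem pick_true_congr {ξ : Execution S} {A A' : Set (Event S)} (hA : A' ⊆ A)
    (h : (ξ.restrict A).pick true k ⊆ A') :
    (ξ.restrict A).pick true k = (ξ.restrict A').pick true k := by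
  ext a
  exact mem_pick_true_congr (Q := Set.univ) hA (fun _ _ _ _ => trivial) (fun d _ hd => h hd) trivial

/-! ### Consequences of non-vacuity -/

theorem OpSpec.Selects.valid_congr (hsel : O.Selects b k) {M M' : Set VisFormula}
    {ξ : Execution S} (h : ∀ r ∈ ξ.events, ∀ x, O.Reads r x →
      (ξ.restrict (ξ.sees M x r)).pick b k = (ξ.restrict (ξ.sees M' x r)).pick b k)
    (hv : O.Valid M ξ) : O.Valid M' ξ := by
  refine hsel.valid_iff.2 fun r hr => ?_
  obtain ⟨h1, h2, h3, h4, h5⟩ := hsel.valid_iff.1 hv r hr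
  exact ⟨h1, h2, fun x hx => (h3 x hx).trans (h r hr x hx), h4, h5⟩

theorem OpSpec.Selects.exists_pick_ne (hsel : O.Selects b k) {M : Set VisFormula}
    {v : VisFormula} (hv : ¬ O.IsVacuous M v) : ∃ ξ : Execution S,
      (O.Valid M ξ ∨ O.Valid (M \ {v}) ξ) ∧ ∃ r ∈ ξ.events, ∃ x, O.Reads r x ∧
      (ξ.restrict (ξ.sees M x r)).pick b k ≠ (ξ.restrict (ξ.sees (M \ {v}) x r)).pick b k := by
  by_contra! hcon
  refine hv fun ξ => ⟨fun h => ?_, fun h => ?_⟩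
  · exact hsel.valid_congr (hcon ξ (.inl h)) h
  · exact hsel.valid_congr (fun r hr x hx => (hcon ξ (.inr h) r hr x hx).symm) h

/-- The events that are seen, or selected if layers are defined by arbitration, thanks to the
formula `v` only. -/
def OpSpec.gain (b : Bool) (k : ℕ∞) (M : Set VisFormula) (v : VisFormula) (ξ : Execution S)
    (x : S.Obj) (r : Event S) : Set (Event S) :=
  {d ∈ ξ.sees M x r | d ∉ ξ.sees (M \ {v}) x r ∧
    (b = true → d ∈ (ξ.restrict (ξ.sees M x r)).pick true k)}

theorem OpSpec.gain_nonempty {M : Set VisFormula} {v : VisFormula} {ξ : Execution S} {x : S.Obj}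
    {r : Event S}
    (h : (ξ.restrict (ξ.sees M x r)).pick b k ≠ (ξ.restrict (ξ.sees (M \ {v}) x r)).pick b k) :
    (OpSpec.gain b k M v ξ x r).Nonempty := by
  rw [Set.nonempty_iff_ne_empty]
  intro he
  rw [Set.eq_empty_iff_forall_notMem] at he
  have hsub : ξ.sees (M \ {v}) x r ⊆ ξ.sees M x r := Execution.sees_mono Set.sdiff_subset
  apply h
  cases b
  · rw [Set.Subset.antisymm (fun d hd => ?_) hsub]
    by_contra hcon
    exact he d ⟨hd, hcon, fun h => by simp at h⟩
  · refine pick_true_congr hsub fun d hd => ?_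
    by_contra hcon
    exact he d ⟨hd.1.2, hcon, fun _ => hd⟩

theorem OpSpec.exists_matches_of_gain {M : Set VisFormula} {v : VisFormula} {ξ : Execution S}
    {x : S.Obj} {d r : Event S} (h : d ∈ OpSpec.gain b k M v ξ x r) :
    ∃ ε : ℕ → Event S, ε 0 = d ∧ ε v.rels.length = r ∧ v.Matches ξ x ε := by
  obtain ⟨⟨w, hw, ε, h0, hn, h⟩, h', -⟩ := h
  by_cases hwv : w = v
  · subst hwv; exact ⟨ε, h0, hn, h⟩
  · exact absurd ⟨w, ⟨hw, hwv⟩, ε, h0, hn, h⟩ h'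

/-- A formula by which the session order is visible. -/
def OpSpec.SoVisible (O : OpSpec S) (v : VisFormula) : Prop :=
  ∀ ξ : Execution S, O.IsExecution ξ → ∀ x e r, ξ.so e r → ξ.Writes e x → (ξ.wr x r).Nonempty →
    v.Holds ξ x e r

/-- Since the session order is visible, only a formula by which it is visible can be needed in order
to see the initial event. -/
theorem OpSpec.soVisible_of_gain {M : Set VisFormula} (hM : O.IsConsistencyModel M)
    {v : VisFormula} {ξ : Execution S} (hξ : O.IsExecution ξ) {x : S.Obj} {d r : Event S}
    (hd : d ∈ OpSpec.gain b k M v ξ x r) (hdi : d.IsInit) (hr : r ∈ ξ.events)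
    (hx : O.Reads r x) : O.SoVisible v := by
  obtain ⟨w, hw, hso⟩ := hM.so_visible
  by_cases hwv : w = v
  · exact hwv ▸ hso
  · exfalso
    have hne := hξ.reads_nonempty r hr x hx
    have hdξ := Execution.sees_subset hd.1
    have hri : ¬ r.IsInit := fun h => OpSpec.not_reads_of_isInit h x hx
    exact hd.2.1 ⟨w, ⟨hw, hwv⟩, (Execution.holds_iff hne).1 (hso ξ hξ x d r
      (ξ.init_so hdξ hdi hr hri) (hξ.init_writes hdξ hdi x) hne)⟩

/-! ### Chains of events in two sessions -/

theorem SamePast.refl (ξ : Execution S) : SamePast ξ ξ ξ.events where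
  mem _ h := h
  mem' _ h := h
  down _ _ _ h := (ξ.ar_mem _ _ h).1
  down' _ _ _ h := (ξ.ar_mem _ _ h).1
  so _ _ _ _ := Iff.rfl
  rb _ _ _ _ := Iff.rfl
  ar _ _ _ _ := Iff.rfl
  wr _ _ _ := rfl
  wval _ _ _ := rfl

theorem SamePast.trans {ξ ξ' ξ'' : Execution S} {B B' : Set (Event S)} (h : SamePast ξ ξ' B)
    (h' : SamePast ξ' ξ'' B') (hB : B ⊆ B') : SamePast ξ ξ'' B where
  mem := h.mem
  mem' _ ha := h'.mem' _ (hB ha)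
  down := h.down
  down' a r hr har := by
    have ha := h'.down' a r (hB hr) har
    exact h.down' a r hr ((h'.ar a ha r (hB hr)).1 har)
  so a ha r hr := (h'.so a (hB ha) r (hB hr)).trans (h.so a ha r hr)
  rb a ha r hr := (h'.rb a (hB ha) r (hB hr)).trans (h.rb a ha r hr)
  ar a ha r hr := (h'.ar a (hB ha) r (hB hr)).trans (h.ar a ha r hr)
  wr r hr x := (h'.wr r (hB hr) x).trans (h.wr r hr x)
  wval r hr x := (h'.wval r (hB hr) x).trans (h.wval r hr x)

/-- `ξ'` extends `ξ` by a block of events on the replica `ρ`, the last of which is `e`. In `ξ'`, the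
event `e` reads `x` if `rd` holds, writes the objects in `Wr`, and reads the objects in `Lk` from
an event that writes them and is the last one before the block. If `free` does not hold, then `x`
is written in the block at most by `e`, and only if `al` holds. -/
structure Block (O : OpSpec S) (N : Set VisFormula) (x : S.Obj) (ρ : S.Replica) (rd : Prop)
    (Wr Lk : Set S.Obj) (al free : Prop) (ξ ξ' : Execution S) (e : Event S) : Prop where
  ext : SamePast ξ ξ' ξ.events
  valid : O.Valid N ξ'
  only : ξ'.SessionOnly
  mem : e ∈ ξ'.events
  fresh : e ∉ ξ.events
  replica : ∀ a ∈ ξ'.events, a ∉ ξ.events → a.replica? = some ρ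
  last : ∀ a ∈ ξ'.events, a ≠ e → ξ'.ar a e
  reads : rd → O.Reads e x
  writes : ∀ y ∈ Wr, ξ'.Writes e y
  link : ∀ t ∈ ξ.events, t.replica? = some ρ → (∀ a ∈ ξ.events, a ≠ t → ξ.ar a t) →
    ∀ y ∈ Lk, ξ.Writes t y → t ∈ ξ'.wr y e
  writers : ¬ free → ∀ a ∈ ξ'.events, a ∉ ξ.events → ξ'.Writes a x → a = e ∧ al

/-- Such a block can be appended to every valid execution in which only sessions are received. -/
def BlockStep (O : OpSpec S) (N : Set VisFormula) (x : S.Obj) (ρ : S.Replica) (rd : Prop)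
    (Wr Lk : Set S.Obj) (al free : Prop) : Prop :=
  ∀ ξ : Execution S, O.Valid N ξ → ξ.SessionOnly →
    ∃ ξ' e, Block O N x ρ rd Wr Lk al free ξ ξ' e

/-- An execution obtained by appending the blocks with numbers below `m`. -/
structure IsChain (O : OpSpec S) (N : Set VisFormula) (x : S.Obj) (ρ : ℕ → S.Replica)
    (rd : ℕ → Prop) (Wr Lk : ℕ → Set S.Obj) (al free : ℕ → Prop) (m : ℕ) (ξ : Execution S)
    (ε : ℕ → Event S) : Prop where
  valid : O.Valid N ξ
  only : ξ.SessionOnly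
  mem : ∀ j < m, ε j ∈ ξ.events
  replica : ∀ j < m, (ε j).replica? = some (ρ j)
  reads : ∀ j < m, rd j → O.Reads (ε j) x
  writes : ∀ j < m, ∀ y ∈ Wr j, ξ.Writes (ε j) y
  ar : ∀ j, j + 1 < m → ξ.ar (ε j) (ε (j + 1))
  link : ∀ j, j + 1 < m → ρ j = ρ (j + 1) → ∀ y ∈ Wr j, y ∈ Lk (j + 1) → ε j ∈ ξ.wr y (ε (j + 1))
  last : ∀ j, j + 1 = m → ∀ a ∈ ξ.events, a ≠ ε j → ξ.ar a (ε j)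
  writers : ∀ a ∈ ξ.events, ¬ a.IsInit → ξ.Writes a x → (∃ j < m, a = ε j ∧ al j) ∨
    ∃ j < m, free j ∧ a.replica? = some (ρ j)

theorem exists_isChain (hsel : O.Selects b k) {N : Set VisFormula} {x : S.Obj}
    {ρ : ℕ → S.Replica} {rd : ℕ → Prop} {Wr Lk : ℕ → Set S.Obj} {al free : ℕ → Prop}
    {i : Event S} (hi : i.IsInit) (hiO : i ∈ O.events) (n : ℕ)
    (hstep : ∀ j < n, BlockStep O N x (ρ j) (rd j) (Wr j) (Lk j) (al j) (free j)) :
    ∀ m ≤ n, ∃ ξ ε, IsChain O N x ρ rd Wr Lk al free m ξ ε := by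
  intro m
  induction m with
  | zero =>
    refine fun _ => ⟨O.initial i hi, fun _ => i, hsel.valid_initial N hi hiO,
      sessionOnly_initial hi, by simp, by simp, by simp, by simp, by simp, by simp, by simp, ?_⟩
    intro a ha hai
    obtain rfl : a = i := ha
    exact absurd hi hai
  | succ m ih =>
    intro hm
    obtain ⟨ξ, ε, h⟩ := ih (by omega)
    obtain ⟨ξ', e, he⟩ := hstep m (by omega) ξ h.valid h.only
    have hε : ∀ j < m, Function.update ε m e j = ε j := fun j hj =>
      Function.update_of_ne hj.ne _ _
    have hεm : Function.update ε m e m = e := Function.update_self _ _ _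
    have hlt : ∀ j < m + 1, j < m ∨ j = m := fun j hj => by omega
    have hne : ∀ a ∈ ξ.events, a ≠ e := fun a ha h' => he.fresh (h' ▸ ha)
    refine ⟨ξ', Function.update ε m e, he.valid, he.only, fun j hj => ?_, fun j hj => ?_,
      fun j hj => ?_, fun j hj => ?_, fun j hj => ?_, fun j hj => ?_, fun j hj => ?_, ?_⟩
    · rcases hlt j hj with hj | rfl
      · rw [hε j hj]; exact he.ext.mem' _ (h.mem j hj)
      · rw [hεm]; exact he.mem
    · rcases hlt j hj with hj | rfl
      · rw [hε j hj]; exact h.replica j hj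
      · rw [hεm]; exact he.replica e he.mem he.fresh
    · rcases hlt j hj with hj | rfl
      · rw [hε j hj]; exact h.reads j hj
      · rw [hεm]; exact he.reads
    · rcases hlt j hj with hj | rfl
      · rw [hε j hj]
        exact fun y hy => (he.ext.writes (h.mem j hj) y).2 (h.writes j hj y hy)
      · rw [hεm]; exact he.writes
    · rcases hlt _ hj with hj | rfl
      · rw [hε _ hj, hε j (by omega)]
        exact (he.ext.ar _ (h.mem j (by omega)) _ (h.mem _ hj)).2 (h.ar j hj)
      · rw [hεm, hε j (by omega)]
        have hj' := h.mem j (by omega)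
        exact he.last _ (he.ext.mem' _ hj') (hne _ hj')
    · rcases hlt _ hj with hj | rfl
      · rw [hε _ hj, hε j (by omega)]
        intro hρ y hy hy'
        rw [he.ext.wr _ (h.mem _ hj)]
        exact h.link j hj hρ y hy hy'
      · rw [hεm, hε j (by omega)]
        intro hρ y hy hy'
        exact he.link _ (h.mem j (by omega)) (by rw [h.replica j (by omega), hρ])
          (h.last j rfl) y hy' (h.writes j (by omega) y hy)
    · obtain rfl : j = m := by omega
      rw [hεm]
      exact he.last
    · intro a ha hai hax
      by_cases haξ : a ∈ ξ.events
      · rcases h.writers a haξ hai ((he.ext.writes haξ x).1 hax) with ⟨j, hj, h1, h2⟩ | ⟨j, hj, h1⟩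
        · exact .inl ⟨j, by omega, by rw [hε j hj]; exact h1, h2⟩
        · exact .inr ⟨j, by omega, h1⟩
      · by_cases hf : free m
        · exact .inr ⟨m, by omega, hf, he.replica a ha haξ⟩
        · obtain ⟨h1, h2⟩ := he.writers hf a ha haξ hax
          exact .inl ⟨m, by omega, by rw [hεm]; exact h1, h2⟩

/-- A formula `v` with `ar` as its relation number `i` cannot be matched by two chains, the first one
up to the variable `i`, in different sessions: an arbitration-free model does not allow its last
event to read from the other session, while `v` makes visible the event that instantiates the first
variable. -/
theorem false_of_blockStep (hsel : O.Selects b k) {N M : Set VisFormula}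
    (hM : ∀ v ∈ M, v.WellFormed) (hMs : ∀ v ∈ M, v.IsSimple)
    (hNM : ∀ ξ : Execution S, O.Valid N ξ → O.Valid M ξ) {v : VisFormula} (hv : v ∈ M) {i : ℕ}
    (hi : i < v.rels.length) (hiar : v.rels[i] = .ar) {x : S.Obj} {p q : S.Replica} (hpq : p ≠ q)
    {rd : ℕ → Prop} {Wr Lk : ℕ → Set S.Obj} {al free : ℕ → Prop}
    {i₀ : Event S} (hi₀ : i₀.IsInit) (hi₀O : i₀ ∈ O.events)
    (hstep : ∀ j ≤ v.rels.length, BlockStep O N x (if j ≤ i then p else q) (rd j) (Wr j) (Lk j)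
      (al j) (free j))
    (hwr : ∀ (j : ℕ) (hj : j < v.rels.length), v.rels[j] = .wr → ∃ y ∈ Wr j, y ∈ Lk (j + 1))
    (hconfx : ∀ E ∈ v.confx, ∀ j ∈ E, x ∈ Wr j)
    (hconf : ∀ E ∈ v.conf, ∃ y, ∀ j ∈ E, y ∈ Wr j) (hrd : rd v.rels.length)
    (hcount : b = true → {j | i < j ∧ j < v.rels.length ∧ al j}.encard + 1 ≤ k ∧
      ∀ j, free j → j ≤ i) : False := by
  obtain ⟨ξ, ε, h⟩ := exists_isChain hsel (ρ := fun j => if j ≤ i then p else q) hi₀ hi₀O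
    (v.rels.length + 1) (fun j hj => hstep j (by omega)) _ le_rfl
  have hvw := hM v hv
  have hn := h.reads _ (by omega) hrd
  have hMξ := hsel.valid_iff.1 (hNM ξ h.valid) _ (h.mem v.rels.length (by omega))
  have hrep : ∀ a c, ξ.so a c → ¬ a.IsInit → a.replica? = c.replica? := by
    intro a c hac ha
    exact (ξ.mem_session_of_so hac).2.resolve_left ha
  have hmatch : v.Matches ξ x ε := by
    refine ⟨fun j hj => h.mem j (by omega), fun j hj => ?_, fun E hE j hj => ?_, fun E hE => ?_⟩
    · have har := h.ar j (by omega)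
      by_cases hji : j = i
      · subst hji
        rw [hiar]
        exact har
      · have hρ : (if j ≤ i then p else q) = if j + 1 ≤ i then p else q := by
          rcases lt_or_gt_of_ne hji with h1 | h1
          · rw [if_pos (by omega), if_pos (by omega)]
          · rw [if_neg (by omega), if_neg (by omega)]
        have hso : ξ.so (ε j) (ε (j + 1)) := by
          refine ξ.so_of_session ⟨h.mem j (by omega), .inr ?_⟩ har
          rw [h.replica j (by omega), h.replica (j + 1) (by omega), hρ]
        have hs := hMs v hv _ (List.getElem_mem hj)
        have hwrj := hwr j hj
        generalize v.rels[j] = r at hs hwrj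
        rcases hs with rfl | rfl | rfl | rfl
        · exact hso
        · obtain ⟨y, hy, hy'⟩ := hwrj rfl
          exact ⟨y, h.link j (by omega) hρ y hy hy'⟩
        · exact ξ.so_le_rb _ _ hso
        · exact har
    · exact h.writes j (by have := hvw.confx_le E hE j hj; omega) x (hconfx E hE j hj)
    · obtain ⟨y, hy⟩ := hconf E hE
      exact ⟨y, fun j hj => h.writes j (by have := hvw.conf_le E hE j hj; omega) y (hy j hj)⟩
  set A := ξ.sees M x (ε v.rels.length) with hA
  have h0 : ε 0 ∈ {a ∈ A | a.replica? = some p} :=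
    ⟨⟨v, hv, ε, rfl, rfl, hmatch⟩, by rw [h.replica 0 (by omega), if_pos (Nat.zero_le _)]⟩
  -- the last event of the first session that is seen from the second one has layer at most `k`
  obtain ⟨m, ⟨hm, hmp⟩, hmax⟩ := exists_maximal_rel ξ.ar_irrefl ξ.ar_trans
    (ξ.finite.subset fun d hd => Execution.sees_subset hd.1) ⟨_, h0⟩
  have hmi : ¬ m.IsInit := by
    cases m
    · simp [Event.replica?] at hmp
    · exact fun h => h
  have hmpick : m ∈ (ξ.restrict A).pick b k := by
    have hmA : m ∈ (ξ.restrict A).events := ⟨Execution.sees_subset hm, hm⟩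
    cases b
    · refine Context.mem_pick_of_rb_maximal _ hsel.one_le hmA ?_
      rintro d ⟨hd, -, hdA⟩
      exact hmax d ⟨hdA, by rw [← hrep m d (h.only _ _ hd) hmi, hmp]⟩ (ξ.rb_le_ar _ _ hd)
    · obtain ⟨hc, hfree⟩ := hcount rfl
      refine Context.mem_pick_of_encard_le _ hmA (le_trans ?_ hc)
      calc ((ξ.restrict A).upper m).encard
          ≤ (insert m (ε '' {j | i < j ∧ j < v.rels.length ∧ al j})).encard := by
            refine Set.encard_le_encard ?_
            rintro d ⟨⟨hdξ, hdA⟩, rfl | hd⟩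
            · exact .inl rfl
            · right
              have hdp : d.replica? ≠ some p := fun h' => hmax d ⟨hdA, h'⟩ hd.1
              rcases h.writers d hdξ (fun h' => ξ.not_ar_init h' hd.1)
                (Execution.sees_writes hM hdA) with ⟨j, hj, rfl, hal⟩ | ⟨j, hj, hf, hdj⟩
              · rw [h.replica j hj] at hdp
                have hji : ¬ j ≤ i := fun h' => hdp (by rw [if_pos h'])
                refine ⟨j, ⟨by omega, ?_, hal⟩, rfl⟩
                have hjn : j ≠ v.rels.length := by
                  rintro rfl
                  exact ξ.ar_irrefl _ (Execution.sees_ar hM hMs hdA)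
                omega
              · rw [hdj, if_pos (hfree j hf)] at hdp
                exact absurd rfl hdp
        _ ≤ (ε '' {j | i < j ∧ j < v.rels.length ∧ al j}).encard + 1 := Set.encard_insert_le _ _
        _ ≤ _ := by gcongr; exact Set.encard_image_le _ _
  rw [← hMξ.reads x hn] at hmpick
  have h1 := hrep _ _ (h.only _ _ (ξ.wr_le_rb _ _ _ hmpick)) hmi
  rw [hmp, h.replica _ (by omega), if_neg (by omega)] at h1
  exact hpq (Option.some.inj h1)

/-! ### Appending copies and conditional read-writes to a session -/

theorem mem_sessionReads {ξ : Execution S} {r t : Event S} {y : S.Obj} (hr : O.Reads r y)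
    (ht : t ∈ ξ.sessionWriters r y)
    (h : {d ∈ ξ.sessionWriters r y | ξ.ar t d}.encard + 1 ≤ k) :
    t ∈ O.sessionReads b k ξ r y := by
  refine ⟨hr, Context.mem_pick_of_encard_le _ ⟨ht.1.1, ht⟩ (le_trans ?_ h)⟩
  refine le_trans (Set.encard_le_encard (t := insert t {d ∈ ξ.sessionWriters r y | ξ.ar t d}) ?_)
    (Set.encard_insert_le _ _)
  rintro d ⟨⟨-, hd⟩, rfl | h⟩
  · exact .inl rfl
  · exact .inr ⟨hd, h.1⟩

/-- The last event before the appended one is read, if it writes the object. -/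
theorem mem_sessionReads_of_last (hsel : O.Selects b k) {ξ : Execution S} {r t : Event S}
    {y : S.Obj} (hr : O.Reads r y) (ht : t ∈ ξ.sessionWriters r y)
    (h : ∀ a ∈ ξ.events, a ≠ t → ξ.ar a t) : t ∈ O.sessionReads b k ξ r y := by
  refine mem_sessionReads hr ht ?_
  rw [Set.encard_eq_zero.2]
  · simpa using hsel.one_le
  · rw [Set.eq_empty_iff_forall_notMem]
    rintro d ⟨hd, htd⟩
    refine ξ.ar_asymm htd (h d hd.1.1 ?_)
    rintro rfl
    exact ξ.ar_irrefl _ htd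

/-- A single event appended to the session is a block. -/
theorem block_sessionSnoc (hsel : O.Selects b k) {N : Set VisFormula}
    (hN : O.IsConsistencyModel N) (hs : ∀ v ∈ N, v.IsSimple) (haf : ArbitrationFree N)
    {ξ : Execution S} (hv : O.Valid N ξ) (hξ : ξ.SessionOnly) {e : Event S} (he : e ∉ ξ.events)
    (hei : ¬ e.IsInit) (heO : e ∈ O.events) {ρ : S.Replica} (hρ : e.replica? = some ρ)
    {x : S.Obj} {rd : Prop} {Wr Lk : Set S.Obj} {al free : Prop} (hrd : rd → O.Reads e x)
    (hWr : ∀ y ∈ Wr, (O.sessionSnoc b k ξ hξ e he hei).Writes e y)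
    (hLk : ∀ y ∈ Lk, O.Reads e y)
    (hal : ¬ free → (O.sessionSnoc b k ξ hξ e he hei).Writes e x → al) :
    Block O N x ρ rd Wr Lk al free ξ (O.sessionSnoc b k ξ hξ e he hei) e where
  ext := samePast_sessionSnoc hξ he hei
  valid := hsel.valid_sessionSnoc hξ he hei hN hs haf hv heO
  only := sessionOnly_sessionSnoc hξ he hei
  mem := .inl rfl
  fresh := he
  replica := by
    rintro a (rfl | ha) ha'
    · exact hρ
    · exact absurd ha ha'
  last := by
    rintro a (rfl | ha) ha'
    · exact absurd rfl ha'
    · exact .inr ⟨rfl, ha⟩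
  reads := hrd
  writes := hWr
  link t ht htρ hlast y hy hty := by
    rw [sessionSnoc_wr]
    exact mem_sessionReads_of_last hsel (hLk y hy) ⟨⟨ht, .inr (htρ.trans hρ.symm)⟩, hty⟩ hlast
  writers hf := by
    rintro a (rfl | ha) ha' hax
    · exact ⟨rfl, hal hf hax⟩
    · exact absurd ha ha'

theorem OpSpec.OperationClosure.exists_copy [Infinite S.Id] (hO : O.OperationClosure)
    {e : Event S} (he : e ∈ O.events) (hi : ¬ e.IsInit) (ρ : S.Replica) {F : Set (Event S)}
    (hF : F.Finite) : ∃ e' ∈ O.events, e' ∉ F ∧ ¬ e'.IsInit ∧ e'.replica? = some ρ ∧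
      O.rspec e' = O.rspec e ∧ O.extract e' = O.extract e ∧ O.wspec e' = O.wspec e := by
  obtain ⟨j, hj⟩ := ((hF.image Event.id?).preimage
    (Option.some_injective S.Id).injOn).exists_notMem
  obtain ⟨e', h1, h2, h3, h4⟩ := hO.copy e he hi ρ j
  refine ⟨e', h1, fun h => hj ⟨e', h, h3⟩, ?_, h2, h4⟩
  intro h
  cases e'
  · simp [Event.replica?] at h2
  · exact h

theorem OpSpec.reads_congr {e e' : Event S} (h : O.rspec e' = O.rspec e) (y : S.Obj) :
    O.Reads e' y ↔ O.Reads e y := by simp only [OpSpec.Reads, h]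

theorem OpSpec.outcome_congr {e e' : Event S} (h : O.rspec e' = O.rspec e)
    (h' : O.extract e' = O.extract e) (h'' : O.wspec e' = O.wspec e) :
    O.outcome e' = O.outcome e := by
  funext x c val
  simp only [OpSpec.outcome, h, h', h'']

theorem blockStep_of_copy [Infinite S.Id] (hsel : O.Selects b k) (hO : O.OperationClosure)
    {N : Set VisFormula}
    (hN : O.IsConsistencyModel N) (hs : ∀ v ∈ N, v.IsSimple) (haf : ArbitrationFree N)
    {e : Event S} (heO : e ∈ O.events) (hei : ¬ e.IsInit) (x : S.Obj) (ρ : S.Replica) :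
    BlockStep O N x ρ (O.Reads e x) {y | O.AlwaysWrites e y} {y | O.Reads e y} True True := by
  intro ξ hv hξ
  obtain ⟨e', h1, h2, h3, h4, h5, h6, h7⟩ := hO.exists_copy heO hei ρ ξ.finite
  refine ⟨_, e', block_sessionSnoc hsel hN hs haf hv hξ h2 h3 h1 h4
    (fun h => (OpSpec.reads_congr h5 x).2 h) (fun y hy => ?_)
    (fun y hy => (OpSpec.reads_congr h5 y).2 hy) fun _ _ => trivial⟩
  refine (hsel.isExecution_sessionSnoc (hsel.isExecution hN.wellFormed hv) hξ h2 h3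
    h1).writes_of_always (.inl rfl) ?_
  intro c hc val
  rw [OpSpec.outcome_congr h5 h6 h7]
  exact hy c hc val

/-! ### Correcting events in a session -/

theorem not_isInit_of_replica {e : Event S} {ρ : S.Replica} (h : e.replica? = some ρ) :
    ¬ e.IsInit := by
  cases e
  · simp [Event.replica?] at h
  · exact fun h => h

section corrector

variable [LinearOrder S.Obj]

theorem sort_insert_max {T : Finset S.Obj} {m : S.Obj} (h : ∀ y ∈ T, y < m) :
    (insert m T).sort (· ≤ ·) = T.sort (· ≤ ·) ++ [m] := by
  have hm : m ∉ T := fun h' => lt_irrefl _ (h m h')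
  have hnd : (T.sort (· ≤ ·) ++ [m]).Nodup := by
    refine List.Nodup.append (T.sort_nodup _) (List.nodup_singleton m) ?_
    intro y hy hy'
    rw [List.mem_singleton] at hy'
    subst hy'
    exact hm ((Finset.mem_sort _).1 hy)
  have hset : (T.sort (· ≤ ·) ++ [m]).toFinset = insert m T := by
    ext y
    simp
  rw [← hset]
  refine (List.toFinset_sort _ hnd).2 (List.pairwise_append.2 ⟨T.pairwise_sort _, by simp, ?_⟩)
  intro y hy y' hy'
  rw [List.mem_singleton] at hy'
  subst hy'
  exact (h y ((Finset.mem_sort _).1 hy)).le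

theorem mem_correctorSeq {a : S.Obj → Option (Event S)} {T : Finset S.Obj} {y : S.Obj}
    {c : Event S} : (y, c) ∈ correctorSeq a T ↔ y ∈ T ∧ a y = some c := by
  simp only [correctorSeq, List.mem_filterMap, Finset.mem_sort, Option.map_eq_some_iff,
    Prod.mk.injEq]
  constructor
  · rintro ⟨y', hy', c', hc', rfl, rfl⟩
    exact ⟨hy', hc'⟩
  · rintro ⟨hy, hc⟩
    exact ⟨y, hy, c, hc, rfl, rfl⟩

theorem correctorSeq_insert {a : S.Obj → Option (Event S)} {T : Finset S.Obj} {m : S.Obj}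
    (h : ∀ y ∈ T, y < m) : correctorSeq a (insert m T) =
      correctorSeq a T ++ ((a m).map fun c => (m, c)).toList := by
  simp only [correctorSeq, sort_insert_max h, List.filterMap_append]
  cases ha : a m <;> simp [ha]

/-- The events that an event appended on the replica `ρ` receives from its session. -/
def Execution.sessionAt (ξ : Execution S) (ρ : S.Replica) : Set (Event S) :=
  {a ∈ ξ.events | a.IsInit ∨ a.replica? = some ρ}

/-- The slot of an event appended on the replica `ρ` that receives its session only. -/
def OpSpec.sessionSlot (b : Bool) (k : ℕ∞) (ξ : Execution S) (ρ : S.Replica) : Slot S where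
  replica := ρ
  past := ξ.sessionAt ρ
  reads z := (ξ.restrict {a ∈ ξ.sessionAt ρ | ξ.Writes a z}).pick b k

/-- `ξ'` is obtained from `ξ` by appending the correcting events for the objects in `T` to the
session on the replica `ρ`. -/
structure CorrectedBy (O : OpSpec S) (b : Bool) (k : ℕ∞) (N : Set VisFormula) (ξ : Execution S)
    (ρ : S.Replica) (a : S.Obj → Option (Event S)) (T : Finset S.Obj) (ξ' : Execution S) :
    Prop where
  corr : O.IsCorrection (OpSpec.sessionSlot b k ξ ρ) ξ (correctorSeq a T) ξ'
  ext : SamePast ξ ξ' ξ.events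
  valid : O.Valid N ξ'
  only : ξ'.SessionOnly
  mem_iff : ∀ c, c ∈ ξ'.events ↔ c ∈ ξ.events ∨ ∃ y ∈ T, a y = some c
  writes : ∀ y ∈ T, ∀ c, a y = some c → ∀ z, ξ'.Writes c z ↔ z = y

variable {N : Set VisFormula} {ξ : Execution S} {ρ : S.Replica} {D W : Finset S.Obj} {u : S.Obj}
  {e : Event S} {a : S.Obj → Option (Event S)}

theorem CorrectedBy.isPlaced {T : Finset S.Obj} {ξ' : Execution S}
    (h : CorrectedBy O b k N ξ ρ a T ξ') (ha : ∀ y c, a y = some c → c.replica? = some ρ)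
    {r : Event S} (hr : r ∉ ξ'.events) (hi : ¬ r.IsInit) (hρ : r.replica? = some ρ) :
    O.IsPlaced (OpSpec.sessionSlot b k ξ ρ) (correctorSeq a T) ξ' r
      (O.sessionSnoc b k ξ' h.only r hr hi) := by
  refine ⟨hρ, ?_, fun z hz hzl => ?_⟩
  · have hset : ξ'.session r = (OpSpec.sessionSlot b k ξ ρ).past ∪
        {c | ∃ y, (y, c) ∈ correctorSeq a T} := by
      ext c
      simp only [Execution.session, OpSpec.sessionSlot, Execution.sessionAt, hρ, Set.mem_union,
        Set.mem_ofPred_eq, h.mem_iff, mem_correctorSeq]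
      constructor
      · rintro ⟨h1 | ⟨y, hy, hc⟩, h2⟩
        · exact .inl ⟨h1, h2⟩
        · exact .inr ⟨y, hy, hc⟩
      · rintro (⟨h1, h2⟩ | ⟨y, hy, hc⟩)
        · exact ⟨.inl h1, h2⟩
        · exact ⟨.inr ⟨y, hy, hc⟩, .inr (ha y c hc)⟩
    have := Execution.isAppend_snoc (g := fun x => O.writtenValue ξ' r x
      (O.sessionReads b k ξ' r x)) (h.only.appendable (O := O) (b := b) (k := k) hr hi)
    rw [← hset]
    exact this
  · rw [sessionSnoc_wr]
    have hset : ξ'.sessionWriters r z = {c ∈ ξ.sessionAt ρ | ξ.Writes c z} := by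
      ext c
      simp only [Execution.sessionWriters, Execution.session, Execution.sessionAt, hρ,
        Set.mem_ofPred_eq, h.mem_iff]
      constructor
      · rintro ⟨⟨h1 | ⟨y, hy, hc⟩, h2⟩, h3⟩
        · exact ⟨⟨h1, h2⟩, (h.ext.writes h1 z).1 h3⟩
        · have := (h.writes y hy c hc z).1 h3
          subst this
          exact absurd (mem_correctorSeq.2 ⟨hy, hc⟩) (hzl c)
      · rintro ⟨⟨h1, h2⟩, h3⟩
        exact ⟨⟨.inl h1, h2⟩, (h.ext.writes h1 z).2 h3⟩
    have hsub : {c ∈ ξ.sessionAt ρ | ξ.Writes c z} ⊆ ξ.events := fun c hc => hc.1.1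
    have : O.sessionReads b k ξ' r z = (ξ'.restrict (ξ'.sessionWriters r z)).pick b k := by
      ext c
      exact ⟨fun h => h.2, fun h => ⟨hz, h⟩⟩
    rw [this, hset]
    exact pick_restrict_congr hsub (fun c hc => h.ext.mem' c (hsub hc))
      (fun c hc d hd => h.ext.rb c (hsub hc) d (hsub hd))
      (fun c hc d hd => h.ext.ar c (hsub hc) d (hsub hd)) b k

theorem CorrectedBy.insert_max (hsel : O.Selects b k)
    (hN : O.IsConsistencyModel N) (hs : ∀ v ∈ N, v.IsSimple) (haf : ArbitrationFree N)
    (hc : O.IsExecutionCorrector N ξ (OpSpec.sessionSlot b k ξ ρ) D W u e a) {T : Finset S.Obj}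
    {ξ' : Execution S} (h : CorrectedBy O b k N ξ ρ a T ξ') {m : S.Obj}
    (hTm : insert m T = (D.erase u).filter (· ≤ m)) (hlt : ∀ y ∈ T, y < m) :
    ∃ ξ'', CorrectedBy O b k N ξ ρ a (insert m T) ξ'' ∧ SamePast ξ' ξ'' ξ'.events := by
  cases ham : a m with
  | none =>
    refine ⟨ξ', ⟨?_, h.ext, h.valid, h.only, fun c => ?_, ?_⟩, SamePast.refl ξ'⟩
    · rw [correctorSeq_insert hlt, ham]
      simpa using h.corr
    · rw [h.mem_iff]
      simp [ham]
    · intro y hy c hyc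
      rcases Finset.mem_insert.1 hy with rfl | hy
      · rw [ham] at hyc; cases hyc
      · exact h.writes y hy c hyc
  | some c =>
    obtain ⟨hcO, hcξ, hce, hcρ⟩ := hc.fresh m c ham
    have hci := not_isInit_of_replica hcρ
    have hfresh : c ∉ ξ'.events := by
      rw [h.mem_iff]
      rintro (h1 | ⟨y, hy, hyc⟩)
      · exact hcξ h1
      · exact (hlt y hy).ne (hc.injective y m c hyc ham)
    have hpl := h.isPlaced (fun y c hy => (hc.fresh y c hy).2.2.2) hfresh hci hcρ
    have hsp : SamePast ξ' (O.sessionSnoc b k ξ' h.only c hfresh hci) ξ'.events :=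
      samePast_sessionSnoc _ _ _
    have hval := hsel.valid_sessionSnoc h.only hfresh hci hN hs haf h.valid hcO
    have hcorr : O.IsCorrection (OpSpec.sessionSlot b k ξ ρ) ξ (correctorSeq a (insert m T))
        (O.sessionSnoc b k ξ' h.only c hfresh hci) := by
      rw [correctorSeq_insert hlt, ham]
      exact OpSpec.IsCorrection.snoc h.corr hpl
    refine ⟨_, ⟨hcorr, h.ext.trans hsp h.ext.mem', hval, sessionOnly_sessionSnoc _ _ _,
      fun d => ?_, ?_⟩, hsp⟩
    · rw [sessionSnoc_events, Set.mem_insert_iff, h.mem_iff]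
      simp only [Finset.mem_insert, exists_eq_or_imp, ham, Option.some.injEq, eq_comm (a := d)]
      tauto
    · intro y hy d hyd
      rcases Finset.mem_insert.1 hy with rfl | hy
      · rw [ham] at hyd
        cases hyd
        refine hc.corrector_writes y c ham _ ?_ hval
        rw [← hTm]
        exact hcorr
      · intro z
        rw [hsp.writes ((h.mem_iff d).2 (.inr ⟨y, hy, hyd⟩))]
        exact h.writes y hy d hyd z

/-- The corrections for an initial segment of the objects can be completed. -/
theorem CorrectedBy.extend (hsel : O.Selects b k)
    (hN : O.IsConsistencyModel N) (hs : ∀ v ∈ N, v.IsSimple) (haf : ArbitrationFree N)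
    (hc : O.IsExecutionCorrector N ξ (OpSpec.sessionSlot b k ξ ρ) D W u e a) {T' : Finset S.Obj}
    (hT' : T' ⊆ D.erase u) (hini' : ∀ y ∈ T', ∀ y' ∈ D.erase u, y' ≤ y → y' ∈ T') :
    ∀ (n : ℕ) (T : Finset S.Obj) (ξ' : Execution S), (T' \ T).card = n → T ⊆ T' →
      (∀ y ∈ T, ∀ y' ∈ D.erase u, y' ≤ y → y' ∈ T) → CorrectedBy O b k N ξ ρ a T ξ' →
      ∃ ξ'', CorrectedBy O b k N ξ ρ a T' ξ'' ∧ SamePast ξ' ξ'' ξ'.events := by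
  intro n
  induction n with
  | zero =>
    intro T ξ' hn hT hini h
    have : T = T' := Finset.Subset.antisymm hT (Finset.sdiff_eq_empty_iff_subset.1
      (Finset.card_eq_zero.1 hn))
    subst this
    exact ⟨ξ', h, SamePast.refl ξ'⟩
  | succ n ih =>
    intro T ξ' hn hT hini h
    have hne : (T' \ T).Nonempty := Finset.card_pos.1 (by omega)
    set m := (T' \ T).min' hne with hm
    have hmm := (T' \ T).min'_mem hne
    rw [← hm, Finset.mem_sdiff] at hmm
    have hmin : ∀ y ∈ T', y ≤ m → y = m ∨ y ∈ T := by
      intro y hy hym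
      by_cases hyT : y ∈ T
      · exact .inr hyT
      · exact .inl (le_antisymm hym (Finset.min'_le _ _ (Finset.mem_sdiff.2 ⟨hy, hyT⟩)))
    have hlt : ∀ y ∈ T, y < m := by
      intro y hy
      by_contra hcon
      exact hmm.2 (hini y hy m (hT' hmm.1) (not_lt.1 hcon))
    have hini2 : ∀ y ∈ insert m T, ∀ y' ∈ D.erase u, y' ≤ y → y' ∈ insert m T := by
      intro y hy y' hy' hle
      rcases Finset.mem_insert.1 hy with rfl | hy
      · exact Finset.mem_insert.2 (hmin y' (hini' _ hmm.1 y' hy' hle) hle)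
      · exact Finset.mem_insert_of_mem (hini y hy y' hy' hle)
    obtain ⟨ξ₁, h1, h2⟩ := h.insert_max hsel hN hs haf hc (m := m) (by
      ext y
      rw [Finset.mem_filter]
      constructor
      · intro hy
        refine ⟨hT' ?_, ?_⟩
        · rcases Finset.mem_insert.1 hy with rfl | hy
          · exact hmm.1
          · exact hT hy
        · rcases Finset.mem_insert.1 hy with rfl | hy
          · exact le_rfl
          · exact (hlt y hy).le
      · rintro ⟨hy, hym⟩
        exact hini2 m (Finset.mem_insert_self _ _) y hy hym) hlt
    obtain ⟨ξ₂, h3, h4⟩ := ih (insert m T) ξ₁ (by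
      rw [Finset.sdiff_insert, Finset.card_erase_of_mem (Finset.mem_sdiff.2 hmm), hn]; rfl)
      (Finset.insert_subset hmm.1 hT) hini2 h1
    exact ⟨ξ₂, h3, h2.trans h4 h2.mem'⟩

/-- If conditional read-writes exist, then one with domain `D` can be appended to a session such that
it writes the object `u` and those in the initial segment `T` of `D \ {u}`, after events that write
an object of `T` each. Since the value written to an object is determined by what is read for this
object, the correctors of the other objects are not needed. -/
theorem blockStep_of_hasCorrectors (hsel : O.Selects b k) (hO : O.HasCorrectors)
    (hcond : ∃ e, O.IsConditionalReadWrite e)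
    (hN : O.IsConsistencyModel N) (hs : ∀ v ∈ N, v.IsSimple) (haf : ArbitrationFree N)
    (hD : O.IsDomain D) (hu : u ∈ D) {T : Finset S.Obj} (hT : T ⊆ D.erase u)
    (hini : ∀ y ∈ T, ∀ y' ∈ D.erase u, y' ≤ y → y' ∈ T) {x : S.Obj} {ρ : S.Replica} {rd : Prop}
    {Wr Lk : Set S.Obj} {al free : Prop} (hrd : rd → x ∈ D) (hWr : ∀ y ∈ Wr, y = u ∨ y ∈ T)
    (hLk : ∀ y ∈ Lk, y ∈ D ∧ (y ∈ T → 2 ≤ k)) (hfree : ¬ free → x ∉ T ∧ (x ∈ D → al)) :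
    BlockStep O N x ρ rd Wr Lk al free := by
  intro ξ hv hξ
  obtain ⟨e, heC, hevar, heξ, heρ, a, hc⟩ := hO hcond N hN ξ hv (OpSpec.sessionSlot b k ξ ρ) D D u hD
    subset_rfl hu fun _ => hu
  replace heρ : e.replica? = some ρ := heρ
  have hei := not_isInit_of_replica heρ
  have heO : e ∈ O.events := heC.1.1.1
  have haρ : ∀ y c, a y = some c → c.replica? = some ρ := fun y c hy => (hc.fresh y c hy).2.2.2
  have h0 : CorrectedBy O b k N ξ ρ a ∅ ξ := by
    refine ⟨?_, SamePast.refl ξ, hv, hξ, by simp, by simp⟩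
    simpa [correctorSeq] using OpSpec.IsCorrection.nil
  -- `ξ₁` contains the correcting events for `T`, and `ξ₂` all of them; that `e` writes an object after
  -- `ξ₂` implies that it does so after `ξ₁`, if the same events that write this object precede it
  obtain ⟨ξ₁, h1, -⟩ := h0.extend hsel hN hs haf hc hT hini _ ∅ ξ rfl (by simp) (by simp)
  obtain ⟨ξ₂, h2, h12⟩ := h1.extend hsel hN hs haf hc subset_rfl (fun _ _ _ h _ => h) _ T ξ₁ rfl
    hT hini
  have hfresh : ∀ T ξ', CorrectedBy O b k N ξ ρ a T ξ' → e ∉ ξ'.events := by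
    intro T ξ' h
    rw [h.mem_iff]
    rintro (h | ⟨y, -, hy⟩)
    · exact heξ h
    · exact (hc.fresh y e hy).2.2.1 rfl
  have he1 := hfresh T ξ₁ h1
  have he2 := hfresh _ ξ₂ h2
  have hpl := h2.isPlaced haρ he2 hei heρ
  have hval2 := hsel.valid_sessionSnoc h2.only he2 hei hN hs haf h2.valid heO
  have hval1 := hsel.valid_sessionSnoc h1.only he1 hei hN hs haf h1.valid heO
  have hew := hc.event_writes ξ₂ _ h2.corr hpl hval2
  have hereads : ∀ y ∈ D, O.Reads e y := by
    intro y hy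
    obtain ⟨t, ht⟩ := (hew y hy).1
    rw [sessionSnoc_wr] at ht
    exact ht.1
  have hsp1 : SamePast ξ₁ (O.sessionSnoc b k ξ₁ h1.only e he1 hei) ξ₁.events :=
    samePast_sessionSnoc _ _ _
  have hewrites : ∀ y, y = u ∨ y ∈ T → (O.sessionSnoc b k ξ₁ h1.only e he1 hei).Writes e y := by
    intro y hy
    have hyD : y ∈ D := by
      rcases hy with rfl | hy
      · exact hu
      · exact Finset.mem_of_mem_erase (hT hy)
    have hw := (hew y hyD).2.2 hyD
    have hset : ξ₂.sessionWriters e y = ξ₁.sessionWriters e y := by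
      ext c
      constructor
      · rintro ⟨⟨h3, h4⟩, h5⟩
        have hc1 : c ∈ ξ₁.events := by
          rw [h1.mem_iff]
          rcases (h2.mem_iff c).1 h3 with h6 | ⟨y', hy', hyc⟩
          · exact .inl h6
          · have := (h2.writes y' hy' c hyc y).1 h5
            subst this
            rcases hy with rfl | hy
            · exact absurd rfl (Finset.ne_of_mem_erase hy')
            · exact .inr ⟨y, hy, hyc⟩
        exact ⟨⟨hc1, h4⟩, (h12.writes hc1 y).1 h5⟩
      · rintro ⟨⟨h3, h4⟩, h5⟩
        exact ⟨⟨h12.mem' c h3, h4⟩, (h12.writes h3 y).2 h5⟩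
    have hsub : ξ₁.sessionWriters e y ⊆ ξ₁.events := fun c hc => hc.1.1
    have hreads : O.sessionReads b k ξ₂ e y = O.sessionReads b k ξ₁ e y := by
      ext c
      simp only [OpSpec.sessionReads, hset]
      rw [pick_restrict_congr hsub (fun c hc => h12.mem' c (hsub hc))
        (fun c hc d hd => h12.rb c (hsub hc) d (hsub hd))
        (fun c hc d hd => h12.ar c (hsub hc) d (hsub hd)) b k]
    rw [Execution.Writes, sessionSnoc_wval] at hw ⊢
    rwa [hreads, h12.writtenValue_eq O] at hw
    exact fun c hc => hsub hc.2.1.2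
  refine ⟨_, e, h1.ext.trans hsp1 h1.ext.mem', hval1, sessionOnly_sessionSnoc _ _ _, .inl rfl, heξ,
    ?_, ?_, fun h => hereads x (hrd h), fun y hy => hewrites y (hWr y hy), ?_, ?_⟩
  · rintro c (rfl | hc) hcξ
    · exact heρ
    · obtain ⟨y, -, hy⟩ := ((h1.mem_iff c).1 hc).resolve_left hcξ
      exact haρ y c hy
  · rintro c (rfl | hc) hce
    · exact absurd rfl hce
    · exact .inr ⟨rfl, hc⟩
  · intro t ht htρ hlast y hy hty
    obtain ⟨hyD, hyT⟩ := hLk y hy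
    rw [sessionSnoc_wr]
    have ht1 : t ∈ ξ₁.events := h1.ext.mem' t ht
    refine mem_sessionReads (hereads y hyD) ⟨⟨ht1, .inr (htρ.trans heρ.symm)⟩,
      (h1.ext.writes ht y).2 hty⟩ ?_
    have hlate : ∀ d ∈ {d ∈ ξ₁.sessionWriters e y | ξ₁.ar t d}, y ∈ T ∧ a y = some d := by
      rintro d ⟨⟨⟨hd, -⟩, hdy⟩, htd⟩
      rcases (h1.mem_iff d).1 hd with h6 | ⟨y', hy', hyd⟩
      · exfalso
        refine ξ₁.ar_asymm htd ((h1.ext.ar d h6 t ht).2 (hlast d h6 ?_))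
        rintro rfl
        exact ξ₁.ar_irrefl _ htd
      · have := (h1.writes y' hy' d hyd y).1 hdy
        subst this
        exact ⟨hy', hyd⟩
    rcases Set.eq_empty_or_nonempty {d ∈ ξ₁.sessionWriters e y | ξ₁.ar t d} with h7 | ⟨d, hd⟩
    · rw [h7]
      simpa using hsel.one_le
    · have hsub : {d ∈ ξ₁.sessionWriters e y | ξ₁.ar t d} ⊆ {d} := by
        intro d' hd'
        exact Option.some.inj ((hlate d' hd').2.symm.trans (hlate d hd).2)
      calc _ ≤ ({d} : Set (Event S)).encard + 1 := by gcongr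
        _ = 2 := by rw [Set.encard_singleton]; rfl
        _ ≤ k := hyT (hlate d hd).1
  · intro hf c hc1 hcξ hcx
    obtain ⟨hxT, hxD⟩ := hfree hf
    rcases hc1 with rfl | hc1
    · refine ⟨rfl, hxD ?_⟩
      have : x ∈ O.var c := .inr ((hsel.isExecution hN.wellFormed hval1).mayWrite (.inl rfl) hcx)
      rw [hevar] at this
      exact this
    · exfalso
      obtain ⟨y, hy, hyc⟩ := ((h1.mem_iff c).1 hc1).resolve_left hcξ
      have := (h1.writes y hy c hyc x).1 ((hsp1.writes hc1 x).1 hcx)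
      subst this
      exact hxT hy

end corrector

/-! ### Domains -/

theorem OpSpec.OperationClosure.exists_var_eq (hO : O.OperationClosure) {K : Event S → Prop}
    (hK : K ∈ ({O.IsRead, O.IsWrite, O.IsReadWrite} : Set (Event S → Prop))) {e : Event S}
    (he : K e) {y : S.Obj} (hy : y ∈ O.var e) (x : S.Obj) : ∃ e', K e' ∧ O.var e' = {x} := by
  by_cases h : (O.var e).Nontrivial
  · obtain ⟨e', h1, h2⟩ := hO.multi K hK ⟨e, he, h⟩ {x} (Finset.singleton_nonempty x)
    exact ⟨e', h1, by simpa using h2⟩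
  · refine hO.single K hK ⟨e, y, he, ?_⟩ x
    exact (Set.not_nontrivial_iff.1 h).eq_singleton_of_mem hy

theorem OpSpec.OperationClosure.exists_reader (hO : O.OperationClosure) (x : S.Obj) :
    ∃ e, O.IsRead e ∧ O.var e = {x} ∧ O.Reads e x := by
  obtain ⟨e, he⟩ := hO.exists_read
  obtain ⟨y, hy⟩ := he.2.2
  obtain ⟨e', h1, h2⟩ := hO.exists_var_eq (by simp) he (.inl hy) x
  obtain ⟨z, hz⟩ := h1.2.2
  have hz' : z ∈ O.var e' := .inl hz
  rw [h2, Set.mem_singleton_iff] at hz'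
  exact ⟨e', h1, h2, hz' ▸ hz⟩

theorem OpSpec.OperationClosure.exists_writer (hO : O.OperationClosure) (x : S.Obj) :
    ∃ e, O.IsWrite e ∧ O.var e = {x} ∧ O.MayWrite e x := by
  obtain ⟨e, he⟩ := hO.exists_write
  obtain ⟨y, hy⟩ := he.2.2
  obtain ⟨e', h1, h2⟩ := hO.exists_var_eq (by simp) he (.inr hy) x
  obtain ⟨z, hz⟩ := h1.2.2
  have hz' : z ∈ O.var e' := .inr hz
  rw [h2, Set.mem_singleton_iff] at hz'
  exact ⟨e', h1, h2, hz' ▸ hz⟩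

theorem OpSpec.OperationClosure.isDomain_singleton (hO : O.OperationClosure) (x : S.Obj) :
    O.IsDomain {x} := by
  obtain ⟨e, h1, h2, -⟩ := hO.exists_reader x
  exact ⟨e, h1.1, h1.2.1, by simpa using h2⟩

theorem OpSpec.OperationClosure.isDomain_of_nontrivial (hO : O.OperationClosure) {e : Event S}
    (he : e ∈ O.events) (hi : ¬ e.IsInit) (h : (O.var e).Nontrivial) {D : Finset S.Obj}
    (hD : D.Nonempty) : O.IsDomain D := by
  obtain ⟨y, hy | hy⟩ := h.nonempty
  · obtain ⟨e', h1, h2⟩ := hO.multi O.IsRead (by simp) ⟨e, ⟨he, hi, y, hy⟩, h⟩ D hD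
    exact ⟨e', h1.1, h1.2.1, h2⟩
  · obtain ⟨e', h1, h2⟩ := hO.multi O.IsWrite (by simp) ⟨e, ⟨he, hi, y, hy⟩, h⟩ D hD
    exact ⟨e', h1.1, h1.2.1, h2⟩

/-! ### Causal suffixes of a needed formula -/

theorem VisFormula.mem_shift {j a : ℕ} {E : Finset ℕ} :
    a ∈ VisFormula.shift j E ↔ j + a ∈ E := by
  simp only [VisFormula.shift, Finset.mem_image, Finset.mem_filter]
  constructor
  · rintro ⟨c, ⟨hc, hjc⟩, rfl⟩
    rwa [Nat.add_sub_cancel' hjc]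
  · exact fun h => ⟨j + a, ⟨h, Nat.le_add_right _ _⟩, by omega⟩

theorem VisFormula.HoldsAt.suffix {v : VisFormula} {ξ : Execution S} {x : S.Obj}
    {ε : ℕ → Event S} (h : v.HoldsAt ξ x ε) {j : ℕ} (hj : j ≤ v.rels.length) :
    (v.suffix j).HoldsAt ξ x fun a => ε (j + a) := by
  have hlen : (v.suffix j).rels.length = v.rels.length - j := List.length_drop ..
  refine ⟨fun a ha => h.mem _ (by omega), fun a ha => ?_, ?_, fun E hE a ha => ?_, fun E hE => ?_⟩
  · have h1 := h.rel (j + a) (by omega)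
    simpa [VisFormula.suffix, add_assoc] using h1
  · rw [hlen, Nat.add_sub_cancel' hj]
    exact h.reads
  · obtain ⟨E', hE', rfl⟩ := Finset.mem_image.1 hE
    exact h.confx E' hE' _ (VisFormula.mem_shift.1 ha)
  · obtain ⟨E', hE', rfl⟩ := Finset.mem_image.1 hE
    obtain ⟨y, hy⟩ := h.conf E' hE'
    exact ⟨y, fun a ha => hy _ (VisFormula.mem_shift.1 ha)⟩

/-- If layers are defined by arbitration, a formula of a normal form is needed only if the number of
variables that are constrained to write `x` after its last `ar` is small: by closure under causal
suffixes, the events that instantiate them are seen and arbitrated after the one to be selected. -/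
theorem encard_confx_lt (hsel : O.Selects true k) {M : Set VisFormula}
    (hM : ∀ v ∈ M, v.WellFormed) (hMs : ∀ v ∈ M, v.IsSimple)
    (hMc : O.ClosedUnderCausalSuffixes M) {v : VisFormula} (hv : v ∈ M)
    (hnv : ¬ O.IsVacuous M v) {i : ℕ}
    (hlast : ∀ (j : ℕ) (hj : j < v.rels.length), i < j → v.rels[j] ≠ .ar) :
    {j | i < j ∧ j < v.rels.length ∧ ∃ E ∈ v.confx, j ∈ E}.encard + 1 ≤ k := by
  obtain ⟨ξ, hξ, r, hr, x, hx, hne⟩ := hsel.exists_pick_ne hnv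
  have hE : O.IsExecution ξ := by
    rcases hξ with h | h
    · exact hsel.isExecution hM h
    · exact hsel.isExecution (fun w hw => hM w hw.1) h
  obtain ⟨d, hd⟩ := OpSpec.gain_nonempty hne
  obtain ⟨ε, h0, hn, hmat⟩ := OpSpec.exists_matches_of_gain hd
  have hpick := (Context.mem_pick_true _).1 (hd.2.2 rfl)
  have hwr : (ξ.wr x (ε v.rels.length)).Nonempty := hn ▸ hE.reads_nonempty r hr x hx
  have hholds : v.HoldsAt ξ x ε := VisFormula.holdsAt_iff.2 ⟨hmat, hwr⟩
  set J := {j | i < j ∧ j < v.rels.length ∧ ∃ E ∈ v.confx, j ∈ E} with hJ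
  have hsees : ∀ j ∈ J, ε j ∈ ξ.sees M x r := by
    rintro j ⟨hij, hj, hjF⟩
    obtain ⟨v', hv', hsub, himp⟩ := hMc v hv j hj hjF (by
      intro p hp
      obtain ⟨a, ha, rfl⟩ := List.getElem_of_mem hp
      have ha' : j + a < v.rels.length := by
        have : a < v.rels.length - j := by simpa [VisFormula.suffix] using ha
        omega
      have h1 : (v.suffix j).rels[a] = v.rels[j + a] := by simp [VisFormula.suffix]
      rw [h1]
      have h2 := hlast (j + a) ha' (by omega)
      have h3 := hMs v hv _ (List.getElem_mem ha')
      generalize v.rels[j + a] = q at h2 h3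
      rcases h3 with rfl | rfl | rfl | rfl
      · trivial
      · trivial
      · trivial
      · exact absurd rfl h2)
    have hlen : v'.rels.length = v.rels.length - j := by
      rw [hsub.length_eq]
      simp [VisFormula.suffix]
    refine ⟨v', hv', _, ?_, ?_, (VisFormula.holdsAt_iff.1 (himp ξ hE x _ (hholds.suffix hj.le))).1⟩
    · rfl
    · rw [hlen, Nat.add_sub_cancel' hj.le, hn]
  have har : ∀ j ∈ J, ξ.ar d (ε j) := by
    rintro j ⟨hij, hj, -⟩
    rw [← h0]
    exact hmat.ar (hMs v hv) (by omega) hj.le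
  have hinj : Set.InjOn ε J := by
    intro a ha c hc hac
    rcases lt_trichotomy a c with h | h | h
    · have := hmat.ar (hMs v hv) h hc.2.1.le
      rw [hac] at this
      exact absurd this (ξ.ar_irrefl _)
    · exact h
    · have := hmat.ar (hMs v hv) h ha.2.1.le
      rw [hac] at this
      exact absurd this (ξ.ar_irrefl _)
  have hdJ : d ∉ ε '' J := by
    rintro ⟨j, hj, rfl⟩
    exact ξ.ar_irrefl _ (har j hj)
  calc J.encard + 1 = (insert d (ε '' J)).encard := by
        rw [Set.encard_insert_of_notMem hdJ, hinj.encard_image]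
    _ ≤ ((ξ.restrict (ξ.sees M x r)).upper d).encard := by
        refine Set.encard_le_encard ?_
        rintro e (rfl | ⟨j, hj, rfl⟩)
        · exact ⟨hpick.1, .inl rfl⟩
        · exact ⟨⟨Execution.sees_subset (hsees j hj), hsees j hj⟩,
            .inr ⟨har j hj, hd.1, hsees j hj⟩⟩
    _ ≤ k := hpick.2

/-! ### Chains of conditional read-writes -/

section chains

variable [LinearOrder S.Obj] [Infinite S.Replica] {N M : Set VisFormula} {v : VisFormula} {i : ℕ}
  {i₀ : Event S}

/-- Conditional read-writes on a single object allow all chains if layers are defined by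
receive-before. -/
theorem false_of_conditional_of_rb [Infinite S.Obj] (hsel : O.Selects false k)
    (hO : O.StandingAssumptions)
    (hcond : ∃ e, O.IsConditionalReadWrite e) (hN : O.IsConsistencyModel N)
    (hs : ∀ v ∈ N, v.IsSimple) (haf : ArbitrationFree N) (hM : ∀ v ∈ M, v.WellFormed)
    (hMs : ∀ v ∈ M, v.IsSimple) (hNM : ∀ ξ : Execution S, O.Valid N ξ → O.Valid M ξ)
    (hv : v ∈ M) (hi : i < v.rels.length) (hiar : v.rels[i] = .ar) (hi₀ : i₀.IsInit)
    (hi₀O : i₀ ∈ O.events) : False := by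
  obtain ⟨x⟩ : Nonempty S.Obj := inferInstance
  obtain ⟨p, q, hpq⟩ := exists_pair_ne S.Replica
  refine false_of_blockStep hsel hM hMs hNM hv hi hiar hpq (x := x) (rd := fun _ => True)
    (Wr := fun _ => {x}) (Lk := fun _ => {x}) (al := fun _ => True) (free := fun _ => True) hi₀ hi₀O
    (fun j _ => ?_) (fun _ _ _ => ⟨x, rfl, rfl⟩) (fun _ _ _ _ => rfl)
    (fun _ _ => ⟨x, fun _ _ => rfl⟩) trivial (by simp)
  refine blockStep_of_hasCorrectors hsel hO.hasCorrectors hcond hN hs haf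
    (hO.operationClosure.isDomain_singleton x) (Finset.mem_singleton_self x) (T := ∅)
    (Finset.empty_subset _) (by simp) (by simp) (fun y hy => .inl hy) (fun y hy => ?_) (by simp)
  exact ⟨Finset.mem_singleton.2 hy, by simp⟩

/-- If layers are defined by arbitration, the variables after the last `ar` that need not write `x`
are instantiated by read-writes on two other objects. A write-read edge into an event that writes
`x` goes through the object `z`, which a corrector of this event writes as well, if two layers can
be read. Otherwise, no variable between the last `ar` and the end writes `x`, and the edge goes
through the object `y`. -/
theorem false_of_conditional_of_ar [Infinite S.Obj] (hsel : O.Selects true k)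
    (hO : O.StandingAssumptions) (hcond : ∃ e, O.IsConditionalReadWrite e) {e : Event S}
    (heO : e ∈ O.events) (hei : ¬ e.IsInit) (hnt : (O.var e).Nontrivial)
    (hN : O.IsConsistencyModel N) (hs : ∀ v ∈ N, v.IsSimple) (haf : ArbitrationFree N)
    (hM : ∀ v ∈ M, v.WellFormed) (hMs : ∀ v ∈ M, v.IsSimple)
    (hMc : O.ClosedUnderCausalSuffixes M)
    (hNM : ∀ ξ : Execution S, O.Valid N ξ → O.Valid M ξ)
    (hv : v ∈ M) (hnv : ¬ O.IsVacuous M v) (hi : i < v.rels.length) (hiar : v.rels[i] = .ar)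
    (hlast : ∀ (j : ℕ) (hj : j < v.rels.length), i < j → v.rels[j] ≠ .ar) (hi₀ : i₀.IsInit)
    (hi₀O : i₀ ∈ O.events) : False := by
  classical
  obtain ⟨x, z, y, hzx, hyx, hzy⟩ : ∃ x z y : S.Obj, z ≠ x ∧ y ≠ x ∧ z < y := by
    obtain ⟨x⟩ : Nonempty S.Obj := inferInstance
    obtain ⟨z, hz⟩ := Infinite.exists_notMem_finset ({x} : Finset S.Obj)
    obtain ⟨y, hy⟩ := Infinite.exists_notMem_finset ({x, z} : Finset S.Obj)
    simp only [Finset.mem_singleton, Finset.mem_insert, not_or] at hz hy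
    rcases lt_or_gt_of_ne hy.2 with h | h
    · exact ⟨x, y, z, hy.1, hz, h⟩
    · exact ⟨x, z, y, hz, hy.1, h⟩
  obtain ⟨p, q, hpq⟩ := exists_pair_ne S.Replica
  have hdom : ∀ {D : Finset S.Obj}, D.Nonempty → O.IsDomain D := fun hD =>
    hO.operationClosure.isDomain_of_nontrivial heO hei hnt hD
  have hcount := encard_confx_lt hsel hM hMs hMc hv hnv hlast
  set F : ℕ → Prop := fun j => (∃ E ∈ v.confx, j ∈ E) ∨ j = v.rels.length with hF
  have hcount' : {j | i < j ∧ j < v.rels.length ∧ F j}.encard + 1 ≤ k := by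
    refine le_trans ?_ hcount
    refine add_le_add (Set.encard_le_encard ?_) le_rfl
    rintro j ⟨h1, h2, h3⟩
    exact ⟨h1, h2, h3.resolve_right h2.ne⟩
  -- the objects written by, and those read from the preceding event by, the `j`-th event
  set Wr : ℕ → Set S.Obj := fun j => if j ≤ i then {x, z} else if F j then {x, z} else {z, y}
    with hWr
  set Lk : ℕ → Set S.Obj := fun j => if j ≤ i then {z} else if F j then
    {w | w = y ∨ w = z ∧ 2 ≤ k} else {z} with hLk
  have hzW : ∀ j, z ∈ Wr j := by
    intro j
    simp only [hWr]
    split_ifs <;> simp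
  refine false_of_blockStep hsel hM hMs hNM hv hi hiar hpq (x := x) (rd := fun j => j = v.rels.length)
    (Wr := Wr) (Lk := Lk) (al := F) (free := fun j => j ≤ i) hi₀ hi₀O
    (fun j hj => ?_) (fun j hj hjwr => ?_) (fun E hE j hj => ?_)
    (fun _ _ => ⟨z, fun j _ => hzW j⟩) rfl fun _ => ⟨hcount', fun j hj => hj⟩
  · by_cases hji : j ≤ i
    · refine blockStep_of_hasCorrectors hsel hO.hasCorrectors hcond hN hs haf (D := {x, z}) (u := z)
        (T := {x}) (hdom ⟨x, by simp⟩) (by simp) ?_ ?_ (by simp) ?_ ?_ (fun h => absurd hji h)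
      · intro w hw
        rw [Finset.mem_singleton] at hw
        subst hw
        simp [hzx.symm]
      · intro w hw w' hw' _
        simp only [Finset.mem_erase, Finset.mem_insert, Finset.mem_singleton] at hw' ⊢
        tauto
      · intro w hw
        simp only [hWr, if_pos hji] at hw
        rcases hw with rfl | hw
        · exact .inr (by simp)
        · exact .inl hw
      · intro w hw
        simp only [hLk, if_pos hji, Set.mem_singleton_iff] at hw
        subst hw
        exact ⟨by simp, by simp [hzx]⟩
    · by_cases hjF : F j
      · refine blockStep_of_hasCorrectors hsel hO.hasCorrectors hcond hN hs haf (D := {x, z, y})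
          (u := x) (T := {z}) (hdom ⟨x, by simp⟩) (by simp) ?_ ?_ (by simp) ?_ ?_
          (fun _ => ⟨by simp [hzx.symm], fun _ => hjF⟩)
        · intro w hw
          rw [Finset.mem_singleton] at hw
          subst hw
          simp [hzx]
        · intro w hw w' hw' hle
          simp only [Finset.mem_erase, Finset.mem_insert, Finset.mem_singleton] at hw hw' ⊢
          subst hw
          rcases hw' with ⟨h1, rfl | rfl | rfl⟩
          · exact absurd rfl h1
          · rfl
          · exact absurd hle (not_le.2 hzy)
        · intro w hw
          simp only [hWr, if_neg hji, if_pos hjF] at hw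
          rcases hw with rfl | hw
          · exact .inl rfl
          · exact .inr (Finset.mem_singleton.2 hw)
        · intro w hw
          simp only [hLk, if_neg hji, if_pos hjF, Set.mem_ofPred_eq] at hw
          rcases hw with rfl | ⟨rfl, hk⟩
          · exact ⟨by simp, fun h => absurd (Finset.mem_singleton.1 h) hzy.ne'⟩
          · exact ⟨by simp, fun _ => hk⟩
      · refine blockStep_of_hasCorrectors hsel hO.hasCorrectors hcond hN hs haf (D := {z, y})
          (u := z) (T := {y}) (hdom ⟨z, by simp⟩) (by simp) ?_ ?_ (fun h => absurd (.inr h) hjF) ?_ ?_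
          (fun _ => ⟨by simp [hyx.symm], fun h => absurd h (by simp [hzx.symm, hyx.symm])⟩)
        · intro w hw
          rw [Finset.mem_singleton] at hw
          subst hw
          simp [hzy.ne']
        · intro w hw w' hw' _
          simp only [Finset.mem_erase, Finset.mem_insert, Finset.mem_singleton] at hw' ⊢
          tauto
        · intro w hw
          simp only [hWr, if_neg hji, if_neg hjF] at hw
          rcases hw with rfl | hw
          · exact .inl rfl
          · exact .inr (Finset.mem_singleton.2 hw)
        · intro w hw
          simp only [hLk, if_neg hji, if_neg hjF, Set.mem_singleton_iff] at hw
          subst hw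
          exact ⟨by simp, by simp [hzy.ne]⟩
  · have hji : j ≠ i := by
      rintro rfl
      rw [hiar] at hjwr
      cases hjwr
    by_cases hj1 : j + 1 ≤ i
    · exact ⟨z, hzW j, by simp only [hLk, if_pos hj1, Set.mem_singleton_iff]⟩
    · by_cases hjF : F (j + 1)
      · by_cases hk : 2 ≤ k
        · exact ⟨z, hzW j, by simp only [hLk, if_neg hj1, if_pos hjF]; exact .inr ⟨rfl, hk⟩⟩
        · have hjF' : ¬ F j := by
            intro hjF'
            apply hk
            calc (2 : ℕ∞) = ({j} : Set ℕ).encard + 1 := by rw [Set.encard_singleton]; rfl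
              _ ≤ _ := by
                gcongr
                rintro _ rfl
                exact ⟨by omega, hj, hjF'⟩
              _ ≤ k := hcount'
          refine ⟨y, ?_, ?_⟩
          · simp only [hWr, if_neg (show ¬ j ≤ i by omega), if_neg hjF']
            exact .inr rfl
          · simp only [hLk, if_neg hj1, if_pos hjF]
            exact .inl rfl
      · exact ⟨z, hzW j, by simp only [hLk, if_neg hj1, if_neg hjF, Set.mem_singleton_iff]⟩
  · by_cases hji : j ≤ i
    · simp only [hWr, if_pos hji]; exact .inl rfl
    · simp only [hWr, if_neg hji, if_pos (show F j from .inl ⟨E, hE, hj⟩)]; exact .inl rfl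

end chains

/-- If whether an event writes an object never depends on the values read, then an instance of the
formula that does not start with the initial event can be copied to two sessions. -/
theorem false_of_rigid_of_rb [Infinite S.Id] [Infinite S.Replica] (hsel : O.Selects false k)
    (hO : O.OperationClosure) (hcond : ¬ ∃ e, O.IsConditionalReadWrite e) {N M : Set VisFormula}
    (hN : O.IsConsistencyModel N) (hs : ∀ v ∈ N, v.IsSimple) (haf : ArbitrationFree N)
    (hM : ∀ v ∈ M, v.WellFormed) (hMs : ∀ v ∈ M, v.IsSimple)
    (hNM : ∀ ξ : Execution S, O.Valid N ξ → O.Valid M ξ) {v : VisFormula} (hv : v ∈ M) {i : ℕ}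
    (hi : i < v.rels.length) (hiar : v.rels[i] = .ar) {ξ : Execution S} (hξ : O.IsExecution ξ)
    {x : S.Obj} {ε : ℕ → Event S} (h : v.HoldsAt ξ x ε) (hε : ¬ (ε 0).IsInit) : False := by
  obtain ⟨p, q, hpq⟩ := exists_pair_ne S.Replica
  obtain ⟨i₀, hi₀ξ, hi₀, -⟩ := ξ.exists_init
  have hmat := (VisFormula.holdsAt_iff.1 h).1
  have hni : ∀ j ≤ v.rels.length, ¬ (ε j).IsInit := by
    intro j hj
    rcases Nat.eq_zero_or_pos j with rfl | h0
    · exact hε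
    · exact fun h' => ξ.not_ar_init h' (hmat.ar (hMs v hv) h0 hj)
  have hAW : ∀ j ≤ v.rels.length, ∀ y, ξ.Writes (ε j) y → O.AlwaysWrites (ε j) y := by
    intro j hj y hy
    refine OpSpec.rigid_of_not_conditional (hξ.events_subset (h.mem j hj)) (hni j hj)
      (fun h' => hcond ⟨_, h'⟩) y (hξ.mayWrite (h.mem j hj) hy)
  refine false_of_blockStep hsel hM hMs hNM hv hi hiar hpq (x := x)
    (rd := fun j => O.Reads (ε j) x) (Wr := fun j => {y | O.AlwaysWrites (ε j) y})
    (Lk := fun j => {y | O.Reads (ε j) y}) (al := fun _ => True) (free := fun _ => True) hi₀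
    (hξ.events_subset hi₀ξ) (fun j hj => ?_) (fun j hj hjwr => ?_) (fun E hE j hj => ?_)
    (fun E hE => ?_) ?_ (by simp)
  · exact blockStep_of_copy hsel hO hN hs haf (hξ.events_subset (h.mem j hj)) (hni j hj) x _
  · have h1 := h.rel j hj
    rw [hjwr] at h1
    obtain ⟨y, hy⟩ := h1
    exact ⟨y, hAW j hj.le y (hξ.writes_of_mem_wr hy), hξ.reads_of_mem_wr hy⟩
  · exact hAW j ((hM v hv).confx_le E hE j hj) x (h.confx E hE j hj)
  · obtain ⟨y, hy⟩ := h.conf E hE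
    exact ⟨y, fun j hj => hAW j ((hM v hv).conf_le E hE j hj) y (hy j hj)⟩
  · obtain ⟨a, ha⟩ := h.reads
    exact hξ.reads_of_mem_wr ha

/-! ### Simulation of an event on another replica -/

/-- An execution over `O` in which every event that reads `x` selects its events from a set that
includes the writers of `x` in its session. -/
structure SessionFaithful (O : OpSpec S) (b : Bool) (k : ℕ∞) (ξ : Execution S) : Prop where
  isExecution : O.IsExecution ξ
  reads : ∀ r ∈ ξ.events, ∀ x, O.Reads r x → ∃ A : Set (Event S), (∀ a ∈ A, ξ.Writes a x) ∧
    (∀ a, ξ.so a r → ξ.Writes a x → a ∈ A) ∧ ξ.wr x r = (ξ.restrict A).pick b k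

theorem OpSpec.Selects.sessionFaithful (hsel : O.Selects b k) {N : Set VisFormula}
    (hN : O.IsConsistencyModel N) {ξ : Execution S} (hξ : O.Valid N ξ) :
    SessionFaithful O b k ξ := by
  have hE := hsel.isExecution hN.wellFormed hξ
  refine ⟨hE, fun r hr x hx => ⟨ξ.sees N x r, fun a ha => Execution.sees_writes hN.wellFormed ha,
    fun a ha hax => ?_, (hsel.valid_iff.1 hξ r hr).reads x hx⟩⟩
  obtain ⟨v, hv, H⟩ := hN.so_visible
  have hne := hE.reads_nonempty r hr x hx
  exact ⟨v, hv, (Execution.holds_iff hne).1 (H ξ hE x a r ha hax hne)⟩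

/-- The formula that makes the predecessors by the relation `p` visible. -/
def VisFormula.step (p : RelExpr) : VisFormula where
  rels := [p]
  conf := ∅
  confx := {{0}}

theorem VisFormula.wellFormed_step (p : RelExpr) : (VisFormula.step p).WellFormed := by
  refine ⟨by simp [VisFormula.step], by simp [VisFormula.step], ?_, {0}, by simp [VisFormula.step],
    by simp⟩
  intro E hE i hi
  obtain rfl := Finset.mem_singleton.1 hE
  simp [Finset.mem_singleton.1 hi]

theorem VisFormula.exists_matches_step {p : RelExpr} {ξ : Execution S} {x : S.Obj}
    (hp : ∀ a r, p.interp ξ a r → a ∈ ξ.events ∧ r ∈ ξ.events) {a r : Event S} :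
    (∃ ε : ℕ → Event S, ε 0 = a ∧ ε (VisFormula.step p).rels.length = r ∧
      (VisFormula.step p).Matches ξ x ε) ↔ p.interp ξ a r ∧ ξ.Writes a x := by
  constructor
  · rintro ⟨ε, rfl, rfl, h⟩
    exact ⟨h.rel 0 (by simp [VisFormula.step]), h.confx {0} (by simp [VisFormula.step]) 0 (by simp)⟩
  · rintro ⟨h1, h2⟩
    refine ⟨fun j => if j = 0 then a else r, rfl, rfl, fun j _ => ?_, fun j hj => ?_,
      fun E hE j hj => ?_, fun E hE => absurd hE (Finset.notMem_empty E)⟩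
    · split_ifs
      · exact (hp a r h1).1
      · exact (hp a r h1).2
    · obtain rfl : j = 0 := by simpa [VisFormula.step] using hj
      exact h1
    · obtain rfl := Finset.mem_singleton.1 hE
      obtain rfl := Finset.mem_singleton.1 hj
      exact h2

/-- The consistency model in which an event sees its session predecessors and the events that it
reads. Correctors for it suffice to simulate events, as session-faithful executions are valid w.r.t.
it if no event accesses several objects. -/
def sessionModel : Set VisFormula := {VisFormula.step .so, VisFormula.step .wr}

theorem mem_sees_sessionModel {ξ : Execution S} {x : S.Obj} {a r : Event S} :
    a ∈ ξ.sees sessionModel x r ↔ (ξ.so a r ∨ ∃ y, a ∈ ξ.wr y r) ∧ ξ.Writes a x := by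
  have hso := VisFormula.exists_matches_step (x := x) (p := .so) (ξ := ξ) ξ.so_mem (a := a) (r := r)
  have hwr := VisFormula.exists_matches_step (x := x) (p := .wr) (ξ := ξ)
    (fun a r ⟨y, hy⟩ => ξ.wr_mem y a r hy) (a := a) (r := r)
  rw [or_and_right]
  refine Iff.trans ?_ (or_congr hso hwr)
  constructor
  · rintro ⟨v, rfl | rfl, h⟩
    · exact .inl h
    · exact .inr h
  · rintro (h | h)
    · exact ⟨_, .inl rfl, h⟩
    · exact ⟨_, .inr rfl, h⟩

theorem isConsistencyModel_sessionModel : O.IsConsistencyModel sessionModel := by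
  refine ⟨?_, ⟨_, .inl rfl, fun ξ _ x a r h1 h2 h3 => ?_⟩, ⟨_, .inr rfl, fun ξ _ x a r h1 h2 => ?_⟩⟩
  · rintro v (rfl | rfl)
    · exact VisFormula.wellFormed_step _
    · exact VisFormula.wellFormed_step _
  · exact (Execution.holds_iff h3).2 ((VisFormula.exists_matches_step ξ.so_mem).2 ⟨h1, h2⟩)
  · exact (Execution.holds_iff ⟨a, h1⟩).2 ((VisFormula.exists_matches_step (p := .wr)
      (fun a r ⟨y, hy⟩ => ξ.wr_mem y a r hy)).2 ⟨⟨x, h1⟩, h2⟩)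

/-- Removing from the context of an event those events that are not selected does not change the
selection; in particular, it is enough to see the session and the events read. -/
theorem SessionFaithful.valid_sessionModel (hsel : O.Selects true k)
    (hvar : ∀ e ∈ O.events, ¬ e.IsInit → (O.var e).Subsingleton) {ξ : Execution S}
    (h : SessionFaithful O true k ξ) : O.Valid sessionModel ξ := by
  refine hsel.valid_iff.2 fun r hr => ?_
  obtain ⟨h1, h2, h3, h4, h5⟩ := hsel.isExecution_iff.1 h.isExecution r hr
  refine ⟨h1, h2, fun x hx => ?_, h4, h5⟩
  obtain ⟨A, hA, hA', hwr⟩ := h.reads r hr x hx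
  have hri : ¬ r.IsInit := fun h => OpSpec.not_reads_of_isInit h x hx
  rw [hwr]
  refine pick_true_congr ?_ fun a ha => ?_
  · intro a ha
    obtain ⟨h6 | ⟨y, hy⟩, h7⟩ := mem_sees_sessionModel.1 ha
    · exact hA' a h6 h7
    · have : y = x := hvar r h1 hri (.inl (h.isExecution.reads_of_mem_wr hy)) (.inl hx)
      subst this
      rw [hwr] at hy
      exact hy.1.2
  · exact mem_sees_sessionModel.2 ⟨.inr ⟨x, by rw [hwr]; exact ha⟩, hA a ha.1.2⟩

theorem SessionFaithful.snoc (hsel : O.Selects b k) {ξ : Execution S}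
    (hξ : SessionFaithful O b k ξ) {r : Event S} {past : Set (Event S)} {ω : S.Obj → Set (Event S)}
    (h : ξ.Appendable r past ω) (hr : r ∈ O.events) {g : S.Obj → Option S.Val}
    (hg : ∀ x, g x = O.writtenValue ξ r x (ω x)) (hne : ∀ x, O.Reads r x → (ω x).Nonempty)
    (hω : ∀ x, O.Reads r x → ∃ A : Set (Event S), A ⊆ ξ.events ∧ (∀ e ∈ A, ξ.Writes e x) ∧
      (∀ e ∈ ξ.session r, ξ.Writes e x → e ∈ A) ∧ ω x = (ξ.restrict A).pick b k)
    (hω' : ∀ x, ¬ O.Reads r x → ω x = ∅) : SessionFaithful O b k (ξ.snoc r past ω g h) := by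
  have hsp := Execution.samePast_snoc (g := g) h
  have hpick : ∀ A ⊆ ξ.events, ((ξ.snoc r past ω g h).restrict A).pick b k =
      (ξ.restrict A).pick b k := fun A hA =>
    pick_restrict_congr hA (fun a ha => hsp.mem' a (hA ha))
      (fun a ha d hd => hsp.rb a (hA ha) d (hA hd))
      (fun a ha d hd => hsp.ar a (hA ha) d (hA hd)) b k
  refine ⟨hsel.isExecution_snoc hξ.isExecution h hr hg hne (fun x hx => ?_) hω', ?_⟩
  · obtain ⟨A, h1, h2, -, h3⟩ := hω x hx
    exact ⟨A, h1, h2, h3⟩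
  · rintro e (rfl | he) x hx
    · obtain ⟨A, h1, h2, h3, h4⟩ := hω x hx
      refine ⟨A, fun a ha => (hsp.writes (h1 ha) x).2 (h2 a ha), fun a ha hax => ?_, ?_⟩
      · have h5 := (Execution.snoc_so h).1 ha
        exact h3 a h5 ((hsp.writes h5.1 x).1 hax)
      · rw [Execution.snoc_wr, hpick A h1, h4]
    · obtain ⟨A, h2, h3, h4⟩ := hξ.reads e he x hx
      refine ⟨A ∩ ξ.events, fun a ha => (hsp.writes ha.2 x).2 (h2 a ha.1), fun a ha hax => ?_, ?_⟩
      · have h5 := hsp.down' a e he (Execution.so_le_ar _ ha)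
        exact ⟨h3 a ((hsp.so a h5 e he).1 ha) ((hsp.writes h5 x).1 hax), h5⟩
      · rw [hsp.wr e he, hpick _ Set.inter_subset_right, h4]
        exact restrict_inter_events A b k

/-- The events of `O` for which the set of objects written can be prescribed: either all of them
write the same objects always, or all of them access at most one object each. -/
def Simulable (O : OpSpec S) (b : Bool) : Prop :=
  (¬ ∃ e, O.IsConditionalReadWrite e) ∨
    b = true ∧ ∀ e ∈ O.events, ¬ e.IsInit → (O.var e).Subsingleton

/-- The event `s` can be simulated by a fresh event on any replica that reads the same objects, from
any events of a context that includes the session, and writes any set `W` of objects that `s` may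
write. -/
theorem Simulable.exists_event [LinearOrder S.Obj] [Infinite S.Id] (hsim : Simulable O b)
    (hsel : O.Selects b k) (hO : O.StandingAssumptions) {ξ : Execution S}
    (hξ : SessionFaithful O b k ξ) {s : Event S} (hs : s ∈ O.events) (hsi : ¬ s.IsInit)
    {ρ : S.Replica} {past : Set (Event S)} {ω : S.Obj → Set (Event S)}
    (happ : ∀ r, r ∉ ξ.events → r.replica? = some ρ → ξ.Appendable r past ω)
    (hω : ∀ x, O.Reads s x → ∃ A : Set (Event S), A ⊆ ξ.events ∧ (∀ a ∈ A, ξ.Writes a x) ∧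
      (∀ a ∈ ξ.sessionAt ρ, ξ.Writes a x → a ∈ A) ∧ ω x = (ξ.restrict A).pick b k)
    (hω' : ∀ x, ¬ O.Reads s x → ω x = ∅) (hne : ∀ x, O.Reads s x → (ω x).Nonempty)
    {W : Set S.Obj} (hW : ∀ y ∈ W, O.MayWrite s y) (hW' : ∀ y, O.AlwaysWrites s y → y ∈ W) :
    ∃ r ∈ O.events, r ∉ ξ.events ∧ r.replica? = some ρ ∧ (∀ x, O.Reads r x ↔ O.Reads s x) ∧
      ∀ y, (O.writtenValue ξ r y (ω y)).isSome ↔ y ∈ W := by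
  have hout : ∀ r, (∀ x, O.Reads r x ↔ O.Reads s x) → ∀ y, ∃ c : Context (Event S),
      c.events.Nonempty ∧ ∃ val, O.outcome r y c val = O.writtenValue ξ r y (ω y) := by
    intro r hrs y
    refine OpSpec.exists_outcome ξ (fun hy => ?_) (fun hy => hω' y (mt (hrs y).2 hy)) fun a ha => ?_
    · obtain ⟨A, -, -, -, h4⟩ := hω y ((hrs y).1 hy)
      obtain ⟨a, ha⟩ := hne y ((hrs y).1 hy)
      rw [h4] at ha
      exact ⟨_, ⟨a, ha.1⟩, by rw [hsel.reads r y _ hy, h4]⟩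
    · by_cases hy : O.Reads s y
      · obtain ⟨A, -, h2, -, h4⟩ := hω y hy
        rw [h4] at ha
        exact h2 a ha.1.2
      · rw [hω' y hy] at ha
        exact absurd ha (Set.notMem_empty a)
  by_cases hrig : O.Rigid s
  · obtain ⟨r, h1, h2, -, h4, h5, h6, h7⟩ :=
      hO.operationClosure.exists_copy hs hsi ρ ξ.finite
    have hrs := OpSpec.reads_congr h5
    refine ⟨r, h1, h2, h4, hrs, fun y => ?_⟩
    obtain ⟨c, hc, val, hval⟩ := hout r hrs y
    rw [← hval, OpSpec.outcome_congr h5 h6 h7]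
    exact ⟨fun h => hW' y (hrig y ⟨c, hc, val, h⟩), fun h => hrig y (hW y h) c hc val⟩
  · have hcs : O.IsConditionalReadWrite s := by
      by_contra h
      exact hrig (OpSpec.rigid_of_not_conditional hs hsi h)
    obtain ⟨rfl, hvar⟩ := hsim.resolve_left fun h => h ⟨s, hcs⟩
    obtain ⟨o, ho⟩ := hcs.1.1.2.2
    have hso : O.var s = {o} := (hvar s hs hsi).eq_singleton_of_mem (.inl ho)
    have hWo : ∀ y ∈ W, y = o := fun y hy => by
      have : y ∈ O.var s := .inr (hW y hy)
      rwa [hso] at this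
    classical
    -- for a domain with a single object, there is nothing to be corrected before the event itself
    obtain ⟨r, hr1, hr2, hr3, hr4, a, ha⟩ := hO.hasCorrectors ⟨s, hcs⟩ sessionModel
      isConsistencyModel_sessionModel ξ (hξ.valid_sessionModel hsel hvar) ⟨ρ, past, ω⟩ {o}
      (if o ∈ W then {o} else ∅) o ⟨s, hs, hsi, by simpa using hso⟩ (by split_ifs <;> simp)
      (by simp) (by split_ifs <;> simp)
    replace hr4 : r.replica? = some ρ := hr4
    have hrO : r ∈ O.events := hr1.1.1.1
    have hro : ∀ y, y ∈ O.var r → y = o := fun y hy => by rw [hr2] at hy; simpa using hy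
    have hrs : ∀ x, O.Reads r x ↔ O.Reads s x := by
      obtain ⟨z, hz⟩ := hr1.1.1.2.2
      obtain rfl := hro z (.inl hz)
      intro x
      constructor
      · intro hx
        obtain rfl := hro x (.inl hx)
        exact ho
      · intro hx
        have : x ∈ O.var s := .inl hx
        rw [hso, Set.mem_singleton_iff] at this
        exact this ▸ hz
    refine ⟨r, hrO, hr3, hr4, hrs, fun y => ?_⟩
    have happr := happ r hr3 hr4
    have hfaith := SessionFaithful.snoc (g := fun x => O.writtenValue ξ r x (ω x)) hsel hξ happr hrO
      (fun _ => rfl) (fun x hx => hne x ((hrs x).1 hx)) (fun x hx => by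
        obtain ⟨A, h1, h2, h3, h4⟩ := hω x ((hrs x).1 hx)
        refine ⟨A, h1, h2, fun e he hex => h3 e ?_ hex, h4⟩
        exact ⟨he.1, he.2.imp id fun h => h.trans hr4⟩) fun x hx => hω' x (mt (hrs x).2 hx)
    have hnil : correctorSeq a (({o} : Finset S.Obj).erase o) = [] := by simp [correctorSeq]
    have hw := ha.event_writes ξ _ (by rw [hnil]; exact .nil) ⟨hr4, by
        simp only [hnil, List.not_mem_nil, exists_false, Set.ofPred_false, Set.union_empty]
        exact Execution.isAppend_snoc happr, fun z _ _ => Execution.snoc_wr happr z⟩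
      (hfaith.valid_sessionModel hsel hvar) o (Finset.mem_singleton_self o)
    rw [Option.isSome_iff_exists]
    by_cases hyo : y = o
    · subst hyo
      have h1 := hw.2
      rw [Execution.Writes, Execution.snoc_wval] at h1
      rw [h1]
      split_ifs with h <;> simp [h]
    · refine ⟨fun h => absurd (hro y (.inr ?_)) hyo, fun h => absurd (hWo y h) hyo⟩
      obtain ⟨c, hc, val, hval⟩ := hout r hrs y
      exact ⟨c, hc, val, by rw [hval]; exact Option.isSome_iff_exists.2 h⟩

/-- An event that simulates `s` can be appended to a session. -/
theorem Simulable.exists_sessionSnoc [LinearOrder S.Obj] [Infinite S.Id] (hsim : Simulable O b)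
    (hsel : O.Selects b k) (hO : O.StandingAssumptions) {N : Set VisFormula}
    (hN : O.IsConsistencyModel N) {ξ : Execution S} (hξ : O.Valid N ξ) (hξs : ξ.SessionOnly)
    {s : Event S} (hs : s ∈ O.events) (hsi : ¬ s.IsInit) (ρ : S.Replica) :
    ∃ r, ∃ (hr : r ∉ ξ.events) (hri : ¬ r.IsInit), r ∈ O.events ∧ r.replica? = some ρ ∧
      (∀ x, O.Reads r x ↔ O.Reads s x) ∧
      ∀ y, (O.sessionSnoc b k ξ hξs r hr hri).Writes r y ↔ O.MayWrite s y := by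
  have hE := hsel.isExecution hN.wellFormed hξ
  obtain ⟨s', -, hs1, hs2, hs3, hs4, -, -⟩ :=
    hO.operationClosure.exists_copy hs hsi ρ ξ.finite
  have hρ : ∀ r : Event S, r.replica? = some ρ → ξ.session r = ξ.session s' := by
    intro r hr
    simp only [Execution.session, hr, hs3]
  have hsw : ∀ r : Event S, r.replica? = some ρ → (∀ x, O.Reads r x ↔ O.Reads s x) →
      O.sessionReads b k ξ r = O.sessionReads b k ξ s' := by
    intro r hr hrs
    funext x
    simp only [OpSpec.sessionReads, Execution.sessionWriters, hρ r hr, hrs,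
      OpSpec.reads_congr hs4]
  have hread : ∀ x, O.Reads s x → O.sessionReads b k ξ s' x =
      (ξ.restrict (ξ.sessionWriters s' x)).pick b k := by
    intro x hx
    ext a
    exact ⟨fun h => h.2, fun h => ⟨(OpSpec.reads_congr hs4 x).2 hx, h⟩⟩
  obtain ⟨r, h1, h2, h3, h4, h5⟩ := hsim.exists_event hsel hO (hsel.sessionFaithful hN hξ) hs hsi
    (ρ := ρ) (past := ξ.session s') (ω := O.sessionReads b k ξ s') (fun r hr hrρ => by
      have h := hξs.appendable (O := O) (b := b) (k := k) hs1 hs2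
      refine ⟨hr, not_isInit_of_replica hrρ, h.past_subset, (hρ r hrρ).subset, ?_, h.subset_past⟩
      rw [hρ r hrρ]
      exact h.closed) (fun x hx => by
      refine ⟨ξ.sessionWriters s' x, fun a ha => ha.1.1, fun a ha => ha.2, fun a ha hax => ?_,
        hread x hx⟩
      exact ⟨⟨ha.1, ha.2.imp id fun h => h.trans hs3.symm⟩, hax⟩)
    (fun x hx => Set.eq_empty_of_forall_notMem fun a ha =>
      hx ((OpSpec.reads_congr hs4 x).1 ha.1))
    (fun x hx => hsel.sessionReads_nonempty hE ((OpSpec.reads_congr hs4 x).2 hx))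
    (W := {y | O.MayWrite s y}) (fun y hy => hy) (fun y hy => by
      obtain ⟨u⟩ := OpSpec.nonempty_val O ξ y
      exact ⟨singletonContext s, ⟨s, rfl⟩, fun _ => u, hy (singletonContext s) ⟨s, rfl⟩ _⟩)
  refine ⟨r, h2, not_isInit_of_replica h3, h1, h3, h4, fun y => ?_⟩
  rw [Execution.Writes, sessionSnoc_wval, ← Option.isSome_iff_exists, hsw r h3 h4]
  exact h5 y

/-- The formula `v` holds in a valid execution at events the first of which is not initial and is
read by the last one. -/
def HasReadInstance (O : OpSpec S) (M : Set VisFormula) (v : VisFormula) : Prop :=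
  ∃ ξ, O.Valid M ξ ∧ ∃ x ε, v.HoldsAt ξ x ε ∧ ¬ (ε 0).IsInit ∧ ε 0 ∈ ξ.wr x (ε v.rels.length)

/-- A formula by which the session order is visible has such an instance, an event and a reader in
a common session. -/
theorem Simulable.hasReadInstance_of_soVisible [LinearOrder S.Obj] [Infinite S.Obj] [Infinite S.Id]
    [Infinite S.Replica] (hsim : Simulable O b) (hsel : O.Selects b k) (hO : O.StandingAssumptions)
    {N : Set VisFormula} (hN : O.IsConsistencyModel N) (hs : ∀ v ∈ N, v.IsSimple)
    (haf : ArbitrationFree N) {v : VisFormula} (hv : O.SoVisible v) {i₀ : Event S}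
    (hi₀ : i₀.IsInit) (hi₀O : i₀ ∈ O.events) : HasReadInstance O N v := by
  obtain ⟨x⟩ : Nonempty S.Obj := inferInstance
  obtain ⟨ρ⟩ : Nonempty S.Replica := inferInstance
  obtain ⟨w, hw1, -, hw2⟩ := hO.operationClosure.exists_writer x
  obtain ⟨r, hr1, -, hr2⟩ := hO.operationClosure.exists_reader x
  have hξ₀ := hsel.valid_initial N hi₀ hi₀O
  have hξ₀s := sessionOnly_initial (O := O) hi₀
  obtain ⟨w', hwf, hwi, hwO, hwρ, -, hww⟩ := hsim.exists_sessionSnoc hsel hO hN hξ₀ hξ₀s hw1.1 hw1.2.1 ρ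
  have hξ₁ := hsel.valid_sessionSnoc hξ₀s hwf hwi hN hs haf hξ₀ hwO
  have hξ₁s := sessionOnly_sessionSnoc (O := O) (b := b) (k := k) hξ₀s hwf hwi
  set ξ₁ := O.sessionSnoc b k _ hξ₀s w' hwf hwi with hξ₁def
  have hw₁ : w' ∈ ξ₁.events := .inl rfl
  obtain ⟨r', hrO, hrf, hri, hrρ, hrs, -⟩ := hO.operationClosure.exists_copy hr1.1 hr1.2.1 ρ ξ₁.finite
  have hξ₂ := hsel.valid_sessionSnoc hξ₁s hrf hri hN hs haf hξ₁ hrO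
  have hsp := samePast_sessionSnoc (O := O) (b := b) (k := k) hξ₁s hrf hri
  have hwx : ξ₁.Writes w' x := (hww x).2 hw2
  have hwsess : w' ∈ ξ₁.session r' := ⟨hw₁, .inr (hwρ.trans hrρ.symm)⟩
  have hmem : w' ∈ (O.sessionSnoc b k ξ₁ hξ₁s r' hrf hri).wr x r' := by
    rw [sessionSnoc_wr]
    refine mem_sessionReads_of_last hsel ((OpSpec.reads_congr hrs x).2 hr2) ⟨hwsess, hwx⟩ ?_
    rintro a (rfl | ha) hne
    · exact absurd rfl hne
    · exact .inr ⟨rfl, ha⟩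
  obtain ⟨ε, h0, hn, h⟩ := hv _ (hsel.isExecution hN.wellFormed hξ₂) x w' r'
    (Execution.so_of_session _ ⟨.inr hw₁, hwsess.2⟩ (.inr ⟨rfl, hw₁⟩))
    ((hsp.writes hw₁ x).2 hwx) ⟨w', hmem⟩
  exact ⟨_, hξ₂, x, ε, h, h0 ▸ hwi, by rw [h0, hn]; exact hmem⟩

/-! ### Formulas by which the session order is visible -/

theorem VisFormula.Holds.length_eq_one {v : VisFormula} (hv : v.WellFormed) (hs : v.IsSimple)
    {ξ : Execution S} {x : S.Obj} {e r : Event S} (h : v.Holds ξ x e r)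
    (hbetween : ∀ c, ξ.ar e c → ¬ ξ.ar c r) :
    ∃ p, v.rels = [p] ∧ p.interp ξ e r ∧
      (∀ E ∈ v.confx, ∀ j ∈ E, ξ.Writes (if j = 0 then e else r) x) ∧
      ∀ E ∈ v.conf, ∃ y, ∀ j ∈ E, ξ.Writes (if j = 0 then e else r) y := by
  obtain ⟨ε, rfl, rfl, h⟩ := h
  have hmat := (VisFormula.holdsAt_iff.1 h).1
  have hlen : v.rels.length = 1 := by
    by_contra hne
    have hpos := hv.length_pos
    exact hbetween _ (hmat.ar hs (i := 0) (j := 1) (by omega) (by omega))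
      (hmat.ar hs (by omega) le_rfl)
  obtain ⟨p, hp⟩ := List.length_eq_one_iff.1 hlen
  have hε : ∀ j ≤ v.rels.length, (if j = 0 then ε 0 else ε v.rels.length) = ε j := by
    intro j hj
    split_ifs with h0
    · rw [h0]
    · rw [show v.rels.length = j by omega]
  refine ⟨p, hp, ?_, fun E hE j hj => ?_, fun E hE => ?_⟩
  · have h1 := hmat.rel 0 (by omega)
    simp only [hp, List.getElem_cons_zero] at h1
    simpa [hlen] using h1
  · rw [hε j (hv.confx_le E hE j hj)]
    exact h.confx E hE j hj
  · obtain ⟨y, hy⟩ := h.conf E hE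
    refine ⟨y, fun j hj => ?_⟩
    rw [hε j (hv.conf_le E hE j hj)]
    exact hy j hj

/-- A formula by which the session order is visible in the executions over `O` makes it visible in
all executions, for last events that write a set of objects which an event of `O` can write. It
consists of a single relation, which is not `wr`: an event need not read from its session. -/
theorem Simulable.matches_of_so [LinearOrder S.Obj] [Infinite S.Obj] [Infinite S.Id]
    [Infinite S.Replica] (hsim : Simulable O b) (hsel : O.Selects b k) (hO : O.StandingAssumptions)
    {N : Set VisFormula} (hN : O.IsConsistencyModel N) (hs : ∀ v ∈ N, v.IsSimple)
    (haf : ArbitrationFree N) {w : VisFormula} (hw : O.SoVisible w) (hww : w.WellFormed)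
    (hws : w.IsSimple) {i₀ : Event S} (hi₀ : i₀.IsInit) (hi₀O : i₀ ∈ O.events) {s : Event S}
    (hsO : s ∈ O.events) (hsi : ¬ s.IsInit) {z : S.Obj} (hsz : O.Reads s z) {W : Set S.Obj}
    (hW : ∀ y ∈ W, O.MayWrite s y) (hW' : ∀ y, O.AlwaysWrites s y → y ∈ W) {ζ : Execution S}
    {a r : Event S} (har : ζ.so a r) (haz : ζ.Writes a z) (hrW : ∀ y, ζ.Writes r y ↔ y ∈ W) :
    ∃ ε : ℕ → Event S, ε 0 = a ∧ ε w.rels.length = r ∧ w.Matches ζ z ε := by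
  obtain ⟨ρ⟩ : Nonempty S.Replica := inferInstance
  obtain ⟨e₀, he1, he2, he3⟩ := hO.operationClosure.exists_writer z
  have hξ₀ := hsel.valid_initial N hi₀ hi₀O
  have hξ₀s := sessionOnly_initial (O := O) hi₀
  obtain ⟨e, hef, hei, heO, heρ, -, hew⟩ :=
    hsim.exists_sessionSnoc hsel hO hN hξ₀ hξ₀s he1.1 he1.2.1 ρ
  have hez : ∀ y, (O.sessionSnoc b k _ hξ₀s e hef hei).Writes e y ↔ y = z := by
    intro y
    rw [hew]
    refine ⟨fun h => ?_, fun h => h ▸ he3⟩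
    have : y ∈ O.var e₀ := .inr h
    rwa [he2] at this
  have hξ₁ := hsel.valid_sessionSnoc hξ₀s hef hei hN hs haf hξ₀ heO
  have hξ₁s := sessionOnly_sessionSnoc (O := O) (b := b) (k := k) hξ₀s hef hei
  have hξ₁e : (O.sessionSnoc b k _ hξ₀s e hef hei).events = {e, i₀} := rfl
  generalize O.sessionSnoc b k _ hξ₀s e hef hei = ξ₁ at hez hξ₁ hξ₁s hξ₁e
  have hE₁ := hsel.isExecution hN.wellFormed hξ₁
  have heξ : e ∈ ξ₁.events := by rw [hξ₁e]; exact .inl rfl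
  have hiξ : i₀ ∈ ξ₁.events := by rw [hξ₁e]; exact .inr rfl
  -- nothing is arbitrated between `e` and a last event
  have hbetween : ∀ {r : Event S} {past ω g} (h : ξ₁.Appendable r past ω) (c : Event S),
      (ξ₁.snoc r past ω g h).ar e c → ¬ (ξ₁.snoc r past ω g h).ar c r := by
    intro r past ω g h c h1 h2
    have h3 := (Execution.snoc_ar h).1 h2
    rw [hξ₁e] at h3
    rcases h3 with rfl | rfl
    · exact Execution.ar_irrefl _ _ h1
    · exact Execution.not_ar_init _ hi₀ h1
  -- an event that reads the initial event only
  obtain ⟨p, hp, hpwr⟩ : ∃ p, w.rels = [p] ∧ p ≠ .wr := by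
    obtain ⟨r₁, hr1, hr2, hr3, hr4, hr5, -, -⟩ :=
      hO.operationClosure.exists_copy hsO hsi ρ ξ₁.finite
    have happ : ξ₁.Appendable r₁ ξ₁.events fun y => {c | O.Reads r₁ y ∧ c = i₀} :=
      ⟨hr2, hr3, subset_rfl, ξ₁.session_subset _, fun c d h _ => (ξ₁.ar_mem _ _ (ξ₁.rb_le_ar _ _ h)).1,
        fun y c hc => hc.2 ▸ hiξ⟩
    have hEr := hsel.isExecution_snoc hE₁ happ hr1
      (g := fun x => O.writtenValue ξ₁ r₁ x {c | O.Reads r₁ x ∧ c = i₀}) (fun _ => rfl)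
      (fun y hy => ⟨i₀, hy, rfl⟩) (fun y hy => by
        have hsub : ({i₀} : Set (Event S)) ⊆ ξ₁.events := Set.singleton_subset_iff.2 hiξ
        refine ⟨{i₀}, hsub, ?_, ?_⟩
        · rintro c rfl
          exact hE₁.init_writes hiξ hi₀ y
        · obtain ⟨c, hc⟩ := hsel.pick_nonempty hy (c := ξ₁.restrict {i₀}) ⟨i₀, hiξ, rfl⟩
          ext d
          constructor
          · rintro ⟨-, rfl⟩
            have : c = d := hc.1.2
            exact this ▸ hc
          · exact fun hd => ⟨hy, hd.1.2⟩)
      fun y hy => Set.eq_empty_of_forall_notMem fun c hc => hy hc.1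
    obtain ⟨p, hp, hint, -, -⟩ := VisFormula.Holds.length_eq_one hww hws
      (hw _ hEr z e r₁ ((Execution.snoc_so happ).2 ⟨heξ, .inr (heρ.trans hr4.symm)⟩)
        (((Execution.samePast_snoc happ).writes heξ z).2 ((hez z).2 rfl))
        (by rw [Execution.snoc_wr]; exact ⟨i₀, (OpSpec.reads_congr hr5 z).2 hsz, rfl⟩))
      (hbetween happ)
    refine ⟨p, hp, ?_⟩
    rintro rfl
    obtain ⟨y, hy⟩ := hint
    rw [Execution.snoc_wr] at hy
    exact hei (hy.2 ▸ hi₀)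
  -- an event that writes `W`
  obtain ⟨hcx, hc⟩ : (∀ E ∈ w.confx, 1 ∈ E → z ∈ W) ∧
      ∀ E ∈ w.conf, (0 ∈ E → 1 ∈ E → z ∈ W) ∧ (1 ∈ E → W.Nonempty) := by
    obtain ⟨s', -, hs1, hs2, hs3, hs4, -, -⟩ :=
      hO.operationClosure.exists_copy hsO hsi ρ ξ₁.finite
    have hss : ∀ r : Event S, r.replica? = some ρ → ξ₁.session r = ξ₁.session s' := by
      intro r hr
      simp only [Execution.session, hr, hs3]
    have hrs := OpSpec.reads_congr hs4
    have happ : ∀ r, r ∉ ξ₁.events → r.replica? = some ρ →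
        ξ₁.Appendable r (ξ₁.session s') (O.sessionReads b k ξ₁ s') := by
      intro r hr hrρ
      have h := hξ₁s.appendable (O := O) (b := b) (k := k) hs1 hs2
      refine ⟨hr, not_isInit_of_replica hrρ, h.past_subset, (hss r hrρ).subset, ?_, h.subset_past⟩
      rw [hss r hrρ]
      exact h.closed
    have hread : ∀ x, O.Reads s x → ∃ A : Set (Event S), A ⊆ ξ₁.events ∧ (∀ a ∈ A, ξ₁.Writes a x) ∧
        (∀ a ∈ ξ₁.sessionAt ρ, ξ₁.Writes a x → a ∈ A) ∧
        O.sessionReads b k ξ₁ s' x = (ξ₁.restrict A).pick b k := by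
      intro x hx
      refine ⟨ξ₁.sessionWriters s' x, fun a ha => ha.1.1, fun a ha => ha.2, fun a ha hax =>
        ⟨⟨ha.1, ha.2.imp id fun h => h.trans hs3.symm⟩, hax⟩, ?_⟩
      ext a
      exact ⟨fun h => h.2, fun h => ⟨(hrs x).2 hx, h⟩⟩
    have hread' : ∀ x, ¬ O.Reads s x → O.sessionReads b k ξ₁ s' x = ∅ := fun x hx =>
      Set.eq_empty_of_forall_notMem fun a ha => hx ((hrs x).1 ha.1)
    have hne : ∀ x, O.Reads s x → (O.sessionReads b k ξ₁ s' x).Nonempty := fun x hx =>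
      hsel.sessionReads_nonempty hE₁ ((hrs x).2 hx)
    obtain ⟨r₁, hr1, hr2, hr3, hr4, hr5⟩ := hsim.exists_event hsel hO
      (hsel.sessionFaithful hN hξ₁) hsO hsi happ hread hread' hne hW hW'
    have happr := happ r₁ hr2 hr3
    have hEr := hsel.isExecution_snoc hE₁ happr hr1
      (g := fun x => O.writtenValue ξ₁ r₁ x (O.sessionReads b k ξ₁ s' x)) (fun _ => rfl)
      (fun x hx => hne x ((hr4 x).1 hx)) (fun x hx => by
        obtain ⟨A, h1, h2, -, h3⟩ := hread x ((hr4 x).1 hx)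
        exact ⟨A, h1, h2, h3⟩) fun x hx => hread' x (mt (hr4 x).2 hx)
    have hsp := Execution.samePast_snoc (g := fun x =>
      O.writtenValue ξ₁ r₁ x (O.sessionReads b k ξ₁ s' x)) happr
    have hrw : ∀ y, (ξ₁.snoc r₁ _ _ (fun x =>
        O.writtenValue ξ₁ r₁ x (O.sessionReads b k ξ₁ s' x)) happr).Writes r₁ y ↔ y ∈ W := by
      intro y
      rw [← hr5, Execution.Writes, Execution.snoc_wval, Option.isSome_iff_exists]
    obtain ⟨-, -, -, h1, h2⟩ := VisFormula.Holds.length_eq_one hww hws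
      (hw _ hEr z e r₁ ((Execution.snoc_so happr).2
        (by rw [hss r₁ hr3]; exact ⟨heξ, .inr (heρ.trans hs3.symm)⟩))
        ((hsp.writes heξ z).2 ((hez z).2 rfl))
        (by rw [Execution.snoc_wr]; exact hne z hsz)) (hbetween happr)
    refine ⟨fun E hE h1E => (hrw z).1 (h1 E hE 1 h1E), fun E hE => ?_⟩
    obtain ⟨y, hy⟩ := h2 E hE
    refine ⟨fun h0E h1E => ?_, fun h1E => ⟨y, (hrw y).1 (hy 1 h1E)⟩⟩
    have hyz := (hez y).1 ((hsp.writes heξ y).1 (hy 0 h0E))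
    exact hyz ▸ (hrw y).1 (hy 1 h1E)
  have hle : ∀ j ≤ w.rels.length, j = 0 ∨ j = 1 := fun j hj => by
    rw [hp, List.length_singleton] at hj
    omega
  have har' := ζ.so_mem _ _ har
  refine ⟨fun j => if j = 0 then a else r, rfl, by simp [hp], fun j _ => ?_, fun j hj => ?_,
    fun E hE j hj => ?_, fun E hE => ?_⟩
  · split_ifs
    · exact har'.1
    · exact har'.2
  · have hps : p.IsSimple := hws p (by rw [hp]; exact List.mem_singleton_self p)
    obtain rfl : j = 0 := by
      rw [hp, List.length_singleton] at hj
      omega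
    simp only [hp, List.getElem_cons_zero, if_true]
    rcases hps with rfl | rfl | rfl | rfl
    · exact har
    · exact absurd rfl hpwr
    · exact ζ.so_le_rb _ _ har
    · exact ζ.so_le_ar har
  · rcases hle j (hww.confx_le E hE j hj) with rfl | rfl
    · exact haz
    · exact (hrW z).2 (hcx E hE hj)
  · obtain ⟨h1, h2⟩ := hc E hE
    by_cases h0E : 0 ∈ E
    · refine ⟨z, fun j hj => ?_⟩
      rcases hle j (hww.conf_le E hE j hj) with rfl | rfl
      · exact haz
      · exact (hrW z).2 (h1 h0E hj)
    · by_cases h1E : 1 ∈ E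
      · obtain ⟨y, hy⟩ := h2 h1E
        refine ⟨y, fun j hj => ?_⟩
        rcases hle j (hww.conf_le E hE j hj) with rfl | rfl
        · exact absurd hj h0E
        · exact (hrW y).2 hy
      · refine ⟨z, fun j hj => ?_⟩
        rcases hle j (hww.conf_le E hE j hj) with rfl | rfl
        · exact absurd hj h0E
        · exact absurd hj h1E

/-! ### A consistent choice of the events read by a last event -/

/-- Suppose that whether `e` belongs to `F U` depends only on the elements of `U` above `e` and,
monotonically, on whether `e` belongs to `U`. Then `F` has a fixed point. It can be prescribed above
an element `m`, and it includes `m` if `m` supports itself. -/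
theorem exists_fixedPoint_of_local {α : Type u} {R : α → α → Prop} (hwf : WellFounded (flip R))
    (htr : ∀ a b c, R a b → R b c → R a c) (hirr : ∀ a, ¬ R a a) (F : Set α → Set α)
    (hF : ∀ U U' e, (∀ d, R e d → (d ∈ U ↔ d ∈ U')) → (e ∈ U → e ∈ U') → e ∈ F U → e ∈ F U')
    (m : α) (U₀ : Set α) (hU₀ : ∀ e, R m e → (e ∈ U₀ ↔ e ∈ F U₀)) :
    ∃ U, F U = U ∧ (∀ e, R m e → (e ∈ U ↔ e ∈ U₀)) ∧ (m ∈ F (insert m U) → m ∈ U) := by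
  set P : α → Prop := hwf.fix fun e ih =>
    (R m e ∧ e ∈ U₀) ∨ ¬ R m e ∧ e ∈ F (insert e {d | ∃ h : R e d, ih d h}) with hP
  have hPe : ∀ e, P e ↔ (R m e ∧ e ∈ U₀) ∨
      ¬ R m e ∧ e ∈ F (insert e {d | R e d ∧ P d}) := by
    intro e
    rw [hP, hwf.fix_eq]
    simp only [exists_prop]
  set U : Set α := {e | P e} with hU
  have hUm : ∀ e, R m e → (e ∈ U ↔ e ∈ U₀) := by
    intro e he
    change P e ↔ _
    rw [hPe]
    simp [he]
  have hUn : ∀ e, ¬ R m e → (e ∈ U ↔ e ∈ F (insert e {d | R e d ∧ P d})) := by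
    intro e he
    change P e ↔ _
    rw [hPe]
    simp [he]
  have hagree : ∀ e d, R e d → (d ∈ insert e {d | R e d ∧ P d} ↔ d ∈ U) := by
    intro e d hd
    constructor
    · rintro (rfl | h)
      · exact absurd hd (hirr _)
      · exact h.2
    · exact fun h => .inr ⟨hd, h⟩
  refine ⟨U, ?_, hUm, fun h => ?_⟩
  · ext e
    by_cases he : R m e
    · have h1 : ∀ d, R e d → (d ∈ U ↔ d ∈ U₀) := fun d hd => hUm d (htr _ _ _ he hd)
      rw [hUm e he]
      constructor
      · exact fun h => (hU₀ e he).2 (hF _ _ e h1 (hUm e he).1 h)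
      · exact fun h => hF _ _ e (fun d hd => (h1 d hd).symm) (hUm e he).2 ((hU₀ e he).1 h)
    · constructor
      · exact fun h => (hUn e he).2 (hF _ _ e (fun d hd => (hagree e d hd).symm)
          (fun _ => .inl rfl) h)
      · exact fun h => hF _ _ e (hagree e) (fun _ => h) ((hUn e he).1 h)
  · refine (hUn m (hirr m)).2 (hF _ _ m (fun d hd => ?_) (fun _ => .inl rfl) h)
    rw [hagree m d hd]
    refine ⟨fun h => h.resolve_left ?_, fun h => .inr h⟩
    rintro rfl
    exact hirr _ hd

theorem Execution.wellFounded_flip_ar (ξ : Execution S) : WellFounded (flip ξ.ar) := by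
  refine Subrelation.wf (r := InvImage (· < ·) fun e => {d | ξ.ar e d}.ncard) ?_
    (InvImage.wf _ wellFounded_lt)
  intro d e (h : ξ.ar e d)
  refine Set.ncard_lt_ncard ⟨fun c hc => ξ.ar_trans _ _ _ h hc, fun hsub => ?_⟩
    (ξ.finite.subset fun c hc => (ξ.ar_mem _ _ hc).2)
  exact ξ.ar_irrefl _ (hsub h)

theorem SamePast.interp_iff {ξ ξ' : Execution S} {B : Set (Event S)} (h : SamePast ξ ξ' B)
    {p : RelExpr} (hp : p.IsSimple) {a r : Event S} (ha : a ∈ B) (hr : r ∈ B) :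
    p.interp ξ' a r ↔ p.interp ξ a r := by
  rcases hp with rfl | rfl | rfl | rfl
  · exact h.so a ha r hr
  · exact exists_congr fun x => by rw [h.wr r hr]
  · exact h.rb a ha r hr
  · exact h.ar a ha r hr

/-- Let `ζ` and `ζ'` agree on the past `B` of `r` and `r'`. If `r` sees `e` in `ζ`, then `r'` sees `e`
in `ζ'`, provided that `r'` keeps the dependencies of `r` on `e` and on the events arbitrated after
`e`: an instance of a formula that starts with `e` involves no other events. -/
theorem SamePast.mem_sees {ζ ζ' : Execution S} {B : Set (Event S)} (h : SamePast ζ ζ' B)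
    {M : Set VisFormula} (hM : ∀ v ∈ M, v.WellFormed) (hs : ∀ v ∈ M, v.IsSimple) {r r' e : Event S}
    (hrB : ∀ a, ζ.ar a r → a ∈ B) (hr' : r' ∈ ζ'.events)
    (har : ∀ a ∈ B, ζ'.ar a r') (hso : ∀ a ∈ B, ζ.so a r → ζ'.so a r')
    (hw : ∀ y, ζ.Writes r y → ζ'.Writes r' y)
    (hrb : ∀ a ∈ B, a = e ∨ ζ.ar e a → ζ.rb a r → ζ'.rb a r')
    (hwr : ∀ a ∈ B, a = e ∨ ζ.ar e a → (∃ y, a ∈ ζ.wr y r) → ∃ y, a ∈ ζ'.wr y r') {x : S.Obj}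
    (he : e ∈ ζ.sees M x r) : e ∈ ζ'.sees M x r' := by
  obtain ⟨v, hv, ε, rfl, rfl, hm⟩ := he
  have hpos := (hM v hv).length_pos
  have hB : ∀ j < v.rels.length, ε j ∈ B := fun j hj => hrB _ (hm.ar (hs v hv) hj le_rfl)
  have hε : ∀ j ≤ v.rels.length, ∀ y, ζ.Writes (ε j) y →
      ζ'.Writes (if j < v.rels.length then ε j else r') y := by
    intro j hj y hy
    split_ifs with hjn
    · exact (h.writes (hB j hjn) y).2 hy
    · obtain rfl : j = v.rels.length := by omega
      exact hw y hy
  refine ⟨v, hv, fun j => if j < v.rels.length then ε j else r', if_pos hpos,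
    if_neg (lt_irrefl _), fun j _ => ?_, fun j hj => ?_, fun E hE j hj => ?_, fun E hE => ?_⟩
  · split_ifs with hjn
    · exact h.mem' _ (hB j hjn)
    · exact hr'
  · have h1 := hm.rel j hj
    have h2 := hs v hv _ (List.getElem_mem hj)
    simp only [if_pos hj]
    by_cases hjn : j + 1 < v.rels.length
    · rw [if_pos hjn]
      exact (h.interp_iff h2 (hB j hj) (hB _ hjn)).2 h1
    · rw [if_neg hjn]
      rw [show j + 1 = v.rels.length by omega] at h1
      have hej : ε j = ε 0 ∨ ζ.ar (ε 0) (ε j) := by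
        rcases Nat.eq_zero_or_pos j with rfl | h0
        · exact .inl rfl
        · exact .inr (hm.ar (hs v hv) h0 hj.le)
      generalize v.rels[j] = p at h1 h2
      rcases h2 with rfl | rfl | rfl | rfl
      · exact hso _ (hB j hj) h1
      · exact hwr _ (hB j hj) hej h1
      · exact hrb _ (hB j hj) hej h1
      · exact har _ (hB j hj)
  · exact hε j ((hM v hv).confx_le E hE j hj) x (hm.confx E hE j hj)
  · obtain ⟨y, hy⟩ := hm.conf E hE
    exact ⟨y, fun j hj => hε j ((hM v hv).conf_le E hE j hj) y (hy j hj)⟩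

/-- If layers are defined by arbitration, every formula of a normal form holds in some valid
execution at events the first of which is read by the last one. In an execution that is invalid
because of `v`, let `r` be the first event that does not read what it should. The events read by
`r` are revised: those after the last event `m` that `v` alone makes selected are kept, and the
others are chosen, from the last one to the first one, such that `r` reads what it sees when it
reads this. Then `m` is among them. -/
theorem Simulable.hasReadInstance [LinearOrder S.Obj] [Infinite S.Obj] [Infinite S.Id]
    [Infinite S.Replica] (hsim : Simulable O true) (hsel : O.Selects true k)
    (hO : O.StandingAssumptions)
    {N M : Set VisFormula} (hN : O.IsConsistencyModel N) (hs : ∀ v ∈ N, v.IsSimple)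
    (haf : ArbitrationFree N) (hNM : ∀ ξ : Execution S, O.Valid N ξ → O.Valid M ξ)
    (hM : O.IsConsistencyModel M) (hMs : ∀ v ∈ M, v.IsSimple) {v : VisFormula} (hv : v ∈ M)
    (hnv : ¬ O.IsVacuous M v) : HasReadInstance O M v := by
  by_contra hno
  have hMw := hM.wellFormed
  have hM'w : ∀ w ∈ M \ {v}, w.WellFormed := fun w hw => hMw w hw.1
  obtain ⟨ξ, hval, r₁, hr₁, x₁, hx₁, hne₁⟩ := hsel.exists_pick_ne hnv
  have hE : O.IsExecution ξ := hval.elim (hsel.isExecution hMw) (hsel.isExecution hM'w)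
  obtain ⟨i₀, hi₀ξ, hi₀, -⟩ := ξ.exists_init
  have hgain : ∀ z r d, r ∈ ξ.events → O.Reads r z → d ∈ OpSpec.gain true k M v ξ z r →
      ¬ d.IsInit := by
    intro z r d hr hz hd hdi
    obtain ⟨η, hη, h⟩ := hsim.hasReadInstance_of_soVisible hsel hO hN hs haf
      (OpSpec.soVisible_of_gain hM hE hd hdi hr hz) hi₀ (hE.events_subset hi₀ξ)
    exact hno ⟨η, hNM η hη, h⟩
  have hξM : ¬ O.Valid M ξ := by
    intro hξ
    obtain ⟨d, hd⟩ := OpSpec.gain_nonempty hne₁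
    obtain ⟨ε, h0, hn, hm⟩ := OpSpec.exists_matches_of_gain hd
    have hwr := (hsel.valid_iff.1 hξ r₁ hr₁).reads x₁ hx₁
    have hdw : d ∈ ξ.wr x₁ r₁ := by rw [hwr]; exact hd.2.2 rfl
    exact hno ⟨ξ, hξ, x₁, ε, VisFormula.holdsAt_iff.2 ⟨hm, hn ▸ ⟨d, hdw⟩⟩,
      h0 ▸ hgain x₁ r₁ d hr₁ hx₁ hd, by rw [h0, hn]; exact hdw⟩
  have hξ' : O.Valid (M \ {v}) ξ := hval.resolve_left hξM
  -- the first event that does not read as required by `M`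
  obtain ⟨r, ⟨hr, x, hx, hne⟩, hmin⟩ := exists_maximal_rel (R := flip ξ.ar) ξ.ar_irrefl
    (fun a c d h h' => ξ.ar_trans d c a h' h)
    (s := {r ∈ ξ.events | ∃ x, O.Reads r x ∧ (ξ.restrict (ξ.sees M x r)).pick true k ≠
      (ξ.restrict (ξ.sees (M \ {v}) x r)).pick true k})
    (ξ.finite.subset fun _ h => h.1) ⟨r₁, hr₁, x₁, hx₁, hne₁⟩
  have hri : ¬ r.IsInit := fun h => OpSpec.not_reads_of_isInit h x hx
  obtain ⟨ρ, hρ⟩ : ∃ ρ, r.replica? = some ρ := by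
    cases r with
    | init s => exact absurd trivial hri
    | call i ρ o => exact ⟨ρ, rfl⟩
  set B : Set (Event S) := {a | ξ.ar a r} with hB
  have hBξ : B ⊆ ξ.events := fun a ha => (ξ.ar_mem _ _ ha).1
  have hiB : i₀ ∈ B := ξ.so_le_ar (ξ.init_so hi₀ξ hi₀ hr hri)
  have hsp₀ := ξ.samePast_initialSegment hBξ (fun a c hc h => ξ.ar_trans _ _ _ h hc) ⟨i₀, hiB, hi₀⟩
  have hηe : (ξ.initialSegment B hBξ (fun a c hc h => ξ.ar_trans _ _ _ h hc)
    ⟨i₀, hiB, hi₀⟩).events = B := rfl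
  generalize ξ.initialSegment B hBξ (fun a c hc h => ξ.ar_trans _ _ _ h hc) ⟨i₀, hiB, hi₀⟩ = η
    at hsp₀ hηe
  have hηM : O.Valid M η := by
    refine hsel.valid_iff.2 fun a ha => ?_
    rw [hηe] at ha
    obtain ⟨h1, h2, h3, h4, h5⟩ := hsel.valid_iff.1 hξ' a (hBξ ha)
    refine hsp₀.validAt hMw hMs ha ⟨h1, h2, fun z hz => ?_, h4, h5⟩
    rw [h3 z hz]
    by_contra hcon
    exact hmin a ⟨hBξ ha, z, hz, fun h => hcon h.symm⟩ ha
  have hrB : r ∉ B := ξ.ar_irrefl r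
  -- the last event that is selected thanks to `v` only
  obtain ⟨m, ⟨z, hz, hmz⟩, hmax⟩ := exists_maximal_rel ξ.ar_irrefl ξ.ar_trans
    (s := {d | ∃ z, O.Reads r z ∧ d ∈ OpSpec.gain true k M v ξ z r})
    (ξ.finite.subset fun d ⟨z, _, hd⟩ => Execution.sees_subset hd.1)
    (by obtain ⟨d, hd⟩ := OpSpec.gain_nonempty hne; exact ⟨d, x, hx, hd⟩)
  have hmB : m ∈ B := Execution.sees_ar hMw hMs hmz.1
  -- appending `r` to `η` such that it reads the events in `U`
  have hpast : ∀ a ∈ η.session r, ξ.so a r := by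
    rintro a ⟨ha, ha'⟩
    rw [hηe] at ha
    exact ξ.so_of_session ⟨hBξ ha, ha'⟩ ha
  have happ : ∀ (U : Set (Event S)) (ω : S.Obj → Set (Event S)), (∀ z, ω z ⊆ U ∩ B) →
      ∀ r', r' ∉ η.events → r'.replica? = some ρ →
        η.Appendable r' ({a | ξ.rb a r} ∪ U ∩ B) ω := by
    intro U ω hω r' hr' hρ'
    have hsess : η.session r' = η.session r := by simp only [Execution.session, hρ, hρ']
    refine ⟨hr', not_isInit_of_replica hρ', ?_, ?_, ?_, fun z a ha => .inr (hω z ha)⟩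
    · rw [hηe]
      rintro a (ha | ha)
      · exact ξ.rb_le_ar _ _ ha
      · exact ha.2
    · rw [hsess]
      exact fun a ha => .inl (ξ.so_le_rb _ _ (hpast a ha))
    · rw [hsess]
      intro a c hac hc
      have hcB : c ∈ B := hηe ▸ hc.1
      have haB := hsp₀.down' a c hcB (η.rb_le_ar _ _ hac)
      exact .inl (ξ.rb_so ((hsp₀.rb a haB c hcB).1 hac) (hpast c hc))
  have hrη : r ∉ η.events := hηe ▸ hrB
  set E : Set (Event S) → Execution S := fun U =>
    η.snoc r ({a | ξ.rb a r} ∪ U ∩ B) (fun _ => U ∩ B) (ξ.wval r)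
      (happ U _ (fun _ => subset_rfl) r hrη hρ) with hEdef
  have hspE : ∀ U, SamePast ξ (E U) B := fun U => by
    have := Execution.samePast_snoc (g := ξ.wval r)
      (happ U _ (fun _ => subset_rfl) r hrη hρ)
    exact hsp₀.trans this hηe.symm.subset
  have hEmem : ∀ U, r ∈ (E U).events := fun U => .inl rfl
  have hEar : ∀ U a, (E U).ar a r ↔ a ∈ B := fun U a => by
    rw [← hηe]; exact Execution.snoc_ar _
  have hEso : ∀ U, ∀ a ∈ B, ((E U).so a r ↔ ξ.so a r) := fun U a ha => by
    refine (Execution.snoc_so _).trans ⟨hpast a, fun h => ?_⟩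
    exact ⟨hηe ▸ ha, (ξ.mem_session_of_so h).2⟩
  have hErb : ∀ U a, (E U).rb a r ↔ a ∈ ({a | ξ.rb a r} ∪ U ∩ B) := fun U a =>
    Execution.snoc_rb _
  have hEwr : ∀ U y, (E U).wr y r = U ∩ B := fun U y => Execution.snoc_wr _ y
  have hEw : ∀ U y, (E U).Writes r y ↔ ξ.Writes r y := fun U y => by
    rw [Execution.Writes, Execution.Writes, Execution.snoc_wval]
  set U₀ : Set (Event S) := {a | ∃ y, a ∈ ξ.wr y r} with hU₀
  have hU₀B : U₀ ⊆ B := fun a ⟨y, hy⟩ => ξ.wr_le_ar hy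
  -- whether `e` is seen depends on `U` above `e`
  have hloc : ∀ U U' e z, (∀ d, ξ.ar e d → d ∈ U → d ∈ U') → (e ∈ U → e ∈ U') →
      e ∈ (E U).sees M z r → e ∈ (E U').sees M z r := by
    intro U U' e z h h' he
    have hab : ∀ a ∈ B, a = e ∨ (E U).ar e a → a ∈ U → a ∈ U' := by
      rintro a ha (rfl | hea) haU
      · exact h' haU
      · exact h a (((hspE U).ar e ((hEar U e).1 (Execution.sees_ar hMw hMs he)) a ha).1 hea) haU
    refine SamePast.mem_sees ((hspE U).symm.trans (hspE U') subset_rfl) hMw hMs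
      (fun a => (hEar U a).1) (hEmem U') (fun a => (hEar U' a).2)
      (fun a ha hso => (hEso U' a ha).2 ((hEso U a ha).1 hso))
      (fun y hy => (hEw U' y).2 ((hEw U y).1 hy)) (fun a ha hae hrb => ?_)
      (fun a ha hae => ?_) he
    · rw [hErb] at hrb ⊢
      exact hrb.imp id fun h1 => ⟨hab a ha hae h1.1, ha⟩
    · rintro ⟨y, hy⟩
      rw [hEwr] at hy
      exact ⟨y, by rw [hEwr]; exact ⟨hab a ha hae hy.1, ha⟩⟩
  have hfrom : ∀ U e z, ∀ M' ⊆ M, (∀ a, a = e ∨ ξ.ar e a → a ∈ U₀ → a ∈ U) →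
      e ∈ ξ.sees M' z r → e ∈ (E U).sees M' z r := by
    intro U e z M' hMM h he
    refine SamePast.mem_sees (hspE U) (fun w hw => hMw w (hMM hw)) (fun w hw => hMs w (hMM hw))
      (fun a ha => ha) (hEmem U) (fun a => (hEar U a).2) (fun a ha => (hEso U a ha).2)
      (fun y => (hEw U y).2) (fun a ha hae hrb => (hErb U a).2 (.inl hrb))
      (fun a ha hae hwr => ?_) he
    obtain ⟨y, -⟩ := id hwr
    exact ⟨y, by rw [hEwr]; exact ⟨h a hae hwr, ha⟩⟩
  have hsees₀ : ∀ z, (E U₀).sees M z r = ξ.sees M z r := by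
    intro z
    refine Set.Subset.antisymm (fun e he => ?_) fun e he =>
      hfrom U₀ e z M subset_rfl (fun a _ h => h) he
    refine SamePast.mem_sees (hspE U₀).symm hMw hMs (fun a => (hEar U₀ a).1) hr (fun a ha => ha)
      (fun a ha => (hEso U₀ a ha).1) (fun y => (hEw U₀ y).1) (fun a ha _ hrb => ?_)
      (fun a ha _ => ?_) he
    · rcases (hErb U₀ a).1 hrb with h1 | ⟨⟨y, hy⟩, -⟩
      · exact h1
      · exact ξ.wr_le_rb _ _ _ hy
    · rintro ⟨y, hy⟩
      rw [hEwr] at hy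
      exact hy.1
  set F : Set (Event S) → Set (Event S) := fun U =>
    {e | ∃ z, O.Reads r z ∧ e ∈ (ξ.restrict ((E U).sees M z r)).pick true k} with hF
  have hpickloc : ∀ U U' e z, (∀ d, ξ.ar e d → (d ∈ U ↔ d ∈ U')) → (e ∈ U → e ∈ U') →
      e ∈ (ξ.restrict ((E U).sees M z r)).pick true k →
      e ∈ (ξ.restrict ((E U').sees M z r)).pick true k := by
    intro U U' e z h h' he
    rw [Context.mem_pick_true] at he ⊢
    obtain ⟨⟨h1, h2⟩, h3⟩ := he
    have h4 := hloc U U' e z (fun d hd => (h d hd).1) h' h2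
    refine ⟨⟨h1, h4⟩, (Set.encard_le_encard ?_).trans h3⟩
    rintro d ⟨⟨hd1, hd2⟩, rfl | hd3⟩
    · exact ⟨⟨h1, h2⟩, .inl rfl⟩
    · have h5 := hloc U' U d z (fun c hc => (h c (ξ.ar_trans _ _ _ hd3.1 hc)).2)
        (h d hd3.1).2 hd2
      exact ⟨⟨hd1, h5⟩, .inr ⟨hd3.1, h2, h5⟩⟩
  obtain ⟨U, hFU, hUm, hmU⟩ := exists_fixedPoint_of_local ξ.wellFounded_flip_ar ξ.ar_trans
    ξ.ar_irrefl F (fun U U' e h h' ⟨z, hz, he⟩ => ⟨z, hz, hpickloc U U' e z h h' he⟩) m U₀ (by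
    intro e he
    have key : ∀ z, O.Reads r z → (e ∈ (ξ.restrict (ξ.sees M z r)).pick true k ↔
        e ∈ (ξ.restrict (ξ.sees (M \ {v}) z r)).pick true k) := by
      intro z hz
      refine mem_pick_true_congr (Q := {d | ξ.ar m d}) (Execution.sees_mono Set.sdiff_subset)
        (fun a ha d hd => ξ.ar_trans _ _ _ ha hd) (fun d hd hdp => ?_) he
      by_contra hcon
      exact hmax d ⟨z, hz, hdp.1.2, hcon, fun _ => hdp⟩ hd
    have hvr := hsel.valid_iff.1 hξ' r hr
    constructor
    · rintro ⟨y, hy⟩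
      have hyr := hE.reads_of_mem_wr hy
      rw [hvr.reads y hyr, ← key y hyr] at hy
      exact ⟨y, hyr, by rw [hsees₀]; exact hy⟩
    · rintro ⟨y, hyr, hy⟩
      rw [hsees₀, key y hyr, ← hvr.reads y hyr] at hy
      exact ⟨y, hy⟩)
  have hmfrom : ∀ U', m ∈ U' → (∀ e, ξ.ar m e → (e ∈ U' ↔ e ∈ U₀)) → ∀ M' ⊆ M,
      m ∈ ξ.sees M' z r → m ∈ (E U').sees M' z r := by
    intro U' hm' h M' hMM
    refine hfrom U' m z M' hMM ?_
    rintro a (rfl | ha) ha'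
    · exact hm'
    · exact (h a ha).2 ha'
  have hinsert : ∀ e, ξ.ar m e → (e ∈ insert m U ↔ e ∈ U₀) := by
    intro e he
    rw [← hUm e he]
    refine ⟨fun h => h.resolve_left ?_, fun h => .inr h⟩
    rintro rfl
    exact ξ.ar_irrefl _ he
  have hmpick : m ∈ (ξ.restrict ((E (insert m U)).sees M z r)).pick true k := by
    obtain ⟨h1, h2⟩ := (Context.mem_pick_true _).1 (hmz.2.2 rfl)
    have h3 := hmfrom (insert m U) (.inl rfl) hinsert M subset_rfl hmz.1
    refine (Context.mem_pick_true _).2 ⟨⟨h1.1, h3⟩, (Set.encard_le_encard ?_).trans h2⟩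
    rintro d ⟨⟨hd1, hd2⟩, rfl | hd3⟩
    · exact ⟨h1, .inl rfl⟩
    · have h4 : d ∈ ξ.sees M z r := by
        rw [← hsees₀]
        refine hloc (insert m U) U₀ d z (fun c hc => (hinsert c (ξ.ar_trans _ _ _ hd3.1 hc)).1)
          (hinsert d hd3.1).1 hd2
      exact ⟨⟨hd1, h4⟩, .inr ⟨hd3.1, h1.2, h4⟩⟩
  have hmUU : m ∈ U := hmU ⟨z, hz, hmpick⟩
  rw [Set.insert_eq_of_mem hmUU] at hmpick
  -- the simulation of `r`
  have hseesB : ∀ z, (E U).sees M z r ⊆ B := fun z a ha =>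
    (hEar U a).1 (Execution.sees_ar hMw hMs ha)
  have hUB : U ⊆ B := by
    intro a ha
    rw [← hFU] at ha
    obtain ⟨y, -, hy⟩ := ha
    exact hseesB y hy.1.2
  set ω : S.Obj → Set (Event S) := fun y =>
    {a | O.Reads r y ∧ a ∈ (ξ.restrict ((E U).sees M y r)).pick true k} with hω
  have hωU : ∀ y, ω y ⊆ U ∩ B := by
    rintro y a ⟨hy, ha⟩
    have : a ∈ U := by rw [← hFU]; exact ⟨y, hy, ha⟩
    exact ⟨this, hUB this⟩
  have hωpick : ∀ y, O.Reads r y → ω y = (ξ.restrict ((E U).sees M y r)).pick true k := by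
    intro y hy
    ext a
    exact ⟨fun h => h.2, fun h => ⟨hy, h⟩⟩
  have hω' : ∀ y, ¬ O.Reads r y → ω y = ∅ := fun y hy =>
    Set.eq_empty_of_forall_notMem fun a ha => hy ha.1
  obtain ⟨w, hwM, hw⟩ := hM.so_visible
  have hrO := hE.events_subset hr
  have hmay : ∀ y ∈ {y | ξ.Writes r y}, O.MayWrite r y := fun y hy => hE.mayWrite hr hy
  have halw : ∀ y, O.AlwaysWrites r y → y ∈ {y | ξ.Writes r y} :=
    fun y hy => hE.writes_of_always hr hy
  have hsess : ∀ y, O.Reads r y → ∀ a ∈ η.sessionAt ρ, η.Writes a y →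
      a ∈ (E U).sees M y r := by
    intro y hy a ha hay
    have haB : a ∈ B := hηe ▸ ha.1
    have hso : (E U).so a r := (hEso U a haB).2 (hpast a ⟨ha.1, ha.2.imp id fun h => h.trans hρ.symm⟩)
    exact ⟨w, hwM, hsim.matches_of_so hsel hO hN hs haf hw (hMw w hwM) (hMs w hwM) hi₀
      (hE.events_subset hi₀ξ) hrO hri hy hmay halw hso
      (((hspE U).writes haB y).2 ((hsp₀.writes haB y).1 hay)) (hEw U)⟩
  have hηpick : ∀ y, (η.restrict ((E U).sees M y r)).pick true k =
      (ξ.restrict ((E U).sees M y r)).pick true k := fun y =>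
    pick_restrict_congr (fun a ha => hBξ (hseesB y ha)) (fun a ha => hηe ▸ hseesB y ha)
      (fun a ha d hd => hsp₀.rb a (hseesB y ha) d (hseesB y hd))
      (fun a ha d hd => hsp₀.ar a (hseesB y ha) d (hseesB y hd)) true k
  have hωne : ∀ y, O.Reads r y → (ω y).Nonempty := by
    intro y hy
    rw [hωpick y hy]
    refine hsel.pick_nonempty hy ⟨i₀, hi₀ξ, hsess y hy i₀ ⟨hηe ▸ hiB, .inl hi₀⟩ ?_⟩
    exact (hsp₀.writes hiB y).2 (hE.init_writes hi₀ξ hi₀ y)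
  obtain ⟨r', hr'O, hr'η, hr'ρ, hr'r, hr'w⟩ := hsim.exists_event hsel hO
    (hsel.sessionFaithful hM hηM) hrO hri (happ U ω hωU) (fun y hy => by
      refine ⟨(E U).sees M y r, fun a ha => hηe ▸ hseesB y ha, fun a ha => ?_, hsess y hy,
        (hωpick y hy).trans (hηpick y).symm⟩
      have haB := hseesB y ha
      exact (hsp₀.writes haB y).2 (((hspE U).writes haB y).1 (Execution.sees_writes hMw ha)))
    hω' hωne hmay halw
  have happ' := happ U ω hωU r' hr'η hr'ρ
  set ζ := η.snoc r' _ ω (fun y => O.writtenValue η r' y (ω y)) happ' with hζ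
  have hspζ : SamePast ξ ζ B := by
    have := Execution.samePast_snoc (g := fun y => O.writtenValue η r' y (ω y)) happ'
    exact hsp₀.trans this hηe.symm.subset
  have hζmem : r' ∈ ζ.events := .inl rfl
  have hζar : ∀ a, ζ.ar a r' ↔ a ∈ B := fun a => by rw [← hηe]; exact Execution.snoc_ar _
  have hζso : ∀ a ∈ B, (ζ.so a r' ↔ ξ.so a r) := fun a ha => by
    refine (Execution.snoc_so _).trans ⟨fun h => hpast a ⟨h.1, ?_⟩, fun h => ⟨hηe ▸ ha, ?_⟩⟩
    · exact h.2.imp id fun h => h.trans (hr'ρ.trans hρ.symm)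
    · exact (ξ.mem_session_of_so h).2.imp id fun h => h.trans (hρ.trans hr'ρ.symm)
  have hζrb : ∀ a, ζ.rb a r' ↔ a ∈ ({a | ξ.rb a r} ∪ U ∩ B) := fun a => Execution.snoc_rb _
  have hζwr : ∀ a, (∃ y, a ∈ ζ.wr y r') ↔ a ∈ U ∩ B := by
    intro a
    simp only [hζ, Execution.snoc_wr]
    refine ⟨fun ⟨y, hy⟩ => hωU y hy, fun h => ?_⟩
    have h1 := h.1
    rw [← hFU] at h1
    obtain ⟨y, hy, hay⟩ := h1
    exact ⟨y, hy, hay⟩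
  have hζw : ∀ y, ζ.Writes r' y ↔ ξ.Writes r y := by
    intro y
    rw [Execution.Writes, Execution.snoc_wval, ← Option.isSome_iff_exists]
    exact hr'w y
  have hseesζ : ∀ y, ∀ M' ⊆ M, ζ.sees M' y r' = (E U).sees M' y r := by
    intro y M' hMM
    have hM'w : ∀ w ∈ M', w.WellFormed := fun w hw => hMw w (hMM hw)
    have hM's : ∀ w ∈ M', w.IsSimple := fun w hw => hMs w (hMM hw)
    ext e
    constructor
    · refine SamePast.mem_sees (hspζ.symm.trans (hspE U) subset_rfl) hM'w hM's
        (fun a => (hζar a).1) (hEmem U) (fun a => (hEar U a).2)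
        (fun a ha h => (hEso U a ha).2 ((hζso a ha).1 h))
        (fun y hy => (hEw U y).2 ((hζw y).1 hy)) (fun a _ _ h => (hErb U a).2 ((hζrb a).1 h))
        fun a _ _ h => ⟨y, by rw [hEwr]; exact (hζwr a).1 h⟩
    · refine SamePast.mem_sees ((hspE U).symm.trans hspζ subset_rfl) hM'w hM's
        (fun a => (hEar U a).1) hζmem (fun a => (hζar a).2)
        (fun a ha h => (hζso a ha).2 ((hEso U a ha).1 h))
        (fun y hy => (hζw y).2 ((hEw U y).1 hy)) (fun a _ _ h => (hζrb a).2 ((hErb U a).1 h))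
        fun a _ _ ⟨y, hy⟩ => (hζwr a).2 (by rwa [hEwr] at hy)
  have hζM : O.Valid M ζ := by
    refine hsel.valid_snoc hMw hMs hηM happ' hr'O (fun _ => rfl)
      (fun y hy => hωne y ((hr'r y).1 hy)) (fun y hy => ?_) fun y hy => hω' y (mt (hr'r y).2 hy)
    rw [hωpick y ((hr'r y).1 hy)]
    change _ = (ζ.restrict (ζ.sees M y r')).pick true k
    rw [hseesζ y M subset_rfl]
    exact (pick_restrict_congr (fun a ha => hBξ (hseesB y ha)) (fun a ha => hspζ.mem' a (hseesB y ha))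
      (fun a ha d hd => hspζ.rb a (hseesB y ha) d (hseesB y hd))
      (fun a ha d hd => hspζ.ar a (hseesB y ha) d (hseesB y hd)) true k).symm
  have hmζ : m ∈ ζ.wr z r' := by
    rw [hζ, Execution.snoc_wr]
    exact ⟨hz, hmpick⟩
  have hvM : ({v} : Set VisFormula) ⊆ M := Set.singleton_subset_iff.2 hv
  have hmv : m ∈ ζ.sees {v} z r' := by
    rw [hseesζ z {v} hvM]
    refine hmfrom U hmUU hUm {v} hvM ?_
    obtain ⟨ε, h0, hn, hm⟩ := OpSpec.exists_matches_of_gain hmz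
    exact ⟨v, rfl, ε, h0, hn, hm⟩
  obtain ⟨_, rfl, ε, h0, hn, hm⟩ := hmv
  exact hno ⟨ζ, hζM, z, ε, VisFormula.holdsAt_iff.2 ⟨hm, hn ▸ ⟨m, hmζ⟩⟩,
    h0 ▸ hgain z r m hr hz hmz, by rw [h0, hn]; exact hmζ⟩

/-! ### Doubling an execution -/

theorem Event.isInit_iff_replica {e : Event S} : e.IsInit ↔ e.replica? = none := by
  cases e <;> simp [Event.IsInit, Event.replica?]

theorem Execution.so_iff_session {ξ : Execution S} {a r : Event S} :
    ξ.so a r ↔ a ∈ ξ.session r ∧ ξ.ar a r :=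
  ⟨fun h => ⟨ξ.mem_session_of_so h, ξ.so_le_ar h⟩, fun h => ξ.so_of_session h.1 h.2⟩

/-- `ζ` consists of two copies of `ξ`, given by `φ false` and `φ true` and restricted to the initial
segments `B false` and `B true`, respectively. They share the initial event only, and no event of a
copy receives other events of the other copy. In arbitration order, each event of the first copy
immediately precedes the corresponding event of the second one. -/
structure Doubling (ξ ζ : Execution S) (ι : Bool → S.Replica → S.Replica)
    (B : Bool → Set (Event S)) (φ : Bool → Event S → Event S) : Prop where
  down : ∀ c a r, r ∈ B c → ξ.ar a r → a ∈ B c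
  sub : ∀ c, B c ⊆ ξ.events
  mem : ∀ c, ∀ a ∈ B c, φ c a ∈ ζ.events
  surj : ∀ e ∈ ζ.events, ∃ c, ∃ a ∈ B c, e = φ c a
  init : ∀ c, ∀ a ∈ B c, a.IsInit → φ c a = a
  replica : ∀ c, ∀ a ∈ B c, (φ c a).replica? = a.replica?.map (ι c)
  ar : ∀ c, ∀ a ∈ B c, ∀ d, ∀ r ∈ B d, ζ.ar (φ c a) (φ d r) ↔
    ξ.ar a r ∨ a = r ∧ ¬ a.IsInit ∧ c = false ∧ d = true
  rb : ∀ c, ∀ a ∈ B c, ∀ d, ∀ r ∈ B d, ζ.rb (φ c a) (φ d r) ↔ ξ.rb a r ∧ (c = d ∨ a.IsInit)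
  wr : ∀ c, ∀ r ∈ B c, ∀ y, ζ.wr y (φ c r) = φ c '' ξ.wr y r
  writes : ∀ c, ∀ a ∈ B c, ∀ y, ζ.Writes (φ c a) y ↔ ξ.Writes a y

namespace Doubling

variable {ξ ζ : Execution S} {ι : Bool → S.Replica → S.Replica} {B : Bool → Set (Event S)}
  {φ : Bool → Event S → Event S}

theorem isInit_iff (h : Doubling ξ ζ ι B φ) {c : Bool} {a : Event S} (ha : a ∈ B c) :
    (φ c a).IsInit ↔ a.IsInit := by
  rw [Event.isInit_iff_replica, Event.isInit_iff_replica, h.replica c a ha, Option.map_eq_none_iff]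

theorem inj (h : Doubling ξ ζ ι B φ) {c d : Bool} {a r : Event S} (ha : a ∈ B c) (hr : r ∈ B d)
    (heq : φ c a = φ d r) : a = r ∧ (c = d ∨ a.IsInit) := by
  have har : a = r := by
    by_contra hne
    rcases ξ.ar_total a (h.sub c ha) r (h.sub d hr) hne with h1 | h1
    · have h2 := (h.ar c a ha d r hr).2 (.inl h1)
      rw [heq] at h2
      exact ζ.ar_irrefl _ h2
    · have h2 := (h.ar d r hr c a ha).2 (.inl h1)
      rw [heq] at h2
      exact ζ.ar_irrefl _ h2
  subst har
  refine ⟨rfl, ?_⟩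
  by_contra! hcon
  obtain ⟨hcd, hai⟩ := hcon
  cases c <;> cases d
  · exact hcd rfl
  · have h2 := (h.ar false a ha true a hr).2 (.inr ⟨rfl, hai, rfl, rfl⟩)
    rw [heq] at h2
    exact ζ.ar_irrefl _ h2
  · have h2 := (h.ar false a hr true a ha).2 (.inr ⟨rfl, hai, rfl, rfl⟩)
    rw [heq] at h2
    exact ζ.ar_irrefl _ h2
  · exact hcd rfl

theorem init_mem (h : Doubling ξ ζ ι B φ) {c : Bool} {a r : Event S} (ha : a ∈ ξ.events)
    (hai : a.IsInit) (hr : r ∈ B c) : a ∈ B c := by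
  by_cases hri : r.IsInit
  · rwa [ξ.init_unique ha (h.sub c hr) hai hri]
  · exact h.down c a r hr (ξ.so_le_ar (ξ.init_so ha hai (h.sub c hr) hri))

theorem so (h : Doubling ξ ζ ι B φ) (hι : ∀ c c' ρ ρ', ι c ρ = ι c' ρ' → c = c' ∧ ρ = ρ')
    {c d : Bool} {a r : Event S} (ha : a ∈ B c) (hr : r ∈ B d) :
    ζ.so (φ c a) (φ d r) ↔ ξ.so a r ∧ (c = d ∨ a.IsInit) := by
  simp only [Execution.so_iff_session, Execution.session, Set.mem_ofPred_eq, h.isInit_iff ha,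
    h.replica c a ha, h.replica d r hr, h.ar c a ha d r hr, h.mem c a ha, h.sub c ha, true_and]
  constructor
  · rintro ⟨h1, h2⟩
    by_cases hai : a.IsInit
    · exact ⟨⟨.inl hai, h2.resolve_right fun h => h.2.1 hai⟩, .inr hai⟩
    · have h3 := h1.resolve_left hai
      cases ha' : a.replica? with
      | none => exact absurd (Event.isInit_iff_replica.2 ha') hai
      | some ρ =>
        cases hr' : r.replica? with
        | none => rw [ha', hr'] at h3; cases h3
        | some ρ' =>
          rw [ha', hr'] at h3
          obtain ⟨h4, h5⟩ := hι c d ρ ρ' (Option.some.inj h3)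
          refine ⟨⟨.inr (by rw [h5]), h2.resolve_right ?_⟩, .inl h4⟩
          rintro ⟨-, -, rfl, h6⟩
          rw [← h4] at h6
          cases h6
  · rintro ⟨⟨h1, h2⟩, h3⟩
    refine ⟨?_, .inl h2⟩
    by_cases hai : a.IsInit
    · exact .inl hai
    · obtain rfl := h3.resolve_right hai
      exact .inr (by rw [h1.resolve_left hai])

theorem writeEmbedding (h : Doubling ξ ζ ι B φ) (c : Bool) : WriteEmbedding ξ ζ (B c) (φ c) where
  injOn _ ha _ hr heq := (h.inj ha hr heq).1
  mem _ ha := h.sub c ha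
  mem' := h.mem c
  writes := h.writes c

theorem ar_iff (h : Doubling ξ ζ ι B φ) {c : Bool} {a r : Event S} (ha : a ∈ B c) (hr : r ∈ B c) :
    ζ.ar (φ c a) (φ c r) ↔ ξ.ar a r := by
  rw [h.ar c a ha c r hr]
  refine or_iff_left ?_
  rintro ⟨-, -, rfl, h⟩
  cases h

/-- The relations other than arbitration relate events of each copy only. -/
theorem lifts (h : Doubling ξ ζ ι B φ) (hι : ∀ c c' ρ ρ', ι c ρ = ι c' ρ' → c = c' ∧ ρ = ρ')
    {p : RelExpr} (hp : p.IsSimple) (haf : p.ArbitrationFree) (c : Bool) :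
    Lifts ξ ζ (B c) (φ c) p := by
  have hinit : ∀ d, ∀ a ∈ B d, a.IsInit → ∀ r ∈ B c, a ∈ B c ∧ φ d a = φ c a := by
    intro d a ha hai r hr
    have hac := h.init_mem (h.sub d ha) hai hr
    exact ⟨hac, (h.init d a ha hai).trans (h.init c a hac hai).symm⟩
  refine ⟨fun a r hr har => ?_, fun e r hr her => ?_⟩
  · have ha := h.down c a r hr (hp.le_ar har)
    refine ⟨ha, ?_⟩
    rcases hp with rfl | rfl | rfl | rfl
    · exact (h.so hι ha hr).2 ⟨har, .inl rfl⟩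
    · obtain ⟨y, hy⟩ := har
      exact ⟨y, by rw [h.wr c r hr]; exact ⟨a, hy, rfl⟩⟩
    · exact (h.rb c a ha c r hr).2 ⟨har, .inl rfl⟩
    · exact haf.elim
  · rcases hp with rfl | rfl | rfl | rfl
    · obtain ⟨d, a, ha, rfl⟩ := h.surj e (ζ.so_mem _ _ her).1
      obtain ⟨h1, h2⟩ := (h.so hι ha hr).1 her
      rcases h2 with rfl | h2
      · exact ⟨a, ha, rfl, h1⟩
      · exact ⟨a, (hinit d a ha h2 r hr).1, (hinit d a ha h2 r hr).2, h1⟩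
    · obtain ⟨y, hy⟩ := her
      rw [h.wr c r hr] at hy
      obtain ⟨a, ha, rfl⟩ := hy
      exact ⟨a, h.down c a r hr (ξ.wr_le_ar ha), rfl, y, ha⟩
    · obtain ⟨d, a, ha, rfl⟩ := h.surj e (ζ.ar_mem _ _ (ζ.rb_le_ar _ _ her)).1
      obtain ⟨h1, h2⟩ := (h.rb d a ha c r hr).1 her
      rcases h2 with rfl | h2
      · exact ⟨a, ha, rfl, h1⟩
      · exact ⟨a, (hinit d a ha h2 r hr).1, (hinit d a ha h2 r hr).2, h1⟩
    · exact haf.elim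

/-- The events in the session of a copy of `r`. -/
theorem of_mem_session (h : Doubling ξ ζ ι B φ)
    (hι : ∀ c c' ρ ρ', ι c ρ = ι c' ρ' → c = c' ∧ ρ = ρ') {c : Bool} {r : Event S}
    (hr : r ∈ ξ.events) (hri : ¬ r.IsInit) (hrc : r ∉ B c)
    (hpre : ∀ a, ξ.ar a r → a ∈ B c)
    (hlast : ∀ d, ∀ a ∈ B d, ξ.ar a r ∨ a = r ∧ d = false ∧ c = true) {e : Event S}
    (he : e ∈ ζ.events) (he' : e.IsInit ∨ e.replica? = r.replica?.map (ι c)) :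
    ∃ a ∈ B c, e = φ c a ∧ ξ.so a r := by
  obtain ⟨d, a, ha, rfl⟩ := h.surj e he
  by_cases hai : a.IsInit
  · have h1 := ξ.init_so (h.sub d ha) hai hr hri
    have h2 := hpre a (ξ.so_le_ar h1)
    exact ⟨a, h2, (h.init d a ha hai).trans (h.init c a h2 hai).symm, h1⟩
  · have h1 := he'.resolve_left (mt (h.isInit_iff ha).1 hai)
    rw [h.replica d a ha] at h1
    cases ha' : a.replica? with
    | none => exact absurd (Event.isInit_iff_replica.2 ha') hai
    | some ρ =>
      cases hr' : r.replica? with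
      | none => exact absurd (Event.isInit_iff_replica.2 hr') hri
      | some ρ' =>
        rw [ha', hr'] at h1
        obtain ⟨rfl, rfl⟩ := hι d c ρ ρ' (Option.some.inj h1)
        have h2 : ξ.ar a r := (hlast d a ha).resolve_right fun h => hrc (h.1 ▸ ha)
        exact ⟨a, ha, rfl, ξ.so_of_session ⟨h.sub d ha, .inr (by rw [ha', hr'])⟩ h2⟩

theorem appendable (h : Doubling ξ ζ ι B φ)
    (hι : ∀ c c' ρ ρ', ι c ρ = ι c' ρ' → c = c' ∧ ρ = ρ') {c : Bool} {r : Event S}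
    (hr : r ∈ ξ.events) (hri : ¬ r.IsInit) (hrc : r ∉ B c)
    (hpre : ∀ a, ξ.ar a r → a ∈ B c)
    (hlast : ∀ d, ∀ a ∈ B d, ξ.ar a r ∨ a = r ∧ d = false ∧ c = true) {r' : Event S}
    (hr' : r' ∉ ζ.events) (hρ : r'.replica? = r.replica?.map (ι c)) :
    ζ.Appendable r' (φ c '' {a | ξ.rb a r}) fun y => φ c '' ξ.wr y r := by
  have hsess : ∀ e ∈ ζ.session r', ∃ a ∈ B c, e = φ c a ∧ ξ.so a r := fun e he =>
    h.of_mem_session hι hr hri hrc hpre hlast he.1 (he.2.imp id fun h => h.trans hρ)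
  refine ⟨hr', ?_, ?_, fun e he => ?_, fun e e' hee he' => ?_, fun y => ?_⟩
  · rw [Event.isInit_iff_replica, hρ, Option.map_eq_none_iff, ← Event.isInit_iff_replica]
    exact hri
  · rintro _ ⟨a, ha, rfl⟩
    exact h.mem c a (hpre a (ξ.rb_le_ar _ _ ha))
  · obtain ⟨a, -, rfl, h2⟩ := hsess e he
    exact ⟨a, ξ.so_le_rb _ _ h2, rfl⟩
  · obtain ⟨a', ha', rfl, h2⟩ := hsess e' he'
    obtain ⟨d, a, ha, rfl⟩ := h.surj e (ζ.ar_mem _ _ (ζ.rb_le_ar _ _ hee)).1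
    obtain ⟨h3, h4⟩ := (h.rb d a ha c a' ha').1 hee
    have h5 := ξ.rb_so h3 h2
    refine ⟨a, h5, ?_⟩
    rcases h4 with rfl | h4
    · rfl
    · exact (h.init c a (hpre a (ξ.rb_le_ar _ _ h5)) h4).trans (h.init d a ha h4).symm
  · rintro _ ⟨a, ha, rfl⟩
    exact ⟨a, ξ.wr_le_rb _ _ _ ha, rfl⟩

open Classical in
/-- Appending a copy of the next event. -/
theorem snoc (h : Doubling ξ ζ ι B φ) {c : Bool} {r : Event S}
    (hr : r ∈ ξ.events) (hri : ¬ r.IsInit) (hrc : r ∉ B c)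
    (hpre : ∀ a, ξ.ar a r → a ∈ B c)
    (hlast : ∀ d, ∀ a ∈ B d, ξ.ar a r ∨ a = r ∧ d = false ∧ c = true) {r' : Event S}
    (hρ : r'.replica? = r.replica?.map (ι c)) {g : S.Obj → Option S.Val}
    (hg : ∀ y, (g y).isSome ↔ ξ.Writes r y)
    (happ : ζ.Appendable r' (φ c '' {a | ξ.rb a r}) fun y => φ c '' ξ.wr y r) :
    Doubling ξ (ζ.snoc r' _ _ g happ) ι (Function.update B c (insert r (B c)))
      (Function.update φ c (Function.update (φ c) r r')) := by
  have hsp := Execution.samePast_snoc (g := g) happ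
  set B' := Function.update B c (insert r (B c)) with hB'
  set φ' := Function.update φ c (Function.update (φ c) r r') with hφ'
  have hφr : φ' c r = r' := by simp [hφ']
  have hB : ∀ d, ∀ a ∈ B' d, (a = r ∧ d = c) ∨ a ∈ B d := by
    intro d a ha
    by_cases hdc : d = c
    · subst hdc
      rw [hB', Function.update_self] at ha
      exact ha.imp (fun h => ⟨h, rfl⟩) id
    · rw [hB', Function.update_of_ne hdc] at ha
      exact .inr ha
  have hφ : ∀ d, ∀ a ∈ B d, φ' d a = φ d a := by
    intro d a ha
    by_cases hdc : d = c
    · subst hdc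
      rw [hφ', Function.update_self, Function.update_of_ne]
      rintro rfl
      exact hrc ha
    · rw [hφ', Function.update_of_ne hdc]
  have hBB : ∀ d, B d ⊆ B' d := by
    intro d
    by_cases hdc : d = c
    · subst hdc
      rw [hB', Function.update_self]
      exact Set.subset_insert _ _
    · rw [hB', Function.update_of_ne hdc]
  have hrB' : r ∈ B' c := by rw [hB', Function.update_self]; exact .inl rfl
  have hnotr : ∀ a, ¬ (ζ.snoc r' _ _ g happ).ar r' a := by
    rintro a (h1 | ⟨rfl, h1⟩)
    · exact happ.fresh (ζ.ar_mem _ _ h1).1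
    · exact happ.fresh h1
  refine ⟨?_, ?_, ?_, ?_, ?_, ?_, ?_, ?_, ?_, ?_⟩
  · intro d a e he hae
    rcases hB d e he with ⟨rfl, rfl⟩ | he
    · exact hBB _ (hpre a hae)
    · exact hBB _ (h.down d a e he hae)
  · intro d a ha
    rcases hB d a ha with ⟨rfl, -⟩ | ha
    · exact hr
    · exact h.sub d ha
  · intro d a ha
    rcases hB d a ha with ⟨rfl, rfl⟩ | ha
    · rw [hφr]; exact .inl rfl
    · rw [hφ d a ha]; exact .inr (h.mem d a ha)
  · rintro e (rfl | he)
    · exact ⟨c, r, hrB', hφr.symm⟩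
    · obtain ⟨d, a, ha, rfl⟩ := h.surj e he
      exact ⟨d, a, hBB d ha, (hφ d a ha).symm⟩
  · intro d a ha hai
    rcases hB d a ha with ⟨rfl, rfl⟩ | ha
    · exact absurd hai hri
    · rw [hφ d a ha]; exact h.init d a ha hai
  · intro d a ha
    rcases hB d a ha with ⟨rfl, rfl⟩ | ha
    · rw [hφr]; exact hρ
    · rw [hφ d a ha]; exact h.replica d a ha
  · intro d a ha₀ d' e he₀
    rcases hB d a ha₀ with ⟨rfl, rfl⟩ | ha
    · rw [hφr]
      refine ⟨fun h1 => absurd h1 (hnotr _), ?_⟩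
      rcases hB d' e he₀ with ⟨rfl, rfl⟩ | he
      · rintro (h1 | ⟨-, -, rfl, h1⟩)
        · exact absurd h1 (ξ.ar_irrefl _)
        · cases h1
      · rintro (h1 | ⟨rfl, -, rfl, rfl⟩)
        · rcases hlast d' e he with h2 | ⟨rfl, -⟩
          · exact absurd h2 (ξ.ar_asymm h1)
          · exact absurd h1 (ξ.ar_irrefl _)
        · rcases hlast true a he with h2 | ⟨-, h2, -⟩
          · exact absurd h2 (ξ.ar_irrefl _)
          · cases h2
    · rw [hφ d a ha]
      rcases hB d' e he₀ with ⟨rfl, rfl⟩ | he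
      · rw [hφr]
        refine ⟨fun _ => (hlast d a ha).imp id fun h => ?_,
          fun _ => (Execution.snoc_ar happ).2 (h.mem d a ha)⟩
        obtain ⟨rfl, h2⟩ := h
        exact ⟨rfl, hri, h2⟩
      · rw [hφ d' e he, hsp.ar _ (h.mem d a ha) _ (h.mem d' e he)]
        exact h.ar d a ha d' e he
  · intro d a ha₀ d' e he₀
    rcases hB d a ha₀ with ⟨rfl, rfl⟩ | ha
    · rw [hφr]
      refine ⟨fun h1 => absurd (Execution.rb_le_ar _ _ _ h1) (hnotr _), ?_⟩
      rcases hB d' e he₀ with ⟨rfl, rfl⟩ | he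
      · exact fun h1 => absurd h1.1 (ξ.rb_irrefl _)
      · rintro ⟨h1, h2⟩
        obtain rfl := h2.resolve_right hri
        exact absurd (h.down d a e he (ξ.rb_le_ar _ _ h1)) hrc
    · rw [hφ d a ha]
      rcases hB d' e he₀ with ⟨rfl, rfl⟩ | he
      · rw [hφr, Execution.snoc_rb happ]
        constructor
        · rintro ⟨a', ha', h1⟩
          have h2 := hpre a' (ξ.rb_le_ar _ _ ha')
          obtain ⟨rfl, h3⟩ := h.inj h2 ha h1
          exact ⟨ha', h3.imp Eq.symm id⟩
        · rintro ⟨h1, h2⟩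
          have h3 := hpre a (ξ.rb_le_ar _ _ h1)
          refine ⟨a, h1, ?_⟩
          rcases h2 with rfl | h2
          · rfl
          · exact (h.init d' a h3 h2).trans (h.init d a ha h2).symm
      · rw [hφ d' e he, hsp.rb _ (h.mem d a ha) _ (h.mem d' e he)]
        exact h.rb d a ha d' e he
  · intro d e he y
    have himage : ∀ e, (∀ a ∈ ξ.wr y e, a ∈ B d) → φ' d '' ξ.wr y e = φ d '' ξ.wr y e :=
      fun e he => Set.image_congr fun a ha => hφ d a (he a ha)
    rcases hB d e he with ⟨rfl, rfl⟩ | he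
    · rw [hφr, Execution.snoc_wr, himage e fun a ha => hpre a (ξ.wr_le_ar ha)]
    · rw [hφ d e he, hsp.wr _ (h.mem d e he), h.wr d e he,
        himage e fun a ha => h.down d a e he (ξ.wr_le_ar ha)]
  · intro d a ha y
    rcases hB d a ha with ⟨rfl, rfl⟩ | ha
    · rw [hφr, Execution.Writes, Execution.snoc_wval, ← Option.isSome_iff_exists]
      exact hg y
    · rw [hφ d a ha, hsp.writes (h.mem d a ha)]
      exact h.writes d a ha y

/-- In a doubled execution, an event can see what its original sees, but a formula with `ar` lets an
event of the first copy also see an event of the second copy, which is arbitrated after the event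
that is read. -/
theorem false_of_ar (hsel : O.Selects true k) {M : Set VisFormula} (hM : ∀ v ∈ M, v.WellFormed)
    (hMs : ∀ v ∈ M, v.IsSimple) (hι : ∀ c c' ρ ρ', ι c ρ = ι c' ρ' → c = c' ∧ ρ = ρ')
    (h : Doubling ξ ζ ι (fun _ => ξ.events) φ) (hζ : O.Valid M ζ) {v : VisFormula} (hv : v ∈ M)
    {i : ℕ} (hi : i < v.rels.length) (hiar : v.rels[i] = .ar) {x : S.Obj} {ε : ℕ → Event S}
    (hh : v.HoldsAt ξ x ε) (hε : ¬ (ε 0).IsInit) (hread : ε 0 ∈ ξ.wr x (ε v.rels.length)) :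
    False := by
  have hvw := hM v hv
  have hn := hh.mem v.rels.length le_rfl
  have h0 := hh.mem 0 (Nat.zero_le _)
  have hmatch : v.Matches ζ x fun j => φ (decide (j ≤ i)) (ε j) := by
    refine ⟨fun j hj => h.mem _ _ (hh.mem j hj), fun j hj => ?_, fun E hE j hj => ?_,
      fun E hE => ?_⟩
    · have hj0 := hh.mem j hj.le
      have hj1 := hh.mem (j + 1) hj
      have h1 := hh.rel j hj
      by_cases hji : j = i
      · subst hji
        rw [hiar] at h1 ⊢
        exact (h.ar _ _ hj0 _ _ hj1).2 (.inl h1)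
      · have hdec : decide (j + 1 ≤ i) = decide (j ≤ i) := by
          rw [decide_eq_decide]
          omega
        have hp := hMs v hv _ (List.getElem_mem hj)
        rw [hdec]
        generalize v.rels[j] = p at h1 hp
        rcases hp with rfl | rfl | rfl | rfl
        · exact (h.so hι hj0 hj1).2 ⟨h1, .inl rfl⟩
        · obtain ⟨y, hy⟩ := h1
          exact ⟨y, by rw [h.wr _ _ hj1]; exact ⟨_, hy, rfl⟩⟩
        · exact (h.rb _ _ hj0 _ _ hj1).2 ⟨h1, .inl rfl⟩
        · exact (h.ar_iff hj0 hj1).2 h1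
    · exact (h.writes _ _ (hh.mem j (hvw.confx_le E hE j hj)) x).2 (hh.confx E hE j hj)
    · obtain ⟨y, hy⟩ := hh.conf E hE
      exact ⟨y, fun j hj => (h.writes _ _ (hh.mem j (hvw.conf_le E hE j hj)) y).2 (hy j hj)⟩
  have hsee : φ true (ε 0) ∈ ζ.sees M x (φ false (ε v.rels.length)) := by
    refine ⟨v, hv, fun j => φ (decide (j ≤ i)) (ε j), ?_, ?_, hmatch⟩
    · simp
    · simp only [decide_eq_false (not_le.2 hi)]
  have hwr := h.wr false _ hn x
  have hfirst : φ false (ε 0) ∈ ζ.wr x (φ false (ε v.rels.length)) := by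
    rw [hwr]; exact ⟨_, hread, rfl⟩
  have hval := hsel.valid_iff.1 hζ _ (h.mem false _ hn)
  have hx := (hsel.isExecution hM hζ).reads_of_mem_wr hfirst
  rw [hval.reads x hx] at hfirst
  obtain ⟨h1, h2⟩ := (Context.mem_pick_true _).1 hfirst
  have har : ζ.ar (φ false (ε 0)) (φ true (ε 0)) :=
    (h.ar _ _ h0 _ _ h0).2 (.inr ⟨rfl, hε, rfl, rfl⟩)
  have hsecond : φ true (ε 0) ∈ ζ.wr x (φ false (ε v.rels.length)) := by
    rw [hval.reads x hx]
    refine (Context.mem_pick_true _).2 ⟨⟨h.mem _ _ h0, hsee⟩, (Set.encard_le_encard ?_).trans h2⟩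
    rintro d ⟨hd, rfl | hd'⟩
    · exact ⟨hd, .inr ⟨har, h1.2, hsee⟩⟩
    · exact ⟨hd, .inr ⟨ζ.ar_trans _ _ _ har hd'.1, h1.2, hd'.2.2⟩⟩
  rw [hwr] at hsecond
  obtain ⟨a, ha, heq⟩ := hsecond
  obtain ⟨rfl, h3 | h3⟩ := h.inj (ξ.wr_mem _ _ _ ha).1 h0 heq
  · cases h3
  · exact hε h3

end Doubling

/-- A copy of the next event can be appended to a doubled execution. -/
theorem Simulable.exists_doubling_insert [LinearOrder S.Obj] [Infinite S.Id]
    (hsim : Simulable O true)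
    (hsel : O.Selects true k) (hO : O.StandingAssumptions) {N : Set VisFormula}
    (hN : O.IsConsistencyModel N) (hs : ∀ v ∈ N, v.IsSimple) (haf : ArbitrationFree N)
    {ξ ζ : Execution S} {ι : Bool → S.Replica → S.Replica} {B : Bool → Set (Event S)}
    {φ : Bool → Event S → Event S} (hι : ∀ c c' ρ ρ', ι c ρ = ι c' ρ' → c = c' ∧ ρ = ρ')
    (hξ : O.Valid N ξ) (h : Doubling ξ ζ ι B φ) (hζ : O.Valid N ζ) {c : Bool} {r : Event S}
    (hr : r ∈ ξ.events) (hri : ¬ r.IsInit) (hrc : r ∉ B c) (hpre : ∀ a, ξ.ar a r → a ∈ B c)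
    (hlast : ∀ d, ∀ a ∈ B d, ξ.ar a r ∨ a = r ∧ d = false ∧ c = true) :
    ∃ ζ' φ', Doubling ξ ζ' ι (Function.update B c (insert r (B c))) φ' ∧ O.Valid N ζ' := by
  classical
  have hE := hsel.isExecution hN.wellFormed hξ
  have hval := hsel.valid_iff.1 hξ r hr
  obtain ⟨ρ, hρ⟩ : ∃ ρ, r.replica? = some ρ := by
    cases r with
    | init s => exact absurd trivial hri
    | call i ρ o => exact ⟨ρ, rfl⟩
  have hρ' : r.replica?.map (ι c) = some (ι c ρ) := by rw [hρ]; rfl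
  have hseesB : ∀ y, ξ.sees N y r ⊆ B c := fun y a ha =>
    hpre a (Execution.sees_ar hN.wellFormed hs ha)
  have hpick : ∀ y, (ζ.restrict (φ c '' ξ.sees N y r)).pick true k =
      φ c '' (ξ.restrict (ξ.sees N y r)).pick true k := fun y =>
    pick_true_image (h.writeEmbedding c) (fun a ha d hd => h.ar_iff ha hd) (hseesB y) k
  have hω : ∀ y, O.Reads r y → φ c '' ξ.wr y r = (ζ.restrict (φ c '' ξ.sees N y r)).pick true k :=
    fun y hy => by rw [hpick, hval.reads y hy]
  have hω' : ∀ y, ¬ O.Reads r y → φ c '' ξ.wr y r = ∅ := fun y hy => by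
    rw [hval.no_reads y hy, Set.image_empty]
  have hne : ∀ y, O.Reads r y → (φ c '' ξ.wr y r).Nonempty := fun y hy =>
    (hval.nonempty y hy).image _
  obtain ⟨r', hr'O, hr'ζ, hr'ρ, hr'r, hr'w⟩ := hsim.exists_event hsel hO
    (hsel.sessionFaithful hN hζ) hval.mem hri (ρ := ι c ρ)
    (fun r' h1 h2 => h.appendable hι hr hri hrc hpre hlast h1 (h2.trans hρ'.symm)) (fun y hy => by
      refine ⟨φ c '' ξ.sees N y r, ?_, ?_, fun e he hey => ?_, hω y hy⟩
      · rintro _ ⟨a, ha, rfl⟩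
        exact h.mem c a (hseesB y ha)
      · rintro _ ⟨a, ha, rfl⟩
        exact (h.writes c a (hseesB y ha) y).2 (Execution.sees_writes hN.wellFormed ha)
      · obtain ⟨a, ha, rfl, hso⟩ := h.of_mem_session hι hr hri hrc hpre hlast he.1
          (he.2.imp id fun h => h.trans hρ'.symm)
        obtain ⟨w, hw, H⟩ := hN.so_visible
        have hne := hval.nonempty y hy
        exact ⟨a, ⟨w, hw, (Execution.holds_iff hne).1
          (H ξ hE y a r hso ((h.writes c a ha y).1 hey) hne)⟩, rfl⟩)
    hω' hne (W := {y | ξ.Writes r y}) (fun y hy => hE.mayWrite hr hy)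
    (fun y hy => hE.writes_of_always hr hy)
  have happ := h.appendable hι hr hri hrc hpre hlast hr'ζ (hr'ρ.trans hρ'.symm)
  have hD := h.snoc hr hri hrc hpre hlast (hr'ρ.trans hρ'.symm) hr'w happ
  refine ⟨_, _, hD, hsel.valid_snoc hN.wellFormed hs hζ happ hr'O (fun _ => rfl)
    (fun y hy => hne y ((hr'r y).1 hy)) (fun y hy => ?_) fun y hy => hω' y (mt (hr'r y).2 hy)⟩
  have hrB : r ∈ Function.update B c (insert r (B c)) c := by
    rw [Function.update_self]; exact .inl rfl
  have hsees := ((hD.writeEmbedding c).sees_image hN.wellFormed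
    (fun w hw p hp => hD.lifts hι (hs w hw p hp) (haf w hw p hp) c) hrB y).1
  rw [Function.update_self, Function.update_self] at hsees
  have himage : Function.update (φ c) r r' '' ξ.sees N y r = φ c '' ξ.sees N y r := by
    refine Set.image_congr fun a ha => Function.update_of_ne ?_ _ _
    rintro rfl
    exact hrc (hseesB y ha)
  rw [hsees, himage, hω y ((hr'r y).1 hy)]
  have hsub : φ c '' ξ.sees N y r ⊆ ζ.events := by
    rintro _ ⟨a, ha, rfl⟩
    exact h.mem c a (hseesB y ha)
  have hsp := Execution.samePast_snoc
    (g := fun y => O.writtenValue ζ r' y (φ c '' ξ.wr y r)) happ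
  exact (pick_restrict_congr hsub (fun a ha => hsp.mem' a (hsub ha))
    (fun a ha d hd => hsp.rb a (hsub ha) d (hsub hd))
    (fun a ha d hd => hsp.ar a (hsub ha) d (hsub hd)) true k).symm

theorem Simulable.exists_doubling [LinearOrder S.Obj] [Infinite S.Id]
    (hsim : Simulable O true)
    (hsel : O.Selects true k) (hO : O.StandingAssumptions) {N : Set VisFormula}
    (hN : O.IsConsistencyModel N) (hs : ∀ v ∈ N, v.IsSimple) (haf : ArbitrationFree N)
    {ξ : Execution S} {ι : Bool → S.Replica → S.Replica}
    (hι : ∀ c c' ρ ρ', ι c ρ = ι c' ρ' → c = c' ∧ ρ = ρ') (hξ : O.Valid N ξ) :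
    ∃ ζ φ, Doubling ξ ζ ι (fun _ => ξ.events) φ ∧ O.Valid N ζ := by
  have hE := hsel.isExecution hN.wellFormed hξ
  obtain ⟨i₀, hi₀ξ, hi₀, -⟩ := ξ.exists_init
  have key : ∀ (n : ℕ) (C : Set (Event S)), C.ncard = n → C ⊆ ξ.events → i₀ ∈ C →
      (∀ a, ∀ r ∈ C, ξ.ar a r → a ∈ C) →
      ∃ ζ φ, Doubling ξ ζ ι (fun _ => C) φ ∧ O.Valid N ζ := by
    intro n
    induction n with
    | zero =>
      intro C hC hCξ hi _
      rw [(Set.ncard_eq_zero (ξ.finite.subset hCξ)).1 hC] at hi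
      exact absurd hi (Set.notMem_empty _)
    | succ n ih =>
      intro C hC hCξ hi hdown
      obtain ⟨r, hrC, hmax⟩ := exists_maximal_rel ξ.ar_irrefl ξ.ar_trans (ξ.finite.subset hCξ)
        ⟨i₀, hi⟩
      have hlt : ∀ a ∈ C, a ≠ r → ξ.ar a r := fun a ha har =>
        (ξ.ar_total a (hCξ ha) r (hCξ hrC) har).resolve_right (hmax a ha)
      by_cases hri : r.IsInit
      · obtain rfl := ξ.init_unique hi₀ξ (hCξ hrC) hi₀ hri
        have hCe : ∀ a ∈ C, a = i₀ := by
          intro a ha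
          by_contra hne
          exact ξ.not_ar_init hi₀ (hlt a ha hne)
        have hval := hsel.valid_initial N hi₀ (hE.events_subset hi₀ξ)
        refine ⟨O.initial i₀ hi₀, fun _ => id, ⟨fun _ a e he => hdown a e he, fun _ => hCξ, fun _ a ha => hCe a ha,
          fun e he => ⟨true, i₀, hi, he⟩, fun _ _ _ _ => rfl, fun _ a ha => ?_,
          fun c a ha d e he => ?_, fun c a ha d e he => ?_, fun c e he y => ?_,
          fun c a ha y => ?_⟩, hval⟩
        · rw [hCe a ha, id, Event.isInit_iff_replica.1 hi₀]; rfl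
        · rw [hCe a ha, hCe e he]
          refine ⟨fun h => h.elim, fun h => absurd h ?_⟩
          rintro (h | ⟨-, h, -⟩)
          · exact ξ.ar_irrefl _ h
          · exact h hi₀
        · rw [hCe a ha, hCe e he]
          exact ⟨fun h => h.elim, fun h => absurd h.1 (ξ.rb_irrefl _)⟩
        · rw [hCe e he, Set.image_id]
          refine (Set.eq_empty_of_forall_notMem fun a ha => ?_).symm
          exact ξ.not_ar_init hi₀ (ξ.wr_le_ar ha)
        · rw [hCe a ha]
          exact iff_of_true ((hsel.isExecution hN.wellFormed hval).init_writes rfl hi₀ y)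
            (hE.init_writes hi₀ξ hi₀ y)
      · have hsplit : insert r (C \ {r}) = C := Set.insert_sdiff_self_of_mem hrC
        obtain ⟨ζ, φ, h1, h2⟩ := ih (C \ {r})
          (by rw [Set.ncard_sdiff_singleton_of_mem hrC, hC]; rfl)
          (Set.sdiff_subset.trans hCξ) ⟨hi, fun h => hri (h ▸ hi₀)⟩ (by
            rintro a e ⟨he, her⟩ hae
            refine ⟨hdown a e he hae, ?_⟩
            rintro rfl
            exact hmax e he hae)
        have hpre : ∀ a, ξ.ar a r → a ∈ C \ {r} := by
          intro a ha
          refine ⟨hdown a r hrC ha, ?_⟩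
          rintro rfl
          exact ξ.ar_irrefl _ ha
        obtain ⟨ζ₁, φ₁, h3, h4⟩ := hsim.exists_doubling_insert hsel hO hN hs haf hι hξ h1 h2
          (c := false) (hCξ hrC) hri (fun h => h.2 rfl) hpre
          fun d a ha => .inl (hlt a ha.1 ha.2)
        have hBf : Function.update (fun _ => C \ {r}) false (insert r (C \ {r})) false = C := by
          rw [Function.update_self, hsplit]
        have hBt : Function.update (fun _ => C \ {r}) false (insert r (C \ {r})) true =
            C \ {r} := Function.update_of_ne (by simp) _ _
        obtain ⟨ζ₂, φ₂, h5, h6⟩ := hsim.exists_doubling_insert hsel hO hN hs haf hι hξ h3 h4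
          (c := true) (hCξ hrC) hri (by rw [hBt]; exact fun h => h.2 rfl)
          (by rw [hBt]; exact hpre) (by
            intro d a ha
            cases d
            · rw [hBf] at ha
              by_cases har : a = r
              · exact .inr ⟨har, rfl, rfl⟩
              · exact .inl (hlt a ha har)
            · rw [hBt] at ha
              exact .inl (hlt a ha.1 ha.2))
        refine ⟨ζ₂, φ₂, ?_, h6⟩
        convert h5 using 1
        funext d
        cases d
        · rw [Function.update_of_ne (by simp), hBf]
        · rw [Function.update_self, hBt, hsplit]
  exact key _ ξ.events rfl subset_rfl hi₀ξ fun a r _ h => (ξ.ar_mem _ _ h).1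

theorem exists_injective_bool_prod (α : Type u) [Infinite α] :
    ∃ ι : Bool → α → α, ∀ c c' ρ ρ', ι c ρ = ι c' ρ' → c = c' ∧ ρ = ρ' := by
  obtain ⟨e⟩ : Nonempty (α ⊕ α ≃ α) := by
    rw [← Cardinal.eq, Cardinal.mk_sum, Cardinal.lift_id]
    exact Cardinal.add_eq_self (Cardinal.aleph0_le_mk α)
  refine ⟨fun c ρ => e (if c then .inl ρ else .inr ρ), fun c c' ρ ρ' h => ?_⟩
  have h := e.injective h
  cases c <;> cases c' <;> simp at h ⊢ <;> exact h

/-! ### Normal forms -/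

/-- A normal form that is equivalent to an arbitration-free one is arbitration-free. -/
theorem arbitrationFree_of_equivalent [LinearOrder S.Obj] [Infinite S.Obj] [Infinite S.Id]
    [Infinite S.Replica] (hO : O.StandingAssumptions) {N M C : Set VisFormula}
    (hN : O.IsNormalFormOf N C) (hM : O.IsNormalFormOf M C) (haf : ArbitrationFree N) :
    ArbitrationFree M := by
  classical
  obtain ⟨b, k, hsel⟩ := OpSpec.exists_selects hO.maximallyLayered hO.operationClosure.exists_read
  have hNc := hN.isConsistencyModel
  have hMc := hM.isConsistencyModel
  have hNs := hN.inNormalForm.simple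
  have hMs := hM.inNormalForm.simple
  have hNM : ∀ ξ : Execution S, O.Valid N ξ → O.Valid M ξ := fun ξ h =>
    (hM.equivalent ξ).2 ((hN.equivalent ξ).1 h)
  have hMN : ∀ ξ : Execution S, O.Valid M ξ → O.Valid N ξ := fun ξ h =>
    (hN.equivalent ξ).2 ((hM.equivalent ξ).1 h)
  by_contra hnot
  obtain ⟨v, hv, hva⟩ : ∃ v ∈ M, ¬ v.ArbitrationFree := by
    simpa [ArbitrationFree] using hnot
  -- the last occurrence of `ar`
  obtain ⟨i, hi, hiar, hlast⟩ : ∃ (i : ℕ) (hi : i < v.rels.length), v.rels[i] = .ar ∧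
      ∀ (j : ℕ) (hj : j < v.rels.length), i < j → v.rels[j] ≠ .ar := by
    obtain ⟨j, hj, hjar⟩ : ∃ (j : ℕ) (hj : j < v.rels.length), v.rels[j] = .ar := by
      by_contra! hcon
      refine hva fun p hp => ?_
      obtain ⟨j, hj, rfl⟩ := List.getElem_of_mem hp
      have h1 := hcon j hj
      have h2 := hMs v hv _ (List.getElem_mem hj)
      generalize v.rels[j] = p at h1 h2
      rcases h2 with rfl | rfl | rfl | rfl
      · trivial
      · trivial
      · trivial
      · exact absurd rfl h1
    set J := (Finset.range v.rels.length).filter fun j => v.rels[j]? = some .ar with hJ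
    have hmem : ∀ j, j ∈ J ↔ ∃ hj : j < v.rels.length, v.rels[j] = .ar := by
      intro j
      simp only [hJ, Finset.mem_filter, Finset.mem_range, List.getElem?_eq_some_iff]
      exact ⟨fun h => h.2, fun h => ⟨h.1, h⟩⟩
    have hne : J.Nonempty := ⟨j, (hmem j).2 ⟨hj, hjar⟩⟩
    obtain ⟨hi, hiar⟩ := (hmem _).1 (J.max'_mem hne)
    exact ⟨J.max' hne, hi, hiar, fun j hj hij hjar =>
      absurd (J.le_max' j ((hmem j).2 ⟨hj, hjar⟩)) (not_le.2 hij)⟩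
  have hnv := hM.inNormalForm.not_vacuous v hv
  obtain ⟨ξ, hξ, r, hr, x, hx, hne⟩ := hsel.exists_pick_ne hnv
  have hE : O.IsExecution ξ := hξ.elim (hsel.isExecution hMc.wellFormed)
    (hsel.isExecution fun w hw => hMc.wellFormed w hw.1)
  obtain ⟨i₀, hi₀ξ, hi₀, -⟩ := ξ.exists_init
  have hi₀O := hE.events_subset hi₀ξ
  have hdouble : ∀ hsel : O.Selects true k, Simulable O true → False := by
    intro hsel hsim
    obtain ⟨ξ₁, hξ₁, x₁, ε, hh, hε, hread⟩ :=
      hsim.hasReadInstance hsel hO hNc hNs haf hNM hMc hMs hv hnv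
    obtain ⟨ι, hι⟩ := exists_injective_bool_prod S.Replica
    obtain ⟨ζ, φ, hD, hζ⟩ := hsim.exists_doubling hsel hO hNc hNs haf hι (hMN ξ₁ hξ₁)
    exact hD.false_of_ar hsel hMc.wellFormed hMs hι (hNM ζ hζ) hv hi hiar hh hε hread
  by_cases hcond : ∃ e, O.IsConditionalReadWrite e
  -- for `b = false`, layers are defined by receive-before
  · cases b
    · exact false_of_conditional_of_rb hsel hO hcond hNc hNs haf hMc.wellFormed hMs hNM hv hi hiar
        hi₀ hi₀O
    · by_cases hvar : ∀ e ∈ O.events, ¬ e.IsInit → (O.var e).Subsingleton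
      · exact hdouble hsel (.inr ⟨rfl, hvar⟩)
      · push Not at hvar
        obtain ⟨e, heO, hei, hnt⟩ := hvar
        exact false_of_conditional_of_ar hsel hO hcond heO hei
          hnt hNc hNs haf hMc.wellFormed hMs hM.closed
          hNM hv hnv hi hiar hlast hi₀ hi₀O
  · cases b
    · have hsim : Simulable O false := .inl hcond
      obtain ⟨ξ₁, hξ₁, x₁, ε, hh, hε⟩ : ∃ ξ₁, O.IsExecution ξ₁ ∧ ∃ x₁ ε,
          v.HoldsAt ξ₁ x₁ ε ∧ ¬ (ε 0).IsInit := by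
        obtain ⟨d, hd⟩ := OpSpec.gain_nonempty hne
        by_cases hdi : d.IsInit
        · obtain ⟨ξ₁, hξ₁, x₁, ε, hh, hε, -⟩ := hsim.hasReadInstance_of_soVisible hsel hO hNc hNs haf
            (OpSpec.soVisible_of_gain hMc hE hd hdi hr hx) hi₀ hi₀O
          exact ⟨ξ₁, hsel.isExecution hNc.wellFormed hξ₁, x₁, ε, hh, hε⟩
        · obtain ⟨ε, h0, hn, hm⟩ := OpSpec.exists_matches_of_gain hd
          exact ⟨ξ, hE, x, ε, VisFormula.holdsAt_iff.2 ⟨hm, hn ▸ hE.reads_nonempty r hr x hx⟩,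
            h0 ▸ hdi⟩
      exact false_of_rigid_of_rb hsel hO.operationClosure hcond hNc hNs haf hMc.wellFormed hMs hNM hv
        hi hiar hξ₁ hh hε
    · exact hdouble hsel (.inl hcond)

end DistStore

theorem theoremB9 {S : StorageSig.{u}} [LinearOrder S.Obj] [Infinite S.Obj]
    [Infinite S.Replica] [Infinite S.Id] (O : OpSpec S) (hO : O.StandingAssumptions)
    (CMod : Set VisFormula) (hCMod : O.IsConsistencyModel CMod)
    (n₁ n₂ : Set VisFormula) (h₁ : O.IsNormalFormOf n₁ CMod) (h₂ : O.IsNormalFormOf n₂ CMod) :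
    (ArbitrationFree n₁ ↔ ArbitrationFree n₂) ∧
      (O.ArbitrationFreeModel CMod ↔ ArbitrationFree n₁) := by
  refine ⟨⟨arbitrationFree_of_equivalent hO h₁ h₂, arbitrationFree_of_equivalent hO h₂ h₁⟩, ?_,
    fun h => ⟨n₁, h₁, h⟩⟩
  rintro ⟨n, hn, h⟩
  exact arbitrationFree_of_equivalent hO hn h₁ h
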